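/- Notation and setting. For a square matrix $M$, $\operatorname{He}(M)=M+M^{\mathsf T}$; $M<0$ means that the symmetric matrix $M$ is negative definite; $\bullet$ denotes blocks determined by symmetry; $|\cdot|$ is the Euclidean norm. Consider the plant $$\dot z=Az+B\psi(Sz)+Nw,\qquad y=Cz+\eta,$$ with $z\in\mathbb R^{n_z}$, $y,\eta\in\mathbb R^{n_y}$, $w\in\mathbb R^{n_w}$, where $\psi:\mathbb R^{n_q}\to\mathbb R^{n_s}$ satisfies $|\psi(v_1)-\psi(v_2)|\le \ell|v_1-v_2|$ for some $\ell>0$. The output is available only at times $t_1,t_2,\dots$ with $0\le t_1\le T_2$ and $T_1\le t_{k+1}-t_k\le T_2$ for $k\ge1$, where $0<T_1\le T_2$. For gains $L\in\mathbb R^{n_z\times n_y}$, $H\in\mathbb R^{n_y\times n_y}$ the observer is $$\dot{\hat z}=A\hat z+B\psi(S\hat z)+L\theta,\quad \dot\theta=H\theta\quad(t\ne t_k);\qquad \hat z^+=\hat z,\quad \theta^+=y-C\hat z\quad(t=t_k).$$ Put $\varepsilon=z-\hat z$, $\tilde\theta=C\varepsilon-\theta$, and let $y_p=C_p\varepsilon$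 be the performance output. The closed loop is modelled by the hybrid system $\mathcal H_e$ with state $x=(z,\varepsilon,\tilde\theta,\tau)$ and input $u=(w,\eta)$: $x$ flows while $\tau\in[0,T_2]$, according to the dynamics of $(z,\varepsilon,\tilde\theta)$ induced by the plant and the observer together with $\dot\tau=-1$, and jumps when $\tau=0$ by $z^+=z$, $\varepsilon^+=\varepsilon$, $\tilde\theta^+=-\eta$, $\tau^+\in[T_1,T_2]$. Hybrid inputs are measurable and essentially bounded on bounded time intervals, for each $j$. Let $\mathcal A=\{x:\varepsilon=0,\ \tilde\theta=0,\ \tau\in[0,T_2]\}$ and let $|x|_{\mathcal A}$ be the distance of $x$ to $\mathcal A$. Given $\lambda_t,\gamma>0$, the pair $(L,H)$ is said to solve Problem 1 if the following hold for $\mathcal H_e$. (P1) There is $\kappa>0$ such that every solution $\phi$ with $w\equiv0$, $\eta\equiv0$ satisfies $|\phi(t,j)|_{\mathcal A}\le\kappa e^{-\lambda_t t}|\phi(0,0)|_{\mathcal A}$ for all $(t,j)\in\operatorname{dom}\phi$. (P2) $\mathcal H_e$ is exponentially input-to-state stable with respect to $\mathcal A$: every maximal solution pair is complete, and there are $\kappa,\lambda>0$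 and a class-$\mathcal K$ function $\rho$ such that $|\phi(t,j)|_{\mathcal A}\le\max\{\kappa e^{-\lambda(t+j)}|\phi(0,0)|_{\mathcal A},\rho(\|u\|_\infty)\}$ for every solution pair $(\phi,u)$ with $\|u\|_\infty<\infty$ and all $(t,j)\in\operatorname{dom}\phi$. Here $\|u\|_\infty$ is the maximum of the essential supremum of $|u|$ off the jump times and its supremum over the jump times. (P3) There is $\alpha>0$ such that every solution pair with $\eta\equiv0$ satisfies $$\Big(\int_{\mathcal I}|y_p(s,j(s))|^2ds\Big)^{1/2}\le\alpha|\phi(0,0)|_{\mathcal A}+\gamma\Big(\int_{\mathcal I}|w(s,j(s))|^2ds\Big)^{1/2},$$ where $\mathcal I$ is the set of ordinary times $s$ in the domain of $\phi$ and $j(s)$ is the least $j$ with $(s,j)\in\operatorname{dom}\phi$. Moreover, the corresponding three properties are required of the plant interconnected with the observer on $[0,\infty)$, with constants uniform over all admissible sequences $(t_k)$: for $w\equiv0,\eta\equiv0$, $|(\varepsilon,\tilde\theta)(t)|\le\kappa e^{-\lambda_t t}|(\varepsilon,\tilde\theta)(0)|$; if $|w|\le W$ almost everywhere and $|\eta(t_k)|\le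 W$ for all $k\ge1$, then $|(\varepsilon,\tilde\theta)(t)|\le\max\{\kappa|(\varepsilon,\tilde\theta)(0)|,\rho(W)\}$ with $\rho$ of class $\mathcal K$; and for $\eta\equiv0$, $\|y_p\|_{\mathcal L_2}\le\alpha|(\varepsilon,\tilde\theta)(0)|+\gamma\|w\|_{\mathcal L_2}$. Proposition. Let $\lambda_t,\gamma>0$. Suppose there are symmetric positive definite matrices $P_1\in\mathbb R^{n_z\times n_z}$, $P_2\in\mathbb R^{n_y\times n_y}$, real numbers $\delta,\chi>0$, a nonsingular $X\in\mathbb R^{n_z\times n_z}$, and matrices $X_5,Y_5,X_7,Y_7\in\mathbb R^{n_y\times n_z}$, $X_6,Y_6,X_8,Y_8\in\mathbb R^{n_y\times n_y}$, $J\in\mathbb R^{n_z\times n_y}$ such that $$\begin{pmatrix}\operatorname{He}(Q_1)&Q_2+\mathcal P&Q_3&Q_4\\ \bullet&\mathcal N+\operatorname{He}(Q_5)&Q_3&Q_4\\ \bullet&\bullet&-\gamma^2I&0\\ \bullet&\bullet&\bullet&-\chi I\end{pmatrix}<0,\qquad \begin{pmatrix}\operatorname{He}(\widehat Q_1)&\widehat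 Q_2+\mathcal P_{T_2}&Q_3&Q_4\\ \bullet&\mathcal N_{T_2}+\operatorname{He}(Q_5)&Q_3&Q_4\\ \bullet&\bullet&-\gamma^2I&0\\ \bullet&\bullet&\bullet&-\chi I\end{pmatrix}<0,$$ where $$\mathcal P=\operatorname{diag}\{P_1,P_2\},\qquad \mathcal P_{T_2}=\operatorname{diag}\{P_1,e^{\delta T_2}P_2\},$$ $$\mathcal N=\operatorname{diag}\{2\lambda_tP_1+C_p^{\mathsf T}C_p+\chi\ell^2S^{\mathsf T}S,\ (2\lambda_t-\delta)P_2\},\qquad \mathcal N_{T_2}=\operatorname{diag}\{2\lambda_tP_1+C_p^{\mathsf T}C_p+\chi\ell^2S^{\mathsf T}S,\ (2\lambda_t-\delta)e^{\delta T_2}P_2\},$$ $$Q_1=\begin{pmatrix}-X+C^{\mathsf T}X_5&C^{\mathsf T}X_6\\-X_5&-X_6\end{pmatrix},\quad Q_2=\begin{pmatrix}-X+X^{\mathsf T}A-JC+C^{\mathsf T}X_7&J+C^{\mathsf T}X_8\\-X_7&-X_8\end{pmatrix},$$ $$Q_3=\begin{pmatrix}X^{\mathsf T}N\\0\end{pmatrix},\quad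 Q_4=\begin{pmatrix}X^{\mathsf T}B\\0\end{pmatrix},\quad Q_5=\begin{pmatrix}A^{\mathsf T}X-C^{\mathsf T}J^{\mathsf T}&0\\J^{\mathsf T}&0\end{pmatrix},$$ and $\widehat Q_1,\widehat Q_2$ are $Q_1,Q_2$ with $X_5,X_6,X_7,X_8$ replaced by $Y_5,Y_6,Y_7,Y_8$. Then $L=X^{-\mathsf T}J$ and $H=0$ solve Problem 1. -/

import Mathlib

open MeasureTheory Set Filter Topology
open scoped ENNReal Matrix

noncomputable section

namespace SporadicObserver

/-! ### Euclidean vectors -/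

/-- `ℝⁿ` with the Euclidean norm. -/
abbrev Vec (n : ℕ) := EuclideanSpace ℝ (Fin n)

/-- The matrix-vector product on Euclidean spaces. -/
def mv {ι κ : Type*} [Fintype κ] (M : Matrix ι κ ℝ) (x : EuclideanSpace ℝ κ) :
    EuclideanSpace ℝ ι :=
  WithLp.toLp 2 (M *ᵥ x.ofLp)

/-- The stacked vector `(x, y)`. -/
def stack {ι κ : Type*} (x : EuclideanSpace ℝ ι) (y : EuclideanSpace ℝ κ) :
    EuclideanSpace ℝ (ι ⊕ κ) :=
  WithLp.toLp 2 (Sum.elim x.ofLp y.ofLp)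

/-- The upper part of a stacked vector. -/
def upper {ι κ : Type*} (x : EuclideanSpace ℝ (ι ⊕ κ)) : EuclideanSpace ℝ ι :=
  WithLp.toLp 2 (fun i => x (Sum.inl i))

/-- The lower part of a stacked vector. -/
def lower {ι κ : Type*} (x : EuclideanSpace ℝ (ι ⊕ κ)) : EuclideanSpace ℝ κ :=
  WithLp.toLp 2 (fun i => x (Sum.inr i))

/-- Local absolute continuity on a set of times (in use: on an interval): absolute continuity on
every compact subinterval. -/
def LocallyAC {X : Type*} [PseudoMetricSpace X] (g : ℝ → X) (I : Set ℝ) : Prop :=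
  ∀ a b : ℝ, a ≤ b → Icc a b ⊆ I → AbsolutelyContinuousOnInterval g a b

/-- Class `𝒦` functions. -/
def IsClassK (ρ : ℝ → ℝ) : Prop :=
  ContinuousOn ρ (Ici 0) ∧ StrictMonoOn ρ (Ici 0) ∧ ρ 0 = 0

/-! ### Hybrid time domains and hybrid signals

A hybrid signal is a total function `ℝ → ℕ → X` together with a hybrid time domain; only its
values on the domain matter. -/

/-- Hybrid time domains: a finite or infinite union of intervals `[t j, t (j+1)] × {j}` with
`0 = t 0 ≤ t 1 ≤ ⋯`, the last interval, if there is one, being closed, or of the form `[t J, T)`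
with `T` finite or infinite. -/
def IsHybridTimeDomain (E : Set (ℝ × ℕ)) : Prop :=
  ∃ t : ℕ → ℝ, t 0 = 0 ∧ Monotone t ∧
    (E = {p | p.1 ∈ Icc (t p.2) (t (p.2 + 1))} ∨
      ∃ (J : ℕ) (I : Set ℝ),
        (I = Icc (t J) (t (J + 1)) ∨ (t J < t (J + 1) ∧ I = Ico (t J) (t (J + 1))) ∨
          I = Ici (t J)) ∧
        E = {p | (p.2 < J ∧ p.1 ∈ Icc (t p.2) (t (p.2 + 1))) ∨ (p.2 = J ∧ p.1 ∈ I)})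

/-- The interval of ordinary times `t` with `(t, j) ∈ E`. -/
def slice (E : Set (ℝ × ℕ)) (j : ℕ) : Set ℝ := {t | (t, j) ∈ E}

/-- The times just before a jump: `(t, j) ∈ E` such that `(t, j + 1) ∈ E`. -/
def jumpTimes (E : Set (ℝ × ℕ)) : Set (ℝ × ℕ) := {p | p ∈ E ∧ (p.1, p.2 + 1) ∈ E}

/-- The projection of a hybrid time domain on ordinary time. -/
def timeProj (E : Set (ℝ × ℕ)) : Set ℝ := {t | ∃ j : ℕ, (t, j) ∈ E}

/-- `j(t)`, the least `j` with `(t, j) ∈ E`. -/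
def firstIndex (E : Set (ℝ × ℕ)) (t : ℝ) : ℕ := sInf {j | (t, j) ∈ E}

/-- Hybrid inputs: measurable, and essentially bounded on bounded time intervals, for each `j`. -/
def IsHybridInput {m : Type*} [Fintype m] (E : Set (ℝ × ℕ)) (u : ℝ → ℕ → EuclideanSpace ℝ m) :
    Prop :=
  ∀ j : ℕ, AEMeasurable (fun t => u t j) (volume.restrict (slice E j)) ∧
    ∀ T : ℝ, ∃ M : ℝ, ∀ᵐ t ∂(volume : Measure ℝ), t ∈ slice E j → t ≤ T → ‖u t j‖ ≤ M

/-- The `ℒ_∞` norm of a hybrid signal with domain `E`: the maximum of the essential supremum off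
the jump times and of the supremum over the jump times. -/
def hybridSupNorm {m : Type*} [Fintype m] (E : Set (ℝ × ℕ)) (u : ℝ → ℕ → EuclideanSpace ℝ m) :
    ℝ≥0∞ :=
  max (⨆ j : ℕ, essSup (fun t => ‖u t j‖ₑ) (volume.restrict (slice (E \ jumpTimes E) j)))
    (⨆ p ∈ jumpTimes E, ‖u p.1 p.2‖ₑ)

/-! ### Hybrid systems with inputs -/

/-- The data of a hybrid system `ẋ = f(x, u)` for `x ∈ C`, `x⁺ ∈ G(x, u)` for `x ∈ D`. -/
structure HybridSystem (n m : Type*) where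
  /-- the flow map -/
  f : EuclideanSpace ℝ n → EuclideanSpace ℝ m → EuclideanSpace ℝ n
  /-- the flow set -/
  C : Set (EuclideanSpace ℝ n)
  /-- the jump map -/
  G : EuclideanSpace ℝ n → EuclideanSpace ℝ m → Set (EuclideanSpace ℝ n)
  /-- the jump set -/
  D : Set (EuclideanSpace ℝ n)

namespace HybridSystem

variable {n m : Type*} [Fintype n] [Fintype m]

/-- `(φ, u)` is a solution pair with hybrid time domain `E`. -/
structure IsSolutionPair (𝓗 : HybridSystem n m) (E : Set (ℝ × ℕ))
    (φ : ℝ → ℕ → EuclideanSpace ℝ n) (u : ℝ → ℕ → EuclideanSpace ℝ m) : Prop where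
  domain : IsHybridTimeDomain E
  input : IsHybridInput E u
  arc : ∀ j : ℕ, LocallyAC (fun t => φ t j) (slice E j)
  initial : φ 0 0 ∈ 𝓗.C ∪ 𝓗.D
  flow_mem : ∀ j : ℕ, ∀ t ∈ interior (slice E j), φ t j ∈ 𝓗.C
  flow : ∀ j : ℕ, ∀ᵐ t ∂(volume : Measure ℝ), t ∈ interior (slice E j) →
    HasDerivAt (fun s => φ s j) (𝓗.f (φ t j) (u t j)) t
  jump : ∀ (t : ℝ) (j : ℕ), (t, j) ∈ E → (t, j + 1) ∈ E →
    φ t j ∈ 𝓗.D ∧ φ t (j + 1) ∈ 𝓗.G (φ t j) (u t j)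

/-- A solution pair is maximal if it has no extension to a strictly larger domain. -/
def IsMaximal (𝓗 : HybridSystem n m) (E : Set (ℝ × ℕ))
    (φ : ℝ → ℕ → EuclideanSpace ℝ n) (u : ℝ → ℕ → EuclideanSpace ℝ m) : Prop :=
  𝓗.IsSolutionPair E φ u ∧
    ¬ ∃ (E' : Set (ℝ × ℕ)) (φ' : ℝ → ℕ → EuclideanSpace ℝ n) (u' : ℝ → ℕ → EuclideanSpace ℝ m),
      𝓗.IsSolutionPair E' φ' u' ∧ E ⊂ E' ∧
        ∀ p ∈ E, φ' p.1 p.2 = φ p.1 p.2 ∧ u' p.1 p.2 = u p.1 p.2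

/-- A hybrid time domain is that of a complete solution if it is unbounded. -/
def IsCompleteDomain (E : Set (ℝ × ℕ)) : Prop :=
  ∀ R : ℝ, ∃ p ∈ E, R ≤ p.1 + (p.2 : ℝ)

/-- Exponential input-to-state stability with respect to a set `𝓐`. -/
def IsEISS (𝓗 : HybridSystem n m) (𝓐 : Set (EuclideanSpace ℝ n)) : Prop :=
  (∃ (κ lam : ℝ) (ρ : ℝ → ℝ), 0 < κ ∧ 0 < lam ∧ IsClassK ρ ∧
    ∀ (E : Set (ℝ × ℕ)) (φ : ℝ → ℕ → EuclideanSpace ℝ n) (u : ℝ → ℕ → EuclideanSpace ℝ m),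
      𝓗.IsSolutionPair E φ u → hybridSupNorm E u ≠ ∞ →
        ∀ (t : ℝ) (j : ℕ), (t, j) ∈ E →
          Metric.infDist (φ t j) 𝓐 ≤
            max (κ * Real.exp (-lam * (t + j)) * Metric.infDist (φ 0 0) 𝓐)
              (ρ (hybridSupNorm E u).toReal)) ∧
  ∀ (E : Set (ℝ × ℕ)) (φ : ℝ → ℕ → EuclideanSpace ℝ n) (u : ℝ → ℕ → EuclideanSpace ℝ m),
    𝓗.IsMaximal E φ u → IsCompleteDomain E

end HybridSystem

/-! ### The plant, the observer and the error system -/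

/-- The plant `ż = A z + B ψ(S z) + N w`, `y = C z + η`, and the performance output matrix. -/
structure Plant (nz ny nw nq ns np : ℕ) where
  A : Matrix (Fin nz) (Fin nz) ℝ
  B : Matrix (Fin nz) (Fin ns) ℝ
  C : Matrix (Fin ny) (Fin nz) ℝ
  S : Matrix (Fin nq) (Fin nz) ℝ
  N : Matrix (Fin nz) (Fin nw) ℝ
  Cp : Matrix (Fin np) (Fin nz) ℝ
  ψ : Vec nq → Vec ns

/-- `He(M) = M + Mᵀ`. -/
def He {ι : Type*} (M : Matrix ι ι ℝ) : Matrix ι ι ℝ := M + Mᵀ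

/-- Index type of the error vector `(ε, θ̃)`. -/
abbrev ErrIx (nz ny : ℕ) := Fin nz ⊕ Fin ny

/-- Index type of the state `x = (z, (ε, θ̃), τ)`. -/
abbrev StateIx (nz ny : ℕ) := Fin nz ⊕ (ErrIx nz ny ⊕ Unit)

/-- The state `x = (z, e, τ)` with `e = (ε, θ̃)`. -/
def mkState {nz ny : ℕ} (z : Vec nz) (e : EuclideanSpace ℝ (ErrIx nz ny)) (τ : ℝ) :
    EuclideanSpace ℝ (StateIx nz ny) :=
  stack z (stack e (WithLp.toLp 2 (fun _ : Unit => τ)))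

/-- The plant state `z` in `x`. -/
def stZ {nz ny : ℕ} (x : EuclideanSpace ℝ (StateIx nz ny)) : Vec nz := upper x

/-- The error vector `(ε, θ̃)` in `x`. -/
def stE {nz ny : ℕ} (x : EuclideanSpace ℝ (StateIx nz ny)) : EuclideanSpace ℝ (ErrIx nz ny) :=
  upper (lower x)

/-- The timer `τ` in `x`. -/
def stτ {nz ny : ℕ} (x : EuclideanSpace ℝ (StateIx nz ny)) : ℝ := lower (lower x) ()

namespace Plant

variable {nz ny nw nq ns np : ℕ}

/-- `𝓕`. -/
def matF (P : Plant nz ny nw nq ns np) (L : Matrix (Fin nz) (Fin ny) ℝ)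
    (H : Matrix (Fin ny) (Fin ny) ℝ) : Matrix (ErrIx nz ny) (ErrIx nz ny) ℝ :=
  Matrix.fromBlocks (P.A - L * P.C) L (P.C * P.A - P.C * L * P.C - H * P.C) (P.C * L + H)

/-- `𝓣`. -/
def matT (P : Plant nz ny nw nq ns np) : Matrix (ErrIx nz ny) (Fin nw) ℝ :=
  Matrix.fromRows P.N (P.C * P.N)

/-- `𝓠`. -/
def matQ (P : Plant nz ny nw nq ns np) : Matrix (ErrIx nz ny) (Fin ns) ℝ :=
  Matrix.fromRows P.B (P.C * P.B)

/-- `ζ(v₁, v₂) = ψ(S v₁) - ψ(S (v₁ - v₂))`. -/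
def zeta (P : Plant nz ny nw nq ns np) (v₁ v₂ : Vec nz) : Vec ns :=
  P.ψ (mv P.S v₁) - P.ψ (mv P.S (v₁ - v₂))

/-- The hybrid system `𝓗ₑ` with state `(z, ε, θ̃, τ)` and input `u = (w, η)`, in which the timer
`τ` decreases along flows and is reset to an arbitrary point of `[T₁, T₂]` at jumps. -/
def errorSystem (P : Plant nz ny nw nq ns np) (T₁ T₂ : ℝ) (L : Matrix (Fin nz) (Fin ny) ℝ)
    (H : Matrix (Fin ny) (Fin ny) ℝ) : HybridSystem (StateIx nz ny) (Fin nw ⊕ Fin ny) where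
  f x u := mkState
    (mv P.A (stZ x) + mv P.B (P.ψ (mv P.S (stZ x))) + mv P.N (upper u))
    (mv (P.matF L H) (stE x) + mv P.matQ (P.zeta (stZ x) (upper (stE x)))
      + mv P.matT (upper u))
    (-1)
  C := {x | stτ x ∈ Icc 0 T₂}
  G x u := {x' | ∃ v ∈ Icc T₁ T₂, x' = mkState (stZ x)
    (mv (Matrix.fromBlocks 1 0 0 0 : Matrix (ErrIx nz ny) (ErrIx nz ny) ℝ) (stE x)
      + mv (Matrix.fromRows 0 (-1) : Matrix (ErrIx nz ny) (Fin ny) ℝ) (lower u)) v}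
  D := {x | stτ x = 0}

end Plant

/-- The set `𝓐` of states with `ε = 0`, `θ̃ = 0` and `τ ∈ [0, T₂]`. -/
def attractor (nz ny : ℕ) (T₂ : ℝ) : Set (EuclideanSpace ℝ (StateIx nz ny)) :=
  {x | upper (stE x) = 0 ∧ lower (stE x) = 0 ∧ stτ x ∈ Icc 0 T₂}

/-! ### The plant interconnected with the observer, for a given sequence of sampling times -/

/-- `t 1, t 2, …` is an admissible sequence of sampling times (`t 0 = 0` is the initial time,
not a sampling time); since `0 < T₁` in use, it is strictly increasing and unbounded. -/
def IsSamplingSequence (T₁ T₂ : ℝ) (t : ℕ → ℝ) : Prop :=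
  t 0 = 0 ∧ t 1 ∈ Icc 0 T₂ ∧ ∀ k : ℕ, 1 ≤ k → t (k + 1) - t k ∈ Icc T₁ T₂

/-- `(z, ẑ, θ)` is a trajectory on `[0, ∞)` of the plant with inputs `w, η` interconnected with
the observer
`ẑ' = A ẑ + B ψ(S ẑ) + L θ`, `θ' = H θ` between samples,
`ẑ⁺ = ẑ`, `θ⁺ = y - C ẑ = C z + η - C ẑ` at the sampling times `t 1, t 2, …`.
The function `θ` is left-continuous and `θ⁺` is its right limit. -/
structure IsTrajectory {nz ny nw nq ns np : ℕ} (P : Plant nz ny nw nq ns np)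
    (L : Matrix (Fin nz) (Fin ny) ℝ) (H : Matrix (Fin ny) (Fin ny) ℝ) (t : ℕ → ℝ)
    (w : ℝ → Vec nw) (η : ℝ → Vec ny) (z zhat : ℝ → Vec nz) (θ : ℝ → Vec ny) : Prop where
  w_meas : AEMeasurable w (volume.restrict (Ici 0))
  w_bdd : ∀ T : ℝ, ∃ M : ℝ, ∀ᵐ s ∂(volume : Measure ℝ), s ∈ Icc 0 T → ‖w s‖ ≤ M
  z_ac : LocallyAC z (Ici 0)
  zhat_ac : LocallyAC zhat (Ici 0)
  z_flow : ∀ᵐ s ∂(volume : Measure ℝ), 0 < s →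
    HasDerivAt z (mv P.A (z s) + mv P.B (P.ψ (mv P.S (z s))) + mv P.N (w s)) s
  zhat_flow : ∀ᵐ s ∂(volume : Measure ℝ), 0 < s →
    HasDerivAt zhat (mv P.A (zhat s) + mv P.B (P.ψ (mv P.S (zhat s))) + mv L (θ s)) s
  θ_init : ContinuousOn θ (Icc 0 (t 1))
  θ_cont : ∀ k : ℕ, 1 ≤ k → ContinuousOn θ (Ioc (t k) (t (k + 1)))
  θ_flow : ∀ k : ℕ, ∀ s ∈ Ioo (t k) (t (k + 1)), HasDerivAt θ (mv H (θ s)) s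
  θ_jump : ∀ k : ℕ, 1 ≤ k → Tendsto θ (𝓝[>] (t k))
    (𝓝 (mv P.C (z (t k)) + η (t k) - mv P.C (zhat (t k))))

/-- `|(ε, θ̃)|` with `ε = z - ẑ` and `θ̃ = C (z - ẑ) - θ`: the size of the error at one time. -/
def errNorm {nz ny nw nq ns np : ℕ} (P : Plant nz ny nw nq ns np) (z zhat : Vec nz)
    (θ : Vec ny) : ℝ :=
  ‖stack (z - zhat) (mv P.C (z - zhat) - θ)‖

/-! ### The design problem -/

/-- The gains `L` and `H` solve the observer design problem with convergence rate `lamt` and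
`ℒ₂`-gain `γ`, both for the hybrid model `𝓗ₑ` of the closed loop and for the plant interconnected
with the observer along every admissible sequence of sampling times. -/
structure SolvesProblem {nz ny nw nq ns np : ℕ} (P : Plant nz ny nw nq ns np)
    (T₁ T₂ lamt γ : ℝ) (L : Matrix (Fin nz) (Fin ny) ℝ) (H : Matrix (Fin ny) (Fin ny) ℝ) :
    Prop where
  /-- `𝓗ₑ` is exponentially input-to-state stable with respect to `𝓐`. -/
  eiss : (P.errorSystem T₁ T₂ L H).IsEISS (attractor nz ny T₂)
  /-- With zero inputs, `𝓐` is globally exponentially stable with rate `lamt` in ordinary time. -/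
  rate : ∃ κ : ℝ, 0 < κ ∧
    ∀ (E : Set (ℝ × ℕ)) (φ : ℝ → ℕ → EuclideanSpace ℝ (StateIx nz ny))
      (u : ℝ → ℕ → EuclideanSpace ℝ (Fin nw ⊕ Fin ny)),
      (P.errorSystem T₁ T₂ L H).IsSolutionPair E φ u → (∀ p ∈ E, u p.1 p.2 = 0) →
        ∀ (t : ℝ) (j : ℕ), (t, j) ∈ E →
          Metric.infDist (φ t j) (attractor nz ny T₂) ≤
            κ * Real.exp (-lamt * t) * Metric.infDist (φ 0 0) (attractor nz ny T₂)
  /-- With `η ≡ 0`, the `ℒ₂`-gain from `w` to `C_p ε` is at most `γ`. -/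
  gain : ∃ α : ℝ, 0 < α ∧
    ∀ (E : Set (ℝ × ℕ)) (φ : ℝ → ℕ → EuclideanSpace ℝ (StateIx nz ny))
      (u : ℝ → ℕ → EuclideanSpace ℝ (Fin nw ⊕ Fin ny)),
      (P.errorSystem T₁ T₂ L H).IsSolutionPair E φ u → (∀ p ∈ E, lower (u p.1 p.2) = 0) →
        (∫⁻ s in timeProj E, ‖mv P.Cp (upper (stE (φ s (firstIndex E s))))‖ₑ ^ 2) ^ (1 / 2 : ℝ) ≤
          ENNReal.ofReal (α * Metric.infDist (φ 0 0) (attractor nz ny T₂)) +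
            ENNReal.ofReal γ *
              (∫⁻ s in timeProj E, ‖upper (u s (firstIndex E s))‖ₑ ^ 2) ^ (1 / 2 : ℝ)
  /-- Exponential convergence of the estimate with rate `lamt` for zero inputs. -/
  sampled_rate : ∃ κ : ℝ, 0 < κ ∧
    ∀ (t : ℕ → ℝ) (w : ℝ → Vec nw) (η : ℝ → Vec ny) (z zhat : ℝ → Vec nz) (θ : ℝ → Vec ny),
      IsSamplingSequence T₁ T₂ t → IsTrajectory P L H t w η z zhat θ →
      (∀ s : ℝ, 0 ≤ s → w s = 0) → (∀ s : ℝ, 0 ≤ s → η s = 0) →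
        ∀ s : ℝ, 0 ≤ s → errNorm P (z s) (zhat s) (θ s) ≤
          κ * Real.exp (-lamt * s) * errNorm P (z 0) (zhat 0) (θ 0)
  /-- Boundedness of the error for bounded inputs. -/
  sampled_bounded : ∃ (κ : ℝ) (ρ : ℝ → ℝ), 0 < κ ∧ IsClassK ρ ∧
    ∀ (t : ℕ → ℝ) (w : ℝ → Vec nw) (η : ℝ → Vec ny) (z zhat : ℝ → Vec nz) (θ : ℝ → Vec ny),
      IsSamplingSequence T₁ T₂ t → IsTrajectory P L H t w η z zhat θ →
      ∀ W : ℝ, 0 ≤ W → (∀ᵐ s ∂(volume : Measure ℝ), 0 ≤ s → ‖w s‖ ≤ W) →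
        (∀ k : ℕ, 1 ≤ k → ‖η (t k)‖ ≤ W) →
        ∀ s : ℝ, 0 ≤ s → errNorm P (z s) (zhat s) (θ s) ≤
          max (κ * errNorm P (z 0) (zhat 0) (θ 0)) (ρ W)
  /-- `ℒ₂`-external stability from `w` to `C_p (z - ẑ)` with gain at most `γ` when `η ≡ 0`. -/
  sampled_gain : ∃ α : ℝ, 0 < α ∧
    ∀ (t : ℕ → ℝ) (w : ℝ → Vec nw) (η : ℝ → Vec ny) (z zhat : ℝ → Vec nz) (θ : ℝ → Vec ny),
      IsSamplingSequence T₁ T₂ t → IsTrajectory P L H t w η z zhat θ →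
      (∀ s : ℝ, 0 ≤ s → η s = 0) →
        (∫⁻ s in Ici (0 : ℝ), ‖mv P.Cp (z s - zhat s)‖ₑ ^ 2) ^ (1 / 2 : ℝ) ≤
          ENNReal.ofReal (α * errNorm P (z 0) (zhat 0) (θ 0)) +
            ENNReal.ofReal γ * (∫⁻ s in Ici (0 : ℝ), ‖w s‖ₑ ^ 2) ^ (1 / 2 : ℝ)

/-! ### The matrix inequalities -/

section LMI

variable {nz ny nw nq ns np : ℕ}

/-- The symmetric `4 × 4` block matrix with upper triangle
`M₁₁ M₁₂ M₁₃ M₁₄`, `M₂₂ M₂₃ M₂₄`, `-γ² I, 0`, `-χ I`. -/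
def lmiBlock {ι : Type*} (γ χ : ℝ) (M₁₁ M₁₂ M₂₂ : Matrix ι ι ℝ)
    (M₁₃ M₂₃ : Matrix ι (Fin nw) ℝ) (M₁₄ M₂₄ : Matrix ι (Fin ns) ℝ) :
    Matrix ((ι ⊕ ι) ⊕ (Fin nw ⊕ Fin ns)) ((ι ⊕ ι) ⊕ (Fin nw ⊕ Fin ns)) ℝ :=
  Matrix.fromBlocks
    (Matrix.fromBlocks M₁₁ M₁₂ M₁₂ᵀ M₂₂)
    (Matrix.fromBlocks M₁₃ M₁₄ M₂₃ M₂₄)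
    (Matrix.fromBlocks M₁₃ M₁₄ M₂₃ M₂₄)ᵀ
    (Matrix.fromBlocks (-(γ ^ 2) • (1 : Matrix (Fin nw) (Fin nw) ℝ)) 0 0
      (-χ • (1 : Matrix (Fin ns) (Fin ns) ℝ)))

/-- `𝓟_τ = diag(P₁, e^{δτ} P₂)`, in use for `τ = 0` (where it is `𝓟`) and `τ = T₂`. -/
def lmiP (P₁ : Matrix (Fin nz) (Fin nz) ℝ) (P₂ : Matrix (Fin ny) (Fin ny) ℝ) (δ τ : ℝ) :
    Matrix (ErrIx nz ny) (ErrIx nz ny) ℝ :=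
  Matrix.fromBlocks P₁ 0 0 (Real.exp (δ * τ) • P₂)

/-- `𝓝_τ = diag(2 λ_t P₁ + C_pᵀ C_p + χ ℓ² Sᵀ S, (-δ + 2 λ_t) e^{δτ} P₂)`, in use for `τ = 0`
(where it is `𝓝`) and `τ = T₂`. -/
def lmiN (P : Plant nz ny nw nq ns np) (ℓ lamt : ℝ) (P₁ : Matrix (Fin nz) (Fin nz) ℝ)
    (P₂ : Matrix (Fin ny) (Fin ny) ℝ) (δ χ τ : ℝ) :
    Matrix (ErrIx nz ny) (ErrIx nz ny) ℝ :=
  Matrix.fromBlocks ((2 * lamt) • P₁ + P.Cpᵀ * P.Cp + (χ * ℓ ^ 2) • (P.Sᵀ * P.S)) 0 0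
    (((-δ + 2 * lamt) * Real.exp (δ * τ)) • P₂)

/-- `Q₁`, for the slack blocks `X₅, X₆`. -/
def lmiQ1 (P : Plant nz ny nw nq ns np) (X : Matrix (Fin nz) (Fin nz) ℝ)
    (X₅ : Matrix (Fin ny) (Fin nz) ℝ) (X₆ : Matrix (Fin ny) (Fin ny) ℝ) :
    Matrix (ErrIx nz ny) (ErrIx nz ny) ℝ :=
  Matrix.fromBlocks (-X + P.Cᵀ * X₅) (P.Cᵀ * X₆) (-X₅) (-X₆)

/-- `Q₂`, for the slack blocks `X₇, X₈`. -/
def lmiQ2 (P : Plant nz ny nw nq ns np) (X : Matrix (Fin nz) (Fin nz) ℝ)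
    (J : Matrix (Fin nz) (Fin ny) ℝ)
    (X₇ : Matrix (Fin ny) (Fin nz) ℝ) (X₈ : Matrix (Fin ny) (Fin ny) ℝ) :
    Matrix (ErrIx nz ny) (ErrIx nz ny) ℝ :=
  Matrix.fromBlocks (-X + Xᵀ * P.A - J * P.C + P.Cᵀ * X₇) (J + P.Cᵀ * X₈) (-X₇) (-X₈)

/-- `Q₅`. -/
def lmiQ5 (P : Plant nz ny nw nq ns np) (X : Matrix (Fin nz) (Fin nz) ℝ)
    (J : Matrix (Fin nz) (Fin ny) ℝ) : Matrix (ErrIx nz ny) (ErrIx nz ny) ℝ :=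
  Matrix.fromBlocks (P.Aᵀ * X - P.Cᵀ * Jᵀ) 0 Jᵀ 0

/-- The left-hand side of the matrix inequality at `τ` (in use for `τ = 0` and `τ = T₂`), with
slack blocks `X₅, X₆, X₇, X₈`. -/
def lmiZOH (P : Plant nz ny nw nq ns np) (ℓ lamt γ : ℝ) (P₁ : Matrix (Fin nz) (Fin nz) ℝ)
    (P₂ : Matrix (Fin ny) (Fin ny) ℝ) (δ χ : ℝ) (X : Matrix (Fin nz) (Fin nz) ℝ)
    (J : Matrix (Fin nz) (Fin ny) ℝ)
    (X₅ : Matrix (Fin ny) (Fin nz) ℝ) (X₆ : Matrix (Fin ny) (Fin ny) ℝ)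
    (X₇ : Matrix (Fin ny) (Fin nz) ℝ) (X₈ : Matrix (Fin ny) (Fin ny) ℝ) (τ : ℝ) :
    Matrix ((ErrIx nz ny ⊕ ErrIx nz ny) ⊕ (Fin nw ⊕ Fin ns))
      ((ErrIx nz ny ⊕ ErrIx nz ny) ⊕ (Fin nw ⊕ Fin ns)) ℝ :=
  lmiBlock γ χ
    (He (lmiQ1 P X X₅ X₆))
    (lmiQ2 P X J X₇ X₈ + lmiP P₁ P₂ δ τ)
    (lmiN P ℓ lamt P₁ P₂ δ χ τ + He (lmiQ5 P X J))
    (Matrix.fromRows (Xᵀ * P.N) 0) (Matrix.fromRows (Xᵀ * P.N) 0)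
    (Matrix.fromRows (Xᵀ * P.B) 0) (Matrix.fromRows (Xᵀ * P.B) 0)

/-- `M < 0` for a symmetric matrix `M`. -/
def NegDef {ι : Type*} (M : Matrix ι ι ℝ) : Prop := (-M).PosDef

end LMI

end SporadicObserver

end

/-! The certificate is V = εᵀP₁ε + e^{δτ} θ̃ᵀP₂θ̃ (`lyap`). Along flows τ̇ = -1, so the weight
contributes the extra decay -δ e^{δτ} θ̃ᵀP₂θ̃. At a jump τ = 0, ε is kept and θ̃ becomes -η, so V
does not rise when η = 0 and rises by at most k|η|² in general (`exists_lyap_jump_bound`).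

With H = 0 the hold state is constant between samples, hence the derivative of θ̃ is C ε̇. Evaluate
the quadratic form of either matrix inequality at the vector with blocks (ε̇, Cε̇), (ε, θ̃), w, ζ,
where ζ is the increment of ψ. The slack blocks cancel because the second block is C times the
first, and X only multiplies the residual of the error equation, which is zero
(`quadratic_form_lmiZOH`). The term χ(ℓ²|Sε|² - |ζ|²) that remains is nonnegative by the Lipschitz
bound, and removing it leaves V̇ + 2λ_t V + |C_p ε|² ≤ γ²|w|² at τ = 0 and at τ = T₂. This scalar
inequality is affine in e^{δτ}, so it holds for all τ in [0, T₂] (`dissipation`); since the slack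
matrices have already disappeared, they may differ at the two endpoints.

Everything else follows from `IsDissipative`, which collects these properties of V. Dropping |C_p
ε|² and using the integrating factor e^{2λ_t t} gives the decay rate and the input-to-state bound,
the jump contributions being summable because samples are at least T₁ apart
(`IsDissipative.lyap_le_of_input`); the dwell-time bound `jumps_le` turns decay in t into decay in t
+ j. Dropping V instead and integrating gives the ℒ₂-gain (`IsDissipative.gain`). Maximal solutions
are complete because a solution with bounded domain can jump, flow on, or be extended to its missing
endpoint (`isCompleteDomain_of_isMaximal`).

The claims about the actual sampled-data loop reduce to the hybrid ones: a trajectory becomes a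
solution pair when the timer is taken to be the time left until the next sample
(`IsTrajectory.isSolutionPair`). -/

noncomputable section

namespace SporadicObserver

/-! ### Block vectors and matrix products as continuous linear maps -/

section LinearAlgebra

variable {ι κ : Type*} [Fintype ι] [Fintype κ]

/-- `mv M` as a continuous linear map. -/
def mvL (M : Matrix ι κ ℝ) : EuclideanSpace ℝ κ →L[ℝ] EuclideanSpace ℝ ι :=
  LinearMap.toContinuousLinearMap
    { toFun := mv M
      map_add' := fun x y => by ext i; simp [mv, Matrix.mulVec_add]
      map_smul' := fun c x => by ext i; simp [mv, Matrix.mulVec_smul] }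

@[simp] lemma mvL_apply (M : Matrix ι κ ℝ) (x : EuclideanSpace ℝ κ) : mvL M x = mv M x := rfl

/-- `upper` as a continuous linear map. -/
def upperL : EuclideanSpace ℝ (ι ⊕ κ) →L[ℝ] EuclideanSpace ℝ ι :=
  LinearMap.toContinuousLinearMap
    { toFun := upper
      map_add' := fun x y => by ext i; simp [upper]
      map_smul' := fun c x => by ext i; simp [upper] }

/-- `lower` as a continuous linear map. -/
def lowerL : EuclideanSpace ℝ (ι ⊕ κ) →L[ℝ] EuclideanSpace ℝ κ :=
  LinearMap.toContinuousLinearMap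
    { toFun := lower
      map_add' := fun x y => by ext i; simp [lower]
      map_smul' := fun c x => by ext i; simp [lower] }

/-- `stack` as a continuous linear map. -/
def stackL : EuclideanSpace ℝ ι × EuclideanSpace ℝ κ →L[ℝ] EuclideanSpace ℝ (ι ⊕ κ) :=
  LinearMap.toContinuousLinearMap
    { toFun := fun p => stack p.1 p.2
      map_add' := fun x y => by ext (i | i) <;> simp [stack]
      map_smul' := fun c x => by ext (i | i) <;> simp [stack] }


omit [Fintype ι] [Fintype κ] in
@[simp] lemma upper_stack (x : EuclideanSpace ℝ ι) (y : EuclideanSpace ℝ κ) :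
    upper (stack x y) = x := rfl
omit [Fintype ι] [Fintype κ] in
@[simp] lemma lower_stack (x : EuclideanSpace ℝ ι) (y : EuclideanSpace ℝ κ) :
    lower (stack x y) = y := rfl
end LinearAlgebra

/-! ### From the matrix inequalities to a dissipation inequality -/

section LMI
variable {nz ny nw nq ns np : ℕ}

lemma NegDef.dotProduct_mulVec_nonpos {ι : Type*} [Fintype ι] {M : Matrix ι ι ℝ} (h : NegDef M)
    (x : ι → ℝ) : x ⬝ᵥ (M *ᵥ x) ≤ 0 := by
  have := Matrix.PosSemidef.dotProduct_mulVec_nonneg (Matrix.PosDef.posSemidef h) x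
  simp only [star_trivial, Matrix.neg_mulVec, dotProduct_neg] at this
  linarith

lemma dotProduct_transpose_mulVec {ι κ : Type*} [Fintype ι] [Fintype κ] (M : Matrix ι κ ℝ)
    (a : κ → ℝ) (b : ι → ℝ) : a ⬝ᵥ (Mᵀ *ᵥ b) = (M *ᵥ a) ⬝ᵥ b := by
  rw [Matrix.dotProduct_mulVec, Matrix.vecMul_transpose]

/-- The slack terms of the matrix inequality vanish along the error dynamics. -/
lemma quadratic_form_lmiZOH (P : Plant nz ny nw nq ns np) (ℓ lamt γ : ℝ)
    (P₁ : Matrix (Fin nz) (Fin nz) ℝ) (P₂ : Matrix (Fin ny) (Fin ny) ℝ) (δ χ : ℝ)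
    (X : Matrix (Fin nz) (Fin nz) ℝ) (L : Matrix (Fin nz) (Fin ny) ℝ)
    (X₅ : Matrix (Fin ny) (Fin nz) ℝ) (X₆ : Matrix (Fin ny) (Fin ny) ℝ)
    (X₇ : Matrix (Fin ny) (Fin nz) ℝ) (X₈ : Matrix (Fin ny) (Fin ny) ℝ) (τ : ℝ)
    (e p : Fin nz → ℝ) (θ : Fin ny → ℝ) (w : Fin nw → ℝ) (s : Fin ns → ℝ)
    (hp : p = P.A *ᵥ e - L *ᵥ (P.C *ᵥ e) + L *ᵥ θ + P.B *ᵥ s + P.N *ᵥ w)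
    {J : Matrix (Fin nz) (Fin ny) ℝ} (hJ : J = Xᵀ * L) :
    (Sum.elim (Sum.elim (Sum.elim p (P.C *ᵥ p)) (Sum.elim e θ)) (Sum.elim w s)) ⬝ᵥ
      (lmiZOH P ℓ lamt γ P₁ P₂ δ χ X J X₅ X₆ X₇ X₈ τ *ᵥ
        (Sum.elim (Sum.elim (Sum.elim p (P.C *ᵥ p)) (Sum.elim e θ)) (Sum.elim w s))) =
      2 * (p ⬝ᵥ (P₁ *ᵥ e)) + 2 * Real.exp (δ * τ) * ((P.C *ᵥ p) ⬝ᵥ (P₂ *ᵥ θ))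
        + 2 * lamt * (e ⬝ᵥ (P₁ *ᵥ e)) + (P.Cp *ᵥ e) ⬝ᵥ (P.Cp *ᵥ e)
        + χ * ℓ ^ 2 * ((P.S *ᵥ e) ⬝ᵥ (P.S *ᵥ e))
        + (-δ + 2 * lamt) * Real.exp (δ * τ) * (θ ⬝ᵥ (P₂ *ᵥ θ))
        - γ ^ 2 * (w ⬝ᵥ w) - χ * (s ⬝ᵥ s) := by
  subst hJ
  -- The error equation tested against X(p + e): twice this identity accounts for every term with X
  -- or J. The blocks X₅, …, X₈ cancel by themselves, since each occurs once with Cᵀ against p and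
  -- once with a minus sign against C p.
  have key : (X *ᵥ (p + e)) ⬝ᵥ p =
      (X *ᵥ (p + e)) ⬝ᵥ (P.A *ᵥ e - L *ᵥ (P.C *ᵥ e) + L *ᵥ θ + P.B *ᵥ s + P.N *ᵥ w) := by
    rw [← hp]
  clear hp
  simp only [lmiZOH, lmiBlock, lmiQ1, lmiQ2, lmiQ5, lmiP, lmiN, He,
    Matrix.fromBlocks_transpose, Matrix.fromBlocks_add, Matrix.fromBlocks_mulVec,
    Matrix.fromRows_mulVec, Matrix.fromCols_mulVec_sumElim, Matrix.transpose_fromRows,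
    Sum.elim_comp_inl, Sum.elim_comp_inr, sumElim_dotProduct_sumElim, dotProduct_add,
    Matrix.add_mulVec, Matrix.sub_mulVec, Matrix.neg_mulVec, Matrix.smul_mulVec, Sum.elim_add_add,
    Matrix.transpose_add, Matrix.transpose_sub, Matrix.transpose_neg, Matrix.transpose_mul,
    Matrix.transpose_transpose, Matrix.transpose_zero, Matrix.zero_mulVec, Matrix.one_mulVec,
    ← Matrix.mulVec_mulVec, dotProduct_transpose_mulVec, dotProduct_neg, dotProduct_sub,
    dotProduct_smul, Matrix.mulVec_add, add_dotProduct, smul_eq_mul, dotProduct_zero,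
    Matrix.transpose_smul] at key ⊢
  simp only [dotProduct_comm] at key ⊢
  linear_combination (-2) * key

/-- `V(ε, θ̃, τ) = εᵀ P₁ ε + e^{δτ} θ̃ᵀ P₂ θ̃`. -/
def lyap (P₁ : Matrix (Fin nz) (Fin nz) ℝ) (P₂ : Matrix (Fin ny) (Fin ny) ℝ) (δ : ℝ)
    (e : EuclideanSpace ℝ (ErrIx nz ny)) (τ : ℝ) : ℝ :=
  inner ℝ (upper e) (mv P₁ (upper e)) + Real.exp (δ * τ) * inner ℝ (lower e) (mv P₂ (lower e))

/-- The derivative of `lyap` in the direction `(e', -1)`. -/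
def lyapDot (P₁ : Matrix (Fin nz) (Fin nz) ℝ) (P₂ : Matrix (Fin ny) (Fin ny) ℝ) (δ : ℝ)
    (e e' : EuclideanSpace ℝ (ErrIx nz ny)) (τ : ℝ) : ℝ :=
  2 * inner ℝ (upper e') (mv P₁ (upper e)) + Real.exp (δ * τ) *
    (2 * inner ℝ (lower e') (mv P₂ (lower e)) - δ * inner ℝ (lower e) (mv P₂ (lower e)))

lemma inner_eq_dotProduct {ι : Type*} [Fintype ι] (x y : EuclideanSpace ℝ ι) :
    inner ℝ x y = x.ofLp ⬝ᵥ y.ofLp := by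
  rw [EuclideanSpace.inner_eq_star_dotProduct, star_trivial, dotProduct_comm]

/-- The error dynamics for `H = 0`. -/
def errField (P : Plant nz ny nw nq ns np) (L : Matrix (Fin nz) (Fin ny) ℝ) (z : Vec nz)
    (e : EuclideanSpace ℝ (ErrIx nz ny)) (w : Vec nw) : EuclideanSpace ℝ (ErrIx nz ny) :=
  mv (P.matF L 0) e + mv P.matQ (P.zeta z (upper e)) + mv P.matT w

lemma upper_errField (P : Plant nz ny nw nq ns np) (L : Matrix (Fin nz) (Fin ny) ℝ) (z : Vec nz)
    (e : EuclideanSpace ℝ (ErrIx nz ny)) (w : Vec nw) :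
    (upper (errField P L z e w)).ofLp = P.A *ᵥ (upper e).ofLp - L *ᵥ (P.C *ᵥ (upper e).ofLp) +
      L *ᵥ (lower e).ofLp + P.B *ᵥ (P.zeta z (upper e)).ofLp + P.N *ᵥ w.ofLp := by
  have he : e.ofLp = Sum.elim (upper e).ofLp (lower e).ofLp := by ext (i | i) <;> rfl
  ext i
  simp only [errField, upper, Plant.matF, Plant.matQ, Plant.matT, mv, PiLp.add_apply]
  rw [he]
  simp [Matrix.fromBlocks_mulVec, Matrix.fromRows_mulVec, Matrix.sub_mulVec, upper, lower,
    ← Matrix.mulVec_mulVec]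

/-- For H = 0 the hold state does not move along flows, so θ̃ = Cε - θ and Cε have the same
derivative. This is the relation that makes the slack blocks vanish. -/
lemma lower_errField (P : Plant nz ny nw nq ns np) (L : Matrix (Fin nz) (Fin ny) ℝ) (z : Vec nz)
    (e : EuclideanSpace ℝ (ErrIx nz ny)) (w : Vec nw) :
    (lower (errField P L z e w)).ofLp = P.C *ᵥ (upper (errField P L z e w)).ofLp := by
  rw [upper_errField]
  have he : e.ofLp = Sum.elim (upper e).ofLp (lower e).ofLp := by ext (i | i) <;> rfl
  ext i
  simp only [errField, lower, Plant.matF, Plant.matQ, Plant.matT, mv, PiLp.add_apply]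
  rw [he]
  simp [Matrix.fromBlocks_mulVec, Matrix.fromRows_mulVec, Matrix.sub_mulVec, upper, lower,
    ← Matrix.mulVec_mulVec, Matrix.mulVec_add, Matrix.mulVec_sub]

/-- The dissipation inequality at the two ends of the range of the timer. -/
lemma dissipation_of_lmiZOH (P : Plant nz ny nw nq ns np) {ℓ lamt γ : ℝ}
    (hψ : ∀ v₁ v₂ : Vec nq, ‖P.ψ v₁ - P.ψ v₂‖ ≤ ℓ * ‖v₁ - v₂‖)
    {P₁ : Matrix (Fin nz) (Fin nz) ℝ} {P₂ : Matrix (Fin ny) (Fin ny) ℝ} {δ χ : ℝ} (hχ : 0 < χ)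
    {X : Matrix (Fin nz) (Fin nz) ℝ} (hX : IsUnit X) {J : Matrix (Fin nz) (Fin ny) ℝ}
    {X₅ X₇ : Matrix (Fin ny) (Fin nz) ℝ} {X₆ X₈ : Matrix (Fin ny) (Fin ny) ℝ} {τ : ℝ}
    (h : NegDef (lmiZOH P ℓ lamt γ P₁ P₂ δ χ X J X₅ X₆ X₇ X₈ τ))
    (z : Vec nz) (e : EuclideanSpace ℝ (ErrIx nz ny)) (w : Vec nw) :
    lyapDot P₁ P₂ δ e (errField P ((Xᵀ)⁻¹ * J) z e w) τ + 2 * lamt * lyap P₁ P₂ δ e τ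
      + ‖mv P.Cp (upper e)‖ ^ 2 ≤ γ ^ 2 * ‖w‖ ^ 2 := by
  have hJ : J = Xᵀ * ((Xᵀ)⁻¹ * J) := by
    have : IsUnit (Xᵀ).det := by
      rw [Matrix.det_transpose]; exact (Matrix.isUnit_iff_isUnit_det X).1 hX
    rw [← Matrix.mul_assoc, Matrix.mul_nonsing_inv _ this, Matrix.one_mul]
  -- The sector condition for the S-procedure: multiplied by χ, it absorbs the terms in S and ζ of
  -- the quadratic form.
  have hζ : ‖P.zeta z (upper e)‖ ^ 2 ≤ ℓ ^ 2 * ‖mv P.S (upper e)‖ ^ 2 := by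
    rw [← mul_pow]
    refine pow_le_pow_left₀ (norm_nonneg _) ?_ 2
    refine (hψ _ _).trans_eq ?_
    congr 2
    rw [← mvL_apply, ← mvL_apply, ← mvL_apply, ← map_sub, sub_sub_cancel]
  have hq := quadratic_form_lmiZOH P ℓ lamt γ P₁ P₂ δ χ X _ X₅ X₆ X₇ X₈ τ (upper e).ofLp _
    (lower e).ofLp w.ofLp _ (upper_errField P ((Xᵀ)⁻¹ * J) z e w) hJ
  have hle := h.dotProduct_mulVec_nonpos (Sum.elim (Sum.elim (Sum.elim
      (upper (errField P ((Xᵀ)⁻¹ * J) z e w)).ofLp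
      (P.C *ᵥ (upper (errField P ((Xᵀ)⁻¹ * J) z e w)).ofLp))
      (Sum.elim (upper e).ofLp (lower e).ofLp))
      (Sum.elim w.ofLp (P.zeta z (upper e)).ofLp))
  rw [hq] at hle
  simp only [lyapDot, lyap, ← real_inner_self_eq_norm_sq] at hζ ⊢
  simp only [inner_eq_dotProduct, lower_errField, mv] at hζ ⊢
  have := mul_le_mul_of_nonneg_left hζ hχ.le
  linarith

/-- Monotonicity places e^{δτ} between 1 and e^{δT}. The weight a is the normalised position; it
requires e^{δT} ≠ 1, hence the separate case T = 0. -/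
lemma exp_eq_convex_combination {δ τ T : ℝ} (hδ : 0 < δ) (hτ : τ ∈ Icc 0 T) :
    ∃ a ∈ Icc (0 : ℝ) 1, Real.exp (δ * τ) = (1 - a) + a * Real.exp (δ * T) := by
  rcases hτ.1.trans hτ.2 |>.eq_or_lt with h0 | h0
  · obtain rfl : τ = 0 := le_antisymm (hτ.2.trans h0.ge) hτ.1
    exact ⟨0, by simp, by simp⟩
  have h1 : 1 < Real.exp (δ * T) := Real.one_lt_exp_iff.2 (by positivity)
  have h2 : 1 ≤ Real.exp (δ * τ) := Real.one_le_exp (mul_nonneg hδ.le hτ.1)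
  have h3 : Real.exp (δ * τ) ≤ Real.exp (δ * T) := by gcongr; exact hτ.2
  have h4 : 0 < Real.exp (δ * T) - 1 := by linarith
  refine ⟨(Real.exp (δ * τ) - 1) / (Real.exp (δ * T) - 1), ⟨div_nonneg (by linarith) h4.le,
    (div_le_one h4).2 (by linarith)⟩, ?_⟩
  field_simp
  ring

/-- The dissipation inequality for all values of the timer. -/
lemma dissipation (P : Plant nz ny nw nq ns np) {ℓ lamt γ T₂ : ℝ}
    (hψ : ∀ v₁ v₂ : Vec nq, ‖P.ψ v₁ - P.ψ v₂‖ ≤ ℓ * ‖v₁ - v₂‖)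
    {P₁ : Matrix (Fin nz) (Fin nz) ℝ} {P₂ : Matrix (Fin ny) (Fin ny) ℝ} {δ χ : ℝ} (hδ : 0 < δ)
    (hχ : 0 < χ)
    {X : Matrix (Fin nz) (Fin nz) ℝ} (hX : IsUnit X) {J : Matrix (Fin nz) (Fin ny) ℝ}
    {X₅ X₇ Y₅ Y₇ : Matrix (Fin ny) (Fin nz) ℝ} {X₆ X₈ Y₆ Y₈ : Matrix (Fin ny) (Fin ny) ℝ}
    (h₀ : NegDef (lmiZOH P ℓ lamt γ P₁ P₂ δ χ X J X₅ X₆ X₇ X₈ 0))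
    (h₂ : NegDef (lmiZOH P ℓ lamt γ P₁ P₂ δ χ X J Y₅ Y₆ Y₇ Y₈ T₂))
    (z : Vec nz) (e : EuclideanSpace ℝ (ErrIx nz ny)) (w : Vec nw) {τ : ℝ} (hτ : τ ∈ Icc 0 T₂) :
    lyapDot P₁ P₂ δ e (errField P ((Xᵀ)⁻¹ * J) z e w) τ + 2 * lamt * lyap P₁ P₂ δ e τ
      + ‖mv P.Cp (upper e)‖ ^ 2 ≤ γ ^ 2 * ‖w‖ ^ 2 := by
  obtain ⟨a, ha, hexp⟩ := exp_eq_convex_combination hδ hτ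
  -- Both sides depend on the timer only through e^{δτ}, and affinely, so the combination of the
  -- endpoint inequalities with weights 1 - a and a is the inequality at τ.
  have i₀ := mul_le_mul_of_nonneg_left (dissipation_of_lmiZOH P hψ hχ hX h₀ z e w)
    (sub_nonneg.2 ha.2)
  have i₂ := mul_le_mul_of_nonneg_left (dissipation_of_lmiZOH P hψ hχ hX h₂ z e w) ha.1
  simp only [lyapDot, lyap, hexp, mul_zero, Real.exp_zero] at i₀ i₂ ⊢
  linarith

/-- The lower constant is the minimum of the form on the compact unit sphere, extended by
homogeneity; the upper one comes from the operator norm. -/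
lemma exists_bounds_of_posDef {n : ℕ} {M : Matrix (Fin n) (Fin n) ℝ} (hM : M.PosDef) :
    ∃ a b : ℝ, 0 < a ∧ 0 < b ∧ ∀ x : Vec n,
      a * ‖x‖ ^ 2 ≤ inner ℝ x (mv M x) ∧ inner ℝ x (mv M x) ≤ b * ‖x‖ ^ 2 := by
  have hpos : ∀ x : Vec n, x ≠ 0 → 0 < inner ℝ x (mv M x) := fun x hx => by
    have := hM.dotProduct_mulVec_pos (x := x.ofLp) (by simpa using hx)
    simpa [inner_eq_dotProduct, mv] using this
  have hcont : Continuous fun x : Vec n => inner ℝ x (mv M x) :=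
    continuous_id.inner (mvL M).continuous
  -- In dimension zero the sphere is empty and any positive constant works.
  have key : ∃ a : ℝ, 0 < a ∧ ∀ x ∈ Metric.sphere (0 : Vec n) 1, a ≤ inner ℝ x (mv M x) := by
    rcases (Metric.sphere (0 : Vec n) 1).eq_empty_or_nonempty with he | hne
    · exact ⟨1, one_pos, by simp [he]⟩
    obtain ⟨x₀, hx₀, hmin⟩ := (isCompact_sphere (0 : Vec n) 1).exists_isMinOn hne hcont.continuousOn
    exact ⟨_, hpos x₀ (by rintro rfl; simp at hx₀), fun x hx => hmin hx⟩
  obtain ⟨a, ha, hmin⟩ := key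
  refine ⟨a, ‖mvL M‖ + 1, ha, by positivity, fun x => ⟨?_, ?_⟩⟩
  · rcases eq_or_ne x 0 with rfl | hx
    · simp
    have hn : ‖x‖ ≠ 0 := norm_ne_zero_iff.2 hx
    have := hmin (‖x‖⁻¹ • x) (by simp [norm_smul, hn])
    rw [← mvL_apply, map_smul, real_inner_smul_left, real_inner_smul_right, mvL_apply] at this
    calc a * ‖x‖ ^ 2 ≤ (‖x‖⁻¹ * (‖x‖⁻¹ * inner ℝ x (mv M x))) * ‖x‖ ^ 2 := by gcongr
      _ = _ := by field_simp
  · calc inner ℝ x (mv M x) ≤ ‖x‖ * ‖mvL M x‖ := real_inner_le_norm _ _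
      _ ≤ ‖x‖ * (‖mvL M‖ * ‖x‖) := by gcongr; exact (mvL M).le_opNorm x
      _ ≤ (‖mvL M‖ + 1) * ‖x‖ ^ 2 := by nlinarith [sq_nonneg ‖x‖]

lemma norm_sq_eq_upper_add_lower {ι κ : Type*} [Fintype ι] [Fintype κ]
    (x : EuclideanSpace ℝ (ι ⊕ κ)) : ‖x‖ ^ 2 = ‖upper x‖ ^ 2 + ‖lower x‖ ^ 2 := by
  simp [EuclideanSpace.norm_sq_eq, upper, lower]

/-- The constants are uniform in the timer because 1 ≤ e^{δτ} ≤ e^{δT₂} on [0, T₂]. -/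
lemma exists_bounds_lyap {P₁ : Matrix (Fin nz) (Fin nz) ℝ} {P₂ : Matrix (Fin ny) (Fin ny) ℝ}
    (hP₁ : P₁.PosDef) (hP₂ : P₂.PosDef) {δ : ℝ} (hδ : 0 < δ) (T₂ : ℝ) :
    ∃ a b : ℝ, 0 < a ∧ 0 < b ∧ ∀ (e : EuclideanSpace ℝ (ErrIx nz ny)), ∀ τ ∈ Icc 0 T₂,
      a * ‖e‖ ^ 2 ≤ lyap P₁ P₂ δ e τ ∧ lyap P₁ P₂ δ e τ ≤ b * ‖e‖ ^ 2 := by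
  obtain ⟨a₁, b₁, ha₁, hb₁, h₁⟩ := exists_bounds_of_posDef hP₁
  obtain ⟨a₂, b₂, ha₂, hb₂, h₂⟩ := exists_bounds_of_posDef hP₂
  refine ⟨min a₁ a₂, max b₁ (Real.exp (δ * T₂) * b₂), by positivity, by positivity,
    fun e τ hτ => ?_⟩
  have e1 : 1 ≤ Real.exp (δ * τ) := Real.one_le_exp (mul_nonneg hδ.le hτ.1)
  have e2 : Real.exp (δ * τ) ≤ Real.exp (δ * T₂) := by gcongr; exact hτ.2
  have hn : 0 ≤ inner ℝ (lower e) (mv P₂ (lower e)) := le_trans (by positivity) (h₂ _).1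
  rw [norm_sq_eq_upper_add_lower, lyap, mul_add, mul_add]
  constructor
  · refine add_le_add ((mul_le_mul_of_nonneg_right (min_le_left _ _) (sq_nonneg _)).trans
      (h₁ _).1) ?_
    calc _ ≤ a₂ * ‖lower e‖ ^ 2 := by gcongr; exact min_le_right _ _
      _ ≤ 1 * inner ℝ (lower e) (mv P₂ (lower e)) := by rw [one_mul]; exact (h₂ _).1
      _ ≤ _ := by gcongr
  · refine add_le_add ((h₁ _).2.trans
      (mul_le_mul_of_nonneg_right (le_max_left _ _) (sq_nonneg _))) ?_
    calc _ ≤ Real.exp (δ * T₂) * inner ℝ (lower e) (mv P₂ (lower e)) := by gcongr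
      _ ≤ Real.exp (δ * T₂) * (b₂ * ‖lower e‖ ^ 2) := by gcongr; exact (h₂ _).2
      _ = (Real.exp (δ * T₂) * b₂) * ‖lower e‖ ^ 2 := by ring
      _ ≤ _ := by gcongr; exact le_max_right _ _

end LMI

/-! ### Calculus of absolutely continuous functions -/

section AbsolutelyContinuous

open AbsolutelyContinuousOnInterval

lemma absolutelyContinuousOnInterval_comp_lipschitzOn {X Y : Type*} [PseudoMetricSpace X]
    [PseudoMetricSpace Y] {g : X → Y} {s : Set X} {K : NNReal} (hg : LipschitzOnWith K g s)
    {f : ℝ → X} {a b : ℝ} (hf : AbsolutelyContinuousOnInterval f a b)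
    (hs : MapsTo f (uIcc a b) s) : AbsolutelyContinuousOnInterval (fun t => g (f t)) a b := by
  rw [absolutelyContinuousOnInterval_iff] at hf ⊢
  intro ε hε
  -- K + 1 instead of K keeps the quotient meaningful when K = 0.
  obtain ⟨δ, hδ, h⟩ := hf (ε / (K + 1)) (by positivity)
  refine ⟨δ, hδ, fun E hE hlen => ?_⟩
  calc ∑ i ∈ Finset.range E.1, dist (g (f (E.2 i).1)) (g (f (E.2 i).2))
      ≤ ∑ i ∈ Finset.range E.1, K * dist (f (E.2 i).1) (f (E.2 i).2) :=
        Finset.sum_le_sum fun i hi =>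
          hg.dist_le_mul _ (hs (hE.1 i hi).1) _ (hs (hE.1 i hi).2)
    _ = K * ∑ i ∈ Finset.range E.1, dist (f (E.2 i).1) (f (E.2 i).2) := by rw [Finset.mul_sum]
    _ ≤ K * (ε / (K + 1)) := by gcongr; exact (h E hE hlen).le
    _ < (K + 1) * (ε / (K + 1)) := by gcongr; linarith
    _ = ε := by field_simp

/-- The image of the interval is bounded, and a C¹ map is Lipschitz on a closed ball containing it.
-/
lemma absolutelyContinuousOnInterval_comp_contDiff {E F : Type*} [NormedAddCommGroup E]
    [NormedSpace ℝ E] [FiniteDimensional ℝ E] [NormedAddCommGroup F] [NormedSpace ℝ F]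
    {g : E → F} (hg : ContDiff ℝ 1 g) {f : ℝ → E} {a b : ℝ}
    (hf : AbsolutelyContinuousOnInterval f a b) :
    AbsolutelyContinuousOnInterval (fun t => g (f t)) a b := by
  have := FiniteDimensional.proper ℝ E
  obtain ⟨R, hR⟩ := hf.exists_bound
  obtain ⟨K, hK⟩ := (hg.contDiffOn (s := Metric.closedBall 0 R)).exists_lipschitzOnWith
    one_ne_zero (convex_closedBall _ _) (isCompact_closedBall _ _)
  exact absolutelyContinuousOnInterval_comp_lipschitzOn hK hf
    fun t ht => mem_closedBall_zero_iff.2 (hR t ht)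

/-- Precomposition with a monotone `1`-Lipschitz map that contracts to the interval. -/
lemma absolutelyContinuousOnInterval_comp_clamp {X : Type*} [PseudoMetricSpace X] {f : ℝ → X}
    {a b c d : ℝ} {r : ℝ → ℝ} (hf : AbsolutelyContinuousOnInterval f c d)
    (hr : MapsTo r (uIcc a b) (uIcc c d))
    (hr' : ∀ x y, x ≤ y → Ioc (r x) (r y) ⊆ Ioc x y) (hmono : Monotone r)
    (hlip : ∀ x y, dist (r x) (r y) ≤ dist x y) :
    AbsolutelyContinuousOnInterval (fun t => f (r t)) a b := by
  rw [absolutelyContinuousOnInterval_iff] at hf ⊢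
  intro ε hε
  obtain ⟨δ, hδ, h⟩ := hf ε hε
  refine ⟨δ, hδ, fun E hE hlen => ?_⟩
  -- This keeps the image of a disjoint family of intervals disjoint, as the definition of absolute
  -- continuity demands.
  have hsub : ∀ x y, uIoc (r x) (r y) ⊆ uIoc x y := by
    intro x y
    rcases le_total x y with hxy | hxy
    · rw [uIoc_of_le hxy, uIoc_of_le (hmono hxy)]; exact hr' x y hxy
    · rw [uIoc_of_ge hxy, uIoc_of_ge (hmono hxy)]; exact hr' y x hxy
  refine h (E.1, fun i => (r (E.2 i).1, r (E.2 i).2)) ⟨fun i hi => ?_, fun i hi j hj hij => ?_⟩ ?_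
  · exact ⟨hr (hE.1 i hi).1, hr (hE.1 i hi).2⟩
  · exact (hE.2 hi hj hij).mono (hsub _ _) (hsub _ _)
  · exact (Finset.sum_le_sum fun i _ => hlip _ _).trans_lt hlen

/-- Gluing through the identity f(t) = f(min t c) + f(max t c) - f(c), whose terms are absolutely
continuous on all of [a, b]. -/
lemma absolutelyContinuousOnInterval_trans {F : Type*} [NormedAddCommGroup F] {f : ℝ → F}
    {a b c : ℝ} (hac : a ≤ c) (hcb : c ≤ b) (h₁ : AbsolutelyContinuousOnInterval f a c)
    (h₂ : AbsolutelyContinuousOnInterval f c b) : AbsolutelyContinuousOnInterval f a b := by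
  have k₁ : AbsolutelyContinuousOnInterval (fun t => f (min t c)) a b :=
    absolutelyContinuousOnInterval_comp_clamp h₁
      (fun x hx => by
        rw [uIcc_of_le (hac.trans hcb)] at hx; rw [uIcc_of_le hac]
        exact ⟨le_min hx.1 hac, min_le_right _ _⟩)
      (fun x y hxy z hz => by
        have h1 := hz.1; have h2 := hz.2
        refine ⟨?_, h2.trans (min_le_left _ _)⟩
        rcases min_lt_iff.1 h1 with h | h
        · exact h
        · exact absurd (h2.trans (min_le_right _ _)) (not_le.2 h))
      (fun x y hxy => min_le_min_right _ hxy)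
      (fun x y => by simpa [Real.dist_eq] using abs_min_sub_min_le_max x c y c)
  have k₂ : AbsolutelyContinuousOnInterval (fun t => f (max t c)) a b :=
    absolutelyContinuousOnInterval_comp_clamp h₂
      (fun x hx => by
        rw [uIcc_of_le (hac.trans hcb)] at hx; rw [uIcc_of_le hcb]
        exact ⟨le_max_right _ _, max_le hx.2 hcb⟩)
      (fun x y hxy z hz => by
        have h1 := hz.1; have h2 := hz.2
        refine ⟨(le_max_left _ _).trans_lt h1, ?_⟩
        rcases le_max_iff.1 h2 with h | h
        · exact h
        · exact absurd ((le_max_right _ _).trans_lt h1) (not_lt.2 h))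
      (fun x y hxy => max_le_max_right _ hxy)
      (fun x y => by simpa [Real.dist_eq] using abs_max_sub_max_le_max x c y c)
  have k₃ : AbsolutelyContinuousOnInterval (fun _ : ℝ => f c) a b :=
    (LipschitzWith.const (f c)).lipschitzOnWith.absolutelyContinuousOnInterval
  convert (k₁.fun_add k₂).fun_sub k₃ using 2 with t
  rcases le_total t c with h | h <;> simp [h]

lemma absolutelyContinuousOnInterval_congr {X : Type*} [PseudoMetricSpace X] {f g : ℝ → X}
    {a b : ℝ} (hf : AbsolutelyContinuousOnInterval f a b) (h : EqOn f g (uIcc a b)) :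
    AbsolutelyContinuousOnInterval g a b := by
  rw [absolutelyContinuousOnInterval_iff] at hf ⊢
  intro ε hε
  obtain ⟨δ, hδ, hd⟩ := hf ε hε
  refine ⟨δ, hδ, fun E hE hlen => ?_⟩
  convert hd E hE hlen using 1
  exact Finset.sum_congr rfl fun i hi => by rw [h (hE.1 i hi).1, h (hE.1 i hi).2]

/-- An absolutely continuous function is the integral of its derivative, so an almost everywhere
bound suffices. Nothing better is available along solutions, whose inputs are only measurable. -/
lemma sub_le_integral_of_ae_hasDerivAt {f f' g : ℝ → ℝ} {a b : ℝ} (hab : a ≤ b)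
    (hf : AbsolutelyContinuousOnInterval f a b)
    (hf' : ∀ᵐ t, t ∈ Ioo a b → HasDerivAt f (f' t) t ∧ f' t ≤ g t)
    (hg : IntervalIntegrable g volume a b) : f b - f a ≤ ∫ t in a..b, g t := by
  rw [← hf.integral_deriv_eq_sub]
  refine intervalIntegral.integral_mono_ae_restrict hab hf.intervalIntegrable_deriv hg ?_
  rw [EventuallyLE, ae_restrict_iff' measurableSet_Icc]
  have ha : ∀ᵐ t : ℝ, t ≠ a := by simp [ae_iff]
  have hb : ∀ᵐ t : ℝ, t ≠ b := by simp [ae_iff]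
  filter_upwards [hf', ha, hb] with t ht hta htb hmem
  obtain ⟨h1, h2⟩ := ht ⟨lt_of_le_of_ne hmem.1 hta.symm, lt_of_le_of_ne hmem.2 htb⟩
  rwa [h1.deriv]

lemma le_of_ae_hasDerivAt_nonpos {f f' : ℝ → ℝ} {a b : ℝ} (hab : a ≤ b)
    (hf : AbsolutelyContinuousOnInterval f a b)
    (hf' : ∀ᵐ t, t ∈ Ioo a b → HasDerivAt f (f' t) t ∧ f' t ≤ 0) : f b ≤ f a := by
  have := sub_le_integral_of_ae_hasDerivAt (g := fun _ => 0) hab hf hf' (by simp)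
  simp only [intervalIntegral.integral_zero] at this
  linarith

lemma sub_eq_mul_of_ae_hasDerivAt_const {f : ℝ → ℝ} {a b c : ℝ} (hab : a ≤ b)
    (hf : AbsolutelyContinuousOnInterval f a b)
    (hf' : ∀ᵐ t, t ∈ Ioo a b → HasDerivAt f c t) : f b - f a = c * (b - a) := by
  have h1 := sub_le_integral_of_ae_hasDerivAt (f' := fun _ => c) (g := fun _ => c) hab hf
    (by filter_upwards [hf'] with t ht hmem; exact ⟨ht hmem, le_rfl⟩) (by simp)
  have h2 := sub_le_integral_of_ae_hasDerivAt (f' := fun _ => -c) (g := fun _ => -c) hab hf.fun_neg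
    (by filter_upwards [hf'] with t ht hmem; exact ⟨(ht hmem).neg, le_rfl⟩) (by simp)
  rw [intervalIntegral.integral_const, smul_eq_mul] at h1 h2
  linarith

lemma norm_sub_le_of_ae_hasDerivAt {E : Type*} [NormedAddCommGroup E] [InnerProductSpace ℝ E]
    [FiniteDimensional ℝ E] {f f' : ℝ → E} {a b M : ℝ} (hab : a ≤ b)
    (hf : AbsolutelyContinuousOnInterval f a b)
    (hf' : ∀ᵐ t, t ∈ Ioo a b → HasDerivAt f (f' t) t ∧ ‖f' t‖ ≤ M) :
    ‖f b - f a‖ ≤ M * (b - a) := by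
  -- Pairing f with the fixed vector f(b) - f(a) reduces the estimate to a scalar function.
  set c := f b - f a with hc
  have h := sub_le_integral_of_ae_hasDerivAt (f := fun t => inner ℝ c (f t))
    (f' := fun t => inner ℝ c (f' t)) (g := fun _ => ‖c‖ * M) hab
    (absolutelyContinuousOnInterval_comp_contDiff (innerSL ℝ c).contDiff hf) (by
      filter_upwards [hf'] with t ht hmem
      refine ⟨(innerSL ℝ c).hasFDerivAt.comp_hasDerivAt t (ht hmem).1, ?_⟩
      exact (real_inner_le_norm _ _).trans
        (mul_le_mul_of_nonneg_left (ht hmem).2 (norm_nonneg _)))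
    (by simp)
  rw [← inner_sub_right, ← hc, real_inner_self_eq_norm_sq, intervalIntegral.integral_const,
    smul_eq_mul] at h
  -- When c = 0 the claim is 0 ≤ M(b - a). For a < b the sign of M is read off at one point of (a,
  -- b) where the bound holds; such a point exists because the interval has positive measure.
  rcases eq_or_ne ‖c‖ 0 with h0 | h0
  · rw [h0]
    rcases hab.eq_or_lt with rfl | hlt
    · simp
    · have : ∃ t, t ∈ Ioo a b ∧ ‖f' t‖ ≤ M := by
        by_contra hcon
        push Not at hcon
        have h1 : ∀ᵐ t : ℝ, t ∉ Ioo a b := by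
          filter_upwards [hf'] with t ht hmem
          exact absurd (ht hmem).2 (not_le.2 (hcon t hmem))
        have : volume (Ioo a b) = 0 := by
          rw [measure_eq_zero_iff_ae_notMem]; exact h1
        simp at this; linarith
      obtain ⟨t, -, ht⟩ := this
      exact mul_nonneg ((norm_nonneg _).trans ht) (by linarith)
  · have : 0 < ‖c‖ := lt_of_le_of_ne (norm_nonneg _) h0.symm
    nlinarith

end AbsolutelyContinuous

/-! ### Structure of hybrid time domains and induction along them -/

section HybridDomain

variable {E : Set (ℝ × ℕ)}

/-- The common shape of all hybrid time domains. -/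
lemma IsHybridTimeDomain.exists_times (hE : IsHybridTimeDomain E) :
    ∃ t : ℕ → ℝ, t 0 = 0 ∧ Monotone t ∧ (0, 0) ∈ E ∧ ∀ s j, (s, j) ∈ E →
      t j ≤ s ∧ Icc (t j) s ⊆ slice E j ∧ ∀ i < j, slice E i = Icc (t i) (t (i + 1)) := by
  obtain ⟨t, h0, hmono, rfl | ⟨J, I, hI, rfl⟩⟩ := hE
  · refine ⟨t, h0, hmono, ?_, fun s j hs => ⟨hs.1, fun x hx => ⟨hx.1, hx.2.trans hs.2⟩,
      fun i _ => rfl⟩⟩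
    simpa [h0] using h0.symm.le.trans (hmono zero_le_one)
  · have hIcc : ∀ s ∈ I, t J ≤ s ∧ Icc (t J) s ⊆ I := by
      intro s hs
      rcases hI with rfl | ⟨-, rfl⟩ | rfl
      · exact ⟨hs.1, fun x hx => ⟨hx.1, hx.2.trans hs.2⟩⟩
      · exact ⟨hs.1, fun x hx => ⟨hx.1, hx.2.trans_lt hs.2⟩⟩
      · exact ⟨hs, fun x hx => hx.1⟩
    refine ⟨t, h0, hmono, ?_, fun s j hs => ?_⟩
    · rcases Nat.eq_zero_or_pos J with rfl | hJ
      · right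
        refine ⟨rfl, ?_⟩
        have h1 : t 0 ≤ t (0 + 1) := hmono (by simp)
        rcases hI with rfl | ⟨h, rfl⟩ | rfl
        · exact ⟨h0.le, h0 ▸ h1⟩
        · exact ⟨h0.le, h0 ▸ h⟩
        · exact h0.le
      · left
        exact ⟨hJ, h0.le, h0.symm.le.trans (hmono (by simp))⟩
    · rcases hs with ⟨hj, hs⟩ | ⟨hj, hs⟩
      · refine ⟨hs.1, fun x hx => Or.inl ⟨hj, hx.1, hx.2.trans hs.2⟩, fun i hi => ?_⟩
        ext x
        simp only [slice, mem_ofPred_eq]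
        constructor
        · rintro (h | h)
          · exact h.2
          · omega
        · exact fun h => Or.inl ⟨by omega, h⟩
      · dsimp only at hj hs
        subst hj
        refine ⟨(hIcc s hs).1, fun x hx => Or.inr ⟨rfl, (hIcc s hs).2 hx⟩, fun i hi => ?_⟩
        ext x
        simp only [slice, mem_ofPred_eq]
        constructor
        · rintro (h | h)
          · exact h.2
          · omega
        · exact fun h => Or.inl ⟨hi, h⟩

lemma IsHybridTimeDomain.zero_mem (hE : IsHybridTimeDomain E) : (0, 0) ∈ E := by
  obtain ⟨t, -, -, h, -⟩ := hE.exists_times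
  exact h

lemma IsHybridTimeDomain.nonneg (hE : IsHybridTimeDomain E) {s : ℝ} {j : ℕ} (h : (s, j) ∈ E) :
    0 ≤ s := by
  obtain ⟨t, h0, hm, -, ht⟩ := hE.exists_times
  exact h0.symm.le.trans ((hm (Nat.zero_le j)).trans (ht s j h).1)

/-- Induction along a hybrid time domain. -/
lemma IsHybridTimeDomain.induction (hE : IsHybridTimeDomain E) {Q : ℝ → ℕ → Prop} (h0 : Q 0 0)
    (hflow : ∀ j a b, a ≤ b → Icc a b ⊆ slice E j → Q a j → Q b j)
    (hjump : ∀ t j, (t, j) ∈ E → (t, j + 1) ∈ E → Q t j → Q t (j + 1))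
    {s : ℝ} {j : ℕ} (h : (s, j) ∈ E) : Q s j := by
  obtain ⟨t, ht0, hm, -, ht⟩ := hE.exists_times
  induction j generalizing s with
  | zero =>
    have := ht s 0 h
    exact hflow 0 (t 0) s this.1 this.2.1 (ht0 ▸ h0)
  | succ j ih =>
    obtain ⟨h1, h2, h3⟩ := ht s (j + 1) h
    have hj : (t (j + 1), j) ∈ E := by
      have : t (j + 1) ∈ slice E j := by
        rw [h3 j (Nat.lt_succ_self j)]; exact ⟨hm (Nat.le_succ j), le_rfl⟩
      exact this
    exact hflow (j + 1) (t (j + 1)) s h1 h2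
      (hjump _ j hj (h2 ⟨le_rfl, h1⟩) (ih hj))

/-- A function that does not increase along flows and jumps is bounded by its initial value. -/
lemma IsHybridTimeDomain.le_initial (hE : IsHybridTimeDomain E) {F : ℝ → ℕ → ℝ}
    (hflow : ∀ j a b, a ≤ b → Icc a b ⊆ slice E j → F b j ≤ F a j)
    (hjump : ∀ t j, (t, j) ∈ E → (t, j + 1) ∈ E → F t (j + 1) ≤ F t j)
    {s : ℝ} {j : ℕ} (h : (s, j) ∈ E) : F s j ≤ F 0 0 :=
  hE.induction (Q := fun s j => F s j ≤ F 0 0) le_rfl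
    (fun j a b hab hs ha => (hflow j a b hab hs).trans ha)
    (fun t j h1 h2 ht => (hjump t j h1 h2).trans ht) h

lemma Ioo_subset_interior_slice {j : ℕ} {a b : ℝ} (h : Icc a b ⊆ slice E j) :
    Ioo a b ⊆ interior (slice E j) :=
  interior_maximal (Ioo_subset_Icc_self.trans h) isOpen_Ioo

end HybridDomain

/-! ### State components, distance to the attractor, differentiability of V -/

section State

variable {nz ny : ℕ}

/-- `stE` as a continuous linear map. -/
def stEL : EuclideanSpace ℝ (StateIx nz ny) →L[ℝ] EuclideanSpace ℝ (ErrIx nz ny) :=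
  upperL.comp lowerL

/-- `stτ` as a continuous linear map. -/
def stτL : EuclideanSpace ℝ (StateIx nz ny) →L[ℝ] ℝ :=
  (EuclideanSpace.proj ()).comp (lowerL.comp lowerL)

@[simp] lemma stEL_apply (x : EuclideanSpace ℝ (StateIx nz ny)) : stEL x = stE x := rfl
@[simp] lemma stτL_apply (x : EuclideanSpace ℝ (StateIx nz ny)) : stτL x = stτ x := rfl
@[simp] lemma stZ_mkState (z : Vec nz) (e : EuclideanSpace ℝ (ErrIx nz ny)) (τ : ℝ) :
    stZ (mkState z e τ) = z := rfl
@[simp] lemma stE_mkState (z : Vec nz) (e : EuclideanSpace ℝ (ErrIx nz ny)) (τ : ℝ) :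
    stE (mkState z e τ) = e := rfl
@[simp] lemma stτ_mkState (z : Vec nz) (e : EuclideanSpace ℝ (ErrIx nz ny)) (τ : ℝ) :
    stτ (mkState z e τ) = τ := rfl

lemma mkState_eta (x : EuclideanSpace ℝ (StateIx nz ny)) :
    mkState (stZ x) (stE x) (stτ x) = x := by
  ext (i | i | i) <;> rfl

lemma stack_eta {ι κ : Type*} (x : EuclideanSpace ℝ (ι ⊕ κ)) : stack (upper x) (lower x) = x := by
  ext (i | i) <;> rfl

lemma norm_stE_le (x : EuclideanSpace ℝ (StateIx nz ny)) : ‖stE x‖ ≤ ‖x‖ := by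
  have h1 := norm_sq_eq_upper_add_lower x
  have h2 := norm_sq_eq_upper_add_lower (lower x)
  refine le_of_sq_le_sq ?_ (norm_nonneg _)
  change ‖upper (lower x)‖ ^ 2 ≤ _
  nlinarith [sq_nonneg ‖upper x‖, sq_nonneg ‖lower (lower x)‖]

/-- The distance to the attractor is the size of the error. -/
lemma infDist_attractor {T₂ : ℝ} {x : EuclideanSpace ℝ (StateIx nz ny)} (hx : stτ x ∈ Icc 0 T₂) :
    Metric.infDist x (attractor nz ny T₂) = ‖stE x‖ := by
  -- Erasing the error while keeping z and τ gives a nearest point: it lies in the attractor because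
  -- the timer is in range. Conversely the error component is linear, does not increase norms and
  -- vanishes on the attractor.
  have hmem : mkState (stZ x) 0 (stτ x) ∈ attractor nz ny T₂ := ⟨rfl, rfl, hx⟩
  refine le_antisymm ((Metric.infDist_le_dist_of_mem hmem).trans_eq ?_) ?_
  · rw [dist_eq_norm]
    have h : x - mkState (stZ x) 0 (stτ x) = mkState 0 (stE x) 0 := by
      conv_lhs => rw [← mkState_eta x]
      ext (i | i | i) <;> simp [mkState, stack, stZ, stE, stτ, upper, lower]
    rw [h, ← sq_eq_sq₀ (norm_nonneg _) (norm_nonneg _), norm_sq_eq_upper_add_lower,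
      norm_sq_eq_upper_add_lower (lower _)]
    simp [mkState, EuclideanSpace.norm_sq_eq (n := Unit)]
  · refine (Metric.le_infDist ⟨_, hmem⟩).2 fun y hy => ?_
    have : stE y = 0 := by rw [← stack_eta (stE y), hy.1, hy.2.1]; ext (i | i) <;> rfl
    rw [dist_eq_norm]
    calc ‖stE x‖ = ‖stE (x - y)‖ := by
          rw [← stEL_apply (x - y), map_sub, stEL_apply, stEL_apply, this, sub_zero]
      _ ≤ _ := norm_stE_le _

lemma contDiff_lyap (P₁ : Matrix (Fin nz) (Fin nz) ℝ) (P₂ : Matrix (Fin ny) (Fin ny) ℝ) (δ : ℝ) :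
    ContDiff ℝ 1 fun x : EuclideanSpace ℝ (StateIx nz ny) => lyap P₁ P₂ δ (stE x) (stτ x) := by
  have h1 : ContDiff ℝ 1 fun x : EuclideanSpace ℝ (StateIx nz ny) => upper (stE x) :=
    (upperL.comp stEL).contDiff
  have h2 : ContDiff ℝ 1 fun x : EuclideanSpace ℝ (StateIx nz ny) => lower (stE x) :=
    (lowerL.comp stEL).contDiff
  have h3 : ContDiff ℝ 1 fun x : EuclideanSpace ℝ (StateIx nz ny) => stτ x := stτL.contDiff
  exact (h1.inner ℝ ((mvL P₁).contDiff.comp h1)).add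
    ((Real.contDiff_exp.comp (contDiff_const.mul h3)).mul
      (h2.inner ℝ ((mvL P₂).contDiff.comp h2)))

lemma inner_mv_comm_of_posDef {n : ℕ} {M : Matrix (Fin n) (Fin n) ℝ} (hM : M.PosDef)
    (x y : Vec n) : inner ℝ x (mv M y) = inner ℝ y (mv M x) := by
  have : Mᵀ = M := by simpa using hM.isHermitian.eq
  simp only [inner_eq_dotProduct, mv]
  conv_lhs => rw [← this, dotProduct_transpose_mulVec]
  rw [dotProduct_comm]

lemma hasDerivAt_lyap {P₁ : Matrix (Fin nz) (Fin nz) ℝ} {P₂ : Matrix (Fin ny) (Fin ny) ℝ}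
    (hP₁ : P₁.PosDef) (hP₂ : P₂.PosDef) (δ : ℝ) {x : ℝ → EuclideanSpace ℝ (StateIx nz ny)}
    {x' : EuclideanSpace ℝ (StateIx nz ny)} {t : ℝ} (hx : HasDerivAt x x' t)
    (hx' : stτ x' = -1) :
    HasDerivAt (fun s => lyap P₁ P₂ δ (stE (x s)) (stτ (x s)))
      (lyapDot P₁ P₂ δ (stE (x t)) (stE x') (stτ (x t))) t := by
  have h1 : HasDerivAt (fun s => upper (stE (x s))) (upper (stE x')) t :=
    (upperL.comp stEL).hasFDerivAt.comp_hasDerivAt t hx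
  have h2 : HasDerivAt (fun s => lower (stE (x s))) (lower (stE x')) t :=
    (lowerL.comp stEL).hasFDerivAt.comp_hasDerivAt t hx
  have h3 : HasDerivAt (fun s => stτ (x s)) (-1) t :=
    hx' ▸ stτL.hasFDerivAt.comp_hasDerivAt t hx
  have k1 := h1.inner ℝ ((mvL P₁).hasFDerivAt.comp_hasDerivAt t h1)
  have k2 := h2.inner ℝ ((mvL P₂).hasFDerivAt.comp_hasDerivAt t h2)
  refine (k1.add (((h3.const_mul δ).exp).mul k2)).congr_deriv ?_
  simp only [lyapDot, Function.comp_apply, mvL_apply]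
  rw [inner_mv_comm_of_posDef hP₁ (upper (stE (x t))),
    inner_mv_comm_of_posDef hP₂ (lower (stE (x t))) (lower (stE x'))]
  ring

end State

/-! ### Timer, jumps and derivative of V along solutions -/

section Solutions

variable {nz ny nw nq ns np : ℕ} {P : Plant nz ny nw nq ns np} {T₁ T₂ : ℝ}
  {L : Matrix (Fin nz) (Fin ny) ℝ} {E : Set (ℝ × ℕ)}
  {φ : ℝ → ℕ → EuclideanSpace ℝ (StateIx nz ny)}
  {u : ℝ → ℕ → EuclideanSpace ℝ (Fin nw ⊕ Fin ny)}

lemma HybridSystem.IsSolutionPair.ac {n m : Type*} [Fintype n] [Fintype m]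
    {𝓗 : HybridSystem n m} {φ : ℝ → ℕ → EuclideanSpace ℝ n} {u : ℝ → ℕ → EuclideanSpace ℝ m}
    (h : 𝓗.IsSolutionPair E φ u) {j : ℕ} {a b : ℝ} (hab : a ≤ b) (hs : Icc a b ⊆ slice E j) :
    AbsolutelyContinuousOnInterval (fun t => φ t j) a b :=
  h.arc j a b hab hs

lemma HybridSystem.IsSolutionPair.ae_flow {n m : Type*} [Fintype n] [Fintype m]
    {𝓗 : HybridSystem n m} {φ : ℝ → ℕ → EuclideanSpace ℝ n} {u : ℝ → ℕ → EuclideanSpace ℝ m}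
    (h : 𝓗.IsSolutionPair E φ u) {j : ℕ} {a b : ℝ} (hs : Icc a b ⊆ slice E j) :
    ∀ᵐ t, t ∈ Ioo a b → HasDerivAt (fun s => φ s j) (𝓗.f (φ t j) (u t j)) t := by
  filter_upwards [h.flow j] with t ht hmem
  exact ht (Ioo_subset_interior_slice hs hmem)

/-- Along solutions the timer stays in `[0, T₂]`. -/
lemma timer_mem (hT₁ : 0 < T₁) (hT : T₁ ≤ T₂) {H : Matrix (Fin ny) (Fin ny) ℝ}
    (h : (P.errorSystem T₁ T₂ L H).IsSolutionPair E φ u) {s : ℝ} {j : ℕ} (hs : (s, j) ∈ E) :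
    stτ (φ s j) ∈ Icc 0 T₂ := by
  refine h.domain.induction (Q := fun s j => stτ (φ s j) ∈ Icc 0 T₂) ?_ ?_ ?_ hs
  · rcases h.initial with h0 | h0
    · exact h0
    · have : stτ (φ 0 0) = 0 := h0
      rw [this]; exact ⟨le_rfl, hT₁.le.trans hT⟩
  · intro j a b hab hI ha
    rcases hab.eq_or_lt with rfl | hlt
    · exact ha
    have hc : ContinuousOn (fun t => stτ (φ t j)) (Icc a b) := by
      have := (h.ac hab hI).continuousOn
      rw [uIcc_of_le hab] at this
      exact stτL.continuous.comp_continuousOn this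
    have hmem : ∀ t ∈ Ioo a b, stτ (φ t j) ∈ Icc 0 T₂ := fun t ht =>
      h.flow_mem j t (Ioo_subset_interior_slice hI ht)
    -- Membership in the flow set is only known on the interior of a slice; the endpoint is reached
    -- by continuity, the range of the timer being closed.
    have hcl : b ∈ closure (Ioo a b) := by rw [closure_Ioo hlt.ne]; exact ⟨hab, le_rfl⟩
    have := (hc b ⟨hab, le_rfl⟩).mono Ioo_subset_Icc_self |>.mem_closure hcl hmem
    rwa [closure_Icc] at this
  · intro t j h1 h2 _
    obtain ⟨-, v, hv, hG⟩ := h.jump t j h1 h2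
    rw [hG, stτ_mkState]
    exact ⟨hT₁.le.trans hv.1, hv.2⟩

/-- At jumps the timer vanishes and is reset, and the error is reset to `(ε, -η)`. -/
lemma jump_state {H : Matrix (Fin ny) (Fin ny) ℝ}
    (h : (P.errorSystem T₁ T₂ L H).IsSolutionPair E φ u) {s : ℝ} {j : ℕ} (h₁ : (s, j) ∈ E)
    (h₂ : (s, j + 1) ∈ E) :
    stτ (φ s j) = 0 ∧ stτ (φ s (j + 1)) ∈ Icc T₁ T₂ ∧
      upper (stE (φ s (j + 1))) = upper (stE (φ s j)) ∧
      lower (stE (φ s (j + 1))) = -lower (u s j) := by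
  obtain ⟨hD, v, hv, hG⟩ := h.jump s j h₁ h₂
  rw [hG]
  refine ⟨hD, by simpa using hv, ?_, ?_⟩
  · have he : (stE (φ s j)).ofLp =
        Sum.elim (upper (stE (φ s j))).ofLp (lower (stE (φ s j))).ofLp := by
      ext (i | i) <;> rfl
    ext i
    rw [stE_mkState]
    simp only [upper, mv, PiLp.add_apply]
    rw [he]
    simp [Matrix.fromBlocks_mulVec, upper]
  · have he : (stE (φ s j)).ofLp =
        Sum.elim (upper (stE (φ s j))).ofLp (lower (stE (φ s j))).ofLp := by
      ext (i | i) <;> rfl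
    ext i
    rw [stE_mkState]
    simp only [lower, mv, PiLp.add_apply]
    rw [he]
    simp [Matrix.fromBlocks_mulVec, lower, Matrix.neg_mulVec]

/-- Along flows the timer decreases at unit rate. -/
lemma timer_flow {H : Matrix (Fin ny) (Fin ny) ℝ}
    (h : (P.errorSystem T₁ T₂ L H).IsSolutionPair E φ u) {j : ℕ} {a b : ℝ} (hab : a ≤ b)
    (hs : Icc a b ⊆ slice E j) : stτ (φ b j) + b = stτ (φ a j) + a := by
  have hac := absolutelyContinuousOnInterval_comp_contDiff stτL.contDiff (h.ac hab hs)
  have hd : ∀ᵐ t, t ∈ Ioo a b → HasDerivAt (fun s => stτ (φ s j)) (-1) t := by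
    filter_upwards [h.ae_flow hs] with t ht hmem
    exact stτL.hasFDerivAt.comp_hasDerivAt t (ht hmem)
  have := sub_eq_mul_of_ae_hasDerivAt_const hab hac hd
  simp only [stτL_apply] at this
  linarith

/-- Average dwell time: the number of jumps grows at most linearly. -/
lemma jumps_le (hT₁ : 0 < T₁) (hT : T₁ ≤ T₂) {H : Matrix (Fin ny) (Fin ny) ℝ}
    (h : (P.errorSystem T₁ T₂ L H).IsSolutionPair E φ u) {s : ℝ} {j : ℕ} (hs : (s, j) ∈ E) :
    j * T₁ ≤ s + T₂ := by
  -- Along flows τ + s is conserved, so this quantity is constant; at a jump j T₁ grows by T₁ while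
  -- τ rises from 0 to at least T₁.
  have key := h.domain.le_initial (F := fun s j => j * T₁ - s - stτ (φ s j))
    (fun j a b hab hI => by have := timer_flow h hab hI; linarith)
    (fun t j h1 h2 => by
      obtain ⟨h3, h4, -⟩ := jump_state h h1 h2
      have := h4.1
      push_cast
      linarith) hs
  have h1 := (timer_mem hT₁ hT h hs).2
  have h2 := (timer_mem hT₁ hT h h.domain.zero_mem).1
  simp at key
  linarith

lemma stE_errorSystem_f (x : EuclideanSpace ℝ (StateIx nz ny))
    (v : EuclideanSpace ℝ (Fin nw ⊕ Fin ny)) :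
    stE ((P.errorSystem T₁ T₂ L 0).f x v) = errField P L (stZ x) (stE x) (upper v) := by
  simp only [Plant.errorSystem, stE_mkState, errField]

lemma stτ_errorSystem_f {H : Matrix (Fin ny) (Fin ny) ℝ} (x : EuclideanSpace ℝ (StateIx nz ny))
    (v : EuclideanSpace ℝ (Fin nw ⊕ Fin ny)) :
    stτ ((P.errorSystem T₁ T₂ L H).f x v) = -1 := by
  simp only [Plant.errorSystem, stτ_mkState]

/-- The derivative of the Lyapunov function along flows. -/
lemma ae_hasDerivAt_lyap {P₁ : Matrix (Fin nz) (Fin nz) ℝ} {P₂ : Matrix (Fin ny) (Fin ny) ℝ}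
    (hP₁ : P₁.PosDef) (hP₂ : P₂.PosDef) (δ : ℝ)
    (h : (P.errorSystem T₁ T₂ L 0).IsSolutionPair E φ u) {j : ℕ} {a b : ℝ}
    (hs : Icc a b ⊆ slice E j) :
    ∀ᵐ t, t ∈ Ioo a b → HasDerivAt (fun s => lyap P₁ P₂ δ (stE (φ s j)) (stτ (φ s j)))
      (lyapDot P₁ P₂ δ (stE (φ t j))
        (errField P L (stZ (φ t j)) (stE (φ t j)) (upper (u t j))) (stτ (φ t j))) t := by
  filter_upwards [h.ae_flow hs] with t ht hmem
  have := hasDerivAt_lyap hP₁ hP₂ δ (ht hmem) (stτ_errorSystem_f _ _)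
  rwa [stE_errorSystem_f] at this

lemma lyap_ac (P₁ : Matrix (Fin nz) (Fin nz) ℝ) (P₂ : Matrix (Fin ny) (Fin ny) ℝ) (δ : ℝ)
    {H : Matrix (Fin ny) (Fin ny) ℝ}
    (h : (P.errorSystem T₁ T₂ L H).IsSolutionPair E φ u) {j : ℕ} {a b : ℝ} (hab : a ≤ b)
    (hs : Icc a b ⊆ slice E j) :
    AbsolutelyContinuousOnInterval (fun s => lyap P₁ P₂ δ (stE (φ s j)) (stτ (φ s j))) a b :=
  absolutelyContinuousOnInterval_comp_contDiff (contDiff_lyap P₁ P₂ δ) (h.ac hab hs)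

end Solutions

/-! ### Input-to-state stability and decay rate -/

section Stability

variable {nz ny nw nq ns np : ℕ} {P : Plant nz ny nw nq ns np} {T₁ T₂ lamt γ δ : ℝ}
  {L : Matrix (Fin nz) (Fin ny) ℝ} {P₁ : Matrix (Fin nz) (Fin nz) ℝ}
  {P₂ : Matrix (Fin ny) (Fin ny) ℝ}

/-- The function `lyap` is a Lyapunov function with dissipation `2 λ V + |C_p ε|²` and supply
`γ² |w|²`, and grows by at most `k |η|²` at jumps. -/
structure IsDissipative (P : Plant nz ny nw nq ns np) (T₁ T₂ lamt γ : ℝ)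
    (L : Matrix (Fin nz) (Fin ny) ℝ) (P₁ : Matrix (Fin nz) (Fin nz) ℝ)
    (P₂ : Matrix (Fin ny) (Fin ny) ℝ) (δ a b k : ℝ) : Prop where
  T₁_pos : 0 < T₁
  T₁_le : T₁ ≤ T₂
  lamt_pos : 0 < lamt
  γ_pos : 0 < γ
  P₁_pos : P₁.PosDef
  P₂_pos : P₂.PosDef
  a_pos : 0 < a
  b_pos : 0 < b
  k_pos : 0 < k
  le_lyap : ∀ (e : EuclideanSpace ℝ (ErrIx nz ny)), ∀ τ ∈ Icc 0 T₂,
    a * ‖e‖ ^ 2 ≤ lyap P₁ P₂ δ e τ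
  lyap_le : ∀ (e : EuclideanSpace ℝ (ErrIx nz ny)), ∀ τ ∈ Icc 0 T₂,
    lyap P₁ P₂ δ e τ ≤ b * ‖e‖ ^ 2
  lyap_jump : ∀ (e e' : EuclideanSpace ℝ (ErrIx nz ny)), ∀ τ ∈ Icc 0 T₂, upper e' = upper e →
    lyap P₁ P₂ δ e' τ ≤ lyap P₁ P₂ δ e 0 + k * ‖lower e'‖ ^ 2
  dissip : ∀ (z : Vec nz) (e : EuclideanSpace ℝ (ErrIx nz ny)) (w : Vec nw), ∀ τ ∈ Icc 0 T₂,
    lyapDot P₁ P₂ δ e (errField P L z e w) τ + 2 * lamt * lyap P₁ P₂ δ e τ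
      + ‖mv P.Cp (upper e)‖ ^ 2 ≤ γ ^ 2 * ‖w‖ ^ 2

/-- Before the jump the timer is 0, and the nonnegative contribution of the old θ̃ is simply
discarded. The contribution of the new θ̃ is bounded with the largest weight e^{δT₂}. -/
lemma exists_lyap_jump_bound (P₁ : Matrix (Fin nz) (Fin nz) ℝ) (hP₂ : P₂.PosDef) (hδ : 0 < δ)
    (T₂ : ℝ) :
    ∃ k : ℝ, 0 < k ∧ ∀ (e e' : EuclideanSpace ℝ (ErrIx nz ny)), ∀ τ ∈ Icc 0 T₂,
      upper e' = upper e → lyap P₁ P₂ δ e' τ ≤ lyap P₁ P₂ δ e 0 + k * ‖lower e'‖ ^ 2 := by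
  obtain ⟨a₂, b₂, ha₂, hb₂, h₂⟩ := exists_bounds_of_posDef hP₂
  refine ⟨Real.exp (δ * T₂) * b₂, by positivity, fun e e' τ hτ he => ?_⟩
  have hn : ∀ x, 0 ≤ inner ℝ x (mv P₂ x) := fun x => le_trans (by positivity) (h₂ x).1
  have h1 : Real.exp (δ * τ) * inner ℝ (lower e') (mv P₂ (lower e')) ≤
      Real.exp (δ * T₂) * (b₂ * ‖lower e'‖ ^ 2) := by
    gcongr
    · exact hn _
    · exact hτ.2
    · exact (h₂ _).2
  have h2 := hn (lower e)
  simp only [lyap, he, mul_zero, Real.exp_zero]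
  linarith

variable {a b k : ℝ} {E : Set (ℝ × ℕ)} {φ : ℝ → ℕ → EuclideanSpace ℝ (StateIx nz ny)}
  {u : ℝ → ℕ → EuclideanSpace ℝ (Fin nw ⊕ Fin ny)}

/-- The input-to-state gain of the Lyapunov function. -/
def lyapGain (T₁ T₂ lamt γ k : ℝ) : ℝ :=
  γ ^ 2 / (2 * lamt) +
    k / (1 - Real.exp (-(2 * lamt * T₁))) * Real.exp (2 * lamt * (T₂ - T₁))

lemma IsDissipative.one_sub_exp_pos (h : IsDissipative P T₁ T₂ lamt γ L P₁ P₂ δ a b k) :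
    0 < 1 - Real.exp (-(2 * lamt * T₁)) := by
  have := h.T₁_pos
  have := h.lamt_pos
  rw [sub_pos, Real.exp_lt_one_iff]
  have : 0 < 2 * lamt * T₁ := by positivity
  linarith

lemma IsDissipative.lyapGain_pos (h : IsDissipative P T₁ T₂ lamt γ L P₁ P₂ δ a b k) :
    0 < lyapGain T₁ T₂ lamt γ k := by
  have h1 := h.one_sub_exp_pos
  have h2 := h.lamt_pos
  have h3 := h.γ_pos
  have h4 := h.k_pos
  unfold lyapGain
  positivity

/-- Grönwall's argument with integrating factor e^{2λ_t t}, applied to V̇ ≤ -2λ_t V + γ²W²; the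
subtracted constant is the equilibrium value of this comparison equation. -/
lemma IsDissipative.flow_le (h : IsDissipative P T₁ T₂ lamt γ L P₁ P₂ δ a b k)
    (hsol : (P.errorSystem T₁ T₂ L 0).IsSolutionPair E φ u) {W : ℝ}
    {j : ℕ} (hw : ∀ᵐ t, t ∈ interior (slice E j) → ‖upper (u t j)‖ ≤ W) {s r : ℝ}
    (hsr : s ≤ r) (hI : Icc s r ⊆ slice E j) :
    Real.exp (2 * lamt * r) * (lyap P₁ P₂ δ (stE (φ r j)) (stτ (φ r j))
        - γ ^ 2 / (2 * lamt) * W ^ 2) ≤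
      Real.exp (2 * lamt * s) * (lyap P₁ P₂ δ (stE (φ s j)) (stτ (φ s j))
        - γ ^ 2 / (2 * lamt) * W ^ 2) := by
  have hexp : AbsolutelyContinuousOnInterval (fun t => Real.exp (2 * lamt * t)) s r :=
    ((Real.contDiff_exp.comp (contDiff_const.mul contDiff_id)).contDiffOn
      (n := 1)).absolutelyContinuousOnInterval
  have hconst : AbsolutelyContinuousOnInterval (fun _ : ℝ => γ ^ 2 / (2 * lamt) * W ^ 2) s r :=
    (LipschitzWith.const _).lipschitzOnWith.absolutelyContinuousOnInterval
  refine le_of_ae_hasDerivAt_nonpos (f' := fun t => Real.exp (2 * lamt * t) * (2 * lamt * 1) *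
      (lyap P₁ P₂ δ (stE (φ t j)) (stτ (φ t j)) - γ ^ 2 / (2 * lamt) * W ^ 2) +
      Real.exp (2 * lamt * t) * (lyapDot P₁ P₂ δ (stE (φ t j))
        (errField P L (stZ (φ t j)) (stE (φ t j)) (upper (u t j))) (stτ (φ t j)))) hsr
    (hexp.fun_mul ((lyap_ac P₁ P₂ δ hsol hsr hI).fun_sub hconst)) ?_
  filter_upwards [ae_hasDerivAt_lyap h.P₁_pos h.P₂_pos δ hsol hI, hw] with t ht hwt hmem
  have hwt := hwt (Ioo_subset_interior_slice hI hmem)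
  refine ⟨(((hasDerivAt_id t).const_mul (2 * lamt)).exp).mul ((ht hmem).sub_const _), ?_⟩
  have hd := h.dissip (stZ (φ t j)) (stE (φ t j)) (upper (u t j)) (stτ (φ t j))
    (timer_mem h.T₁_pos h.T₁_le hsol (hI (Ioo_subset_Icc_self hmem)))
  have hl := h.lamt_pos
  have hW : γ ^ 2 * ‖upper (u t j)‖ ^ 2 ≤ γ ^ 2 * W ^ 2 := by gcongr
  have hg : 2 * lamt * (γ ^ 2 / (2 * lamt) * W ^ 2) = γ ^ 2 * W ^ 2 := by field_simp
  have hy := sq_nonneg ‖mv P.Cp (upper (stE (φ t j)))‖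
  rw [mul_assoc, ← mul_add]
  refine mul_nonpos_of_nonneg_of_nonpos (Real.exp_pos _).le ?_
  linarith

/-- Input-to-state stability estimate for the Lyapunov function. -/
lemma IsDissipative.lyap_le_of_input (h : IsDissipative P T₁ T₂ lamt γ L P₁ P₂ δ a b k)
    (hsol : (P.errorSystem T₁ T₂ L 0).IsSolutionPair E φ u) {W : ℝ}
    (hw : ∀ j, ∀ᵐ t, t ∈ interior (slice E j) → ‖upper (u t j)‖ ≤ W)
    (hη : ∀ t j, (t, j) ∈ E → (t, j + 1) ∈ E → ‖lower (u t j)‖ ≤ W)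
    {s : ℝ} {j : ℕ} (hs : (s, j) ∈ E) :
    lyap P₁ P₂ δ (stE (φ s j)) (stτ (φ s j)) ≤
      Real.exp (-(2 * lamt * s)) * lyap P₁ P₂ δ (stE (φ 0 0)) (stτ (φ 0 0)) +
        lyapGain T₁ T₂ lamt γ k * W ^ 2 := by
  set q := Real.exp (-(2 * lamt * T₁)) with hq
  have hq1 : 0 < 1 - q := h.one_sub_exp_pos
  have hl := h.lamt_pos
  have hk := h.k_pos
  set K := k / (1 - q) with hK
  have hKpos : 0 < K := by positivity
  -- The last term is the budget for jumps. Since τ + s is constant along flows and grows by at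
  -- least T₁ at jumps, at a jump time t the exponential increases by at least (1 - q) e^{2λ_t t}.
  -- With K = k/(1 - q) this pays for the increase k W² e^{2λ_t t} of the weighted V; in effect a
  -- geometric series is summed.
  have key := hsol.domain.le_initial (F := fun s j =>
      Real.exp (2 * lamt * s) * (lyap P₁ P₂ δ (stE (φ s j)) (stτ (φ s j))
        - γ ^ 2 / (2 * lamt) * W ^ 2)
        - K * W ^ 2 * Real.exp (2 * lamt * (stτ (φ s j) + s - T₁)))
    (fun j a b hab hI => by
      have h1 := h.flow_le hsol (hw j) hab hI
      rw [timer_flow hsol hab hI]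
      linarith)
    (fun t j h1 h2 => by
      obtain ⟨hτ, hτ', hup, hlow⟩ := jump_state hsol h1 h2
      have hj := h.lyap_jump (stE (φ t j)) (stE (φ t (j + 1))) _
        ⟨h.T₁_pos.le.trans hτ'.1, hτ'.2⟩ hup
      rw [hlow, norm_neg] at hj
      have hη2 : k * ‖lower (u t j)‖ ^ 2 ≤ k * W ^ 2 := by gcongr; exact hη t j h1 h2
      have e1 : Real.exp (2 * lamt * (stτ (φ t j) + t - T₁)) = Real.exp (2 * lamt * t) * q := by
        rw [hτ, hq, ← Real.exp_add]; ring_nf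
      have e2 : Real.exp (2 * lamt * t) ≤ Real.exp (2 * lamt * (stτ (φ t (j + 1)) + t - T₁)) := by
        gcongr; linarith [hτ'.1]
      have e3 : K * (1 - q) = k := by rw [hK]; field_simp
      have hc : 0 ≤ K * W ^ 2 := by positivity
      have e4 := mul_le_mul_of_nonneg_left e2 hc
      rw [e1, hτ]
      have e5 := mul_le_mul_of_nonneg_left (hj.trans (add_le_add_right hη2 _))
        (Real.exp_pos (2 * lamt * t)).le
      rw [← e3] at e5
      linarith) hs
  simp only [mul_zero, Real.exp_zero, one_mul] at key
  have hτ := (timer_mem h.T₁_pos h.T₁_le hsol hs).2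
  have e0 : 0 ≤ K * W ^ 2 * Real.exp (2 * lamt * (stτ (φ 0 0) + 0 - T₁)) := by positivity
  have e1 : 0 ≤ γ ^ 2 / (2 * lamt) * W ^ 2 := by positivity
  -- The bound τ ≤ T₂ produces the factor e^{2λ_t(T₂ - T₁)} in `lyapGain`.
  have e2 : Real.exp (2 * lamt * (stτ (φ s j) + s - T₁)) ≤
      Real.exp (2 * lamt * s) * Real.exp (2 * lamt * (T₂ - T₁)) := by
    rw [← Real.exp_add]
    refine Real.exp_le_exp.2 ?_
    have := mul_le_mul_of_nonneg_left hτ hl.le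
    linarith
  have e3 := mul_le_mul_of_nonneg_left e2 (show 0 ≤ K * W ^ 2 by positivity)
  have e4 : Real.exp (2 * lamt * s) * (lyap P₁ P₂ δ (stE (φ s j)) (stτ (φ s j)) -
      lyapGain T₁ T₂ lamt γ k * W ^ 2) ≤ lyap P₁ P₂ δ (stE (φ 0 0)) (stτ (φ 0 0)) := by
    simp only [lyapGain, ← hq, ← hK]
    linarith
  have e5 := mul_le_mul_of_nonneg_left e4 (Real.exp_pos (-(2 * lamt * s))).le
  rw [← mul_assoc, ← Real.exp_add, neg_add_cancel, Real.exp_zero, one_mul] at e5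
  linarith

/-- Input-to-state stability estimate for the error. -/
lemma IsDissipative.norm_le_of_input (h : IsDissipative P T₁ T₂ lamt γ L P₁ P₂ δ a b k)
    (hsol : (P.errorSystem T₁ T₂ L 0).IsSolutionPair E φ u) {W : ℝ} (hW : 0 ≤ W)
    (hw : ∀ j, ∀ᵐ t, t ∈ interior (slice E j) → ‖upper (u t j)‖ ≤ W)
    (hη : ∀ t j, (t, j) ∈ E → (t, j + 1) ∈ E → ‖lower (u t j)‖ ≤ W)
    {s : ℝ} {j : ℕ} (hs : (s, j) ∈ E) :
    ‖stE (φ s j)‖ ≤ max (√(2 * b / a) * Real.exp (-lamt * s) * ‖stE (φ 0 0)‖)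
      (√(2 * lyapGain T₁ T₂ lamt γ k / a) * W) := by
  have h1 := h.lyap_le_of_input hsol hw hη hs
  have h2 := h.le_lyap (stE (φ s j)) _ (timer_mem h.T₁_pos h.T₁_le hsol hs)
  have h3 := h.lyap_le (stE (φ 0 0)) _ (timer_mem h.T₁_pos h.T₁_le hsol hsol.domain.zero_mem)
  have ha := h.a_pos
  have hb := h.b_pos
  have hg := h.lyapGain_pos
  set g := lyapGain T₁ T₂ lamt γ k
  have hexp : Real.exp (-(2 * lamt * s)) = Real.exp (-lamt * s) ^ 2 := by
    rw [← Real.exp_nat_mul]; congr 1; push_cast; ring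
  rw [hexp] at h1
  have h4 : a * ‖stE (φ s j)‖ ^ 2 ≤
      b * (Real.exp (-lamt * s) * ‖stE (φ 0 0)‖) ^ 2 + g * W ^ 2 := by
    have := mul_le_mul_of_nonneg_left h3 (sq_nonneg (Real.exp (-lamt * s)))
    rw [mul_pow]; linarith
  set A := Real.exp (-lamt * s) * ‖stE (φ 0 0)‖ with hA
  have hA0 : 0 ≤ A := by positivity
  rw [mul_assoc, ← hA, le_max_iff]
  -- A sum is at most twice its larger term: this yields the maximum, and the factor 2 under the
  -- square roots.
  have hsq : ∀ {c x : ℝ}, 0 ≤ c → 0 ≤ x → a * ‖stE (φ s j)‖ ^ 2 ≤ 2 * (c * x ^ 2) →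
      ‖stE (φ s j)‖ ≤ √(2 * c / a) * x := by
    intro c x hc hx hle
    refine le_of_sq_le_sq ?_ (by positivity)
    rw [mul_pow, Real.sq_sqrt (by positivity), div_mul_eq_mul_div, le_div_iff₀ ha]
    linarith
  rcases le_total (g * W ^ 2) (b * A ^ 2) with hc | hc
  · exact Or.inl (hsq hb.le hA0 (by linarith))
  · exact Or.inr (hsq hg.le hW (by linarith))

/-- A jump time is the right endpoint of its slice, never an interior point. Hence the essential
supremum off the jump times controls the input along flows. -/
lemma IsHybridTimeDomain.interior_slice_subset (hE : IsHybridTimeDomain E) (j : ℕ) :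
    interior (slice E j) ⊆ slice (E \ jumpTimes E) j := by
  intro s hs
  have hs' : s ∈ slice E j := interior_subset hs
  refine ⟨hs', fun hj => ?_⟩
  obtain ⟨t, -, hm, -, ht⟩ := hE.exists_times
  have h1 := ht s (j + 1) hj.2
  rw [h1.2.2 j (Nat.lt_succ_self j), interior_Icc] at hs
  exact absurd hs.2 (not_lt.2 h1.1)

lemma norm_le_hybridSupNorm {m : Type*} [Fintype m] {u : ℝ → ℕ → EuclideanSpace ℝ m}
    (hE : IsHybridTimeDomain E) (hu : hybridSupNorm E u ≠ ∞) :
    (∀ j, ∀ᵐ t, t ∈ interior (slice E j) → ‖u t j‖ ≤ (hybridSupNorm E u).toReal) ∧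
      ∀ t j, (t, j) ∈ E → (t, j + 1) ∈ E → ‖u t j‖ ≤ (hybridSupNorm E u).toReal := by
  have hconv : ∀ x : EuclideanSpace ℝ m, ‖x‖ₑ ≤ hybridSupNorm E u →
      ‖x‖ ≤ (hybridSupNorm E u).toReal := fun x hx => by
    rw [← toReal_enorm]; exact ENNReal.toReal_mono hu hx
  refine ⟨fun j => ?_, fun t j h1 h2 => hconv _ ?_⟩
  · have h1 : ∀ᵐ t ∂(volume.restrict (slice (E \ jumpTimes E) j)), ‖u t j‖ₑ ≤
        hybridSupNorm E u := by
      filter_upwards [ENNReal.ae_le_essSup (μ := volume.restrict (slice (E \ jumpTimes E) j))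
        (fun t => ‖u t j‖ₑ)] with t ht
      exact ht.trans ((le_iSup (fun j => essSup (fun t => ‖u t j‖ₑ)
        (volume.restrict (slice (E \ jumpTimes E) j))) j).trans (le_max_left _ _))
    have h2 : ∀ᵐ t ∂(volume.restrict (interior (slice E j))), ‖u t j‖ₑ ≤
        hybridSupNorm E u :=
      ae_mono (Measure.restrict_mono_set volume (hE.interior_slice_subset j)) h1
    rw [ae_restrict_iff' isOpen_interior.measurableSet] at h2
    filter_upwards [h2] with t ht hmem
    exact hconv _ (ht hmem)
  · refine le_trans ?_ (le_max_right _ _)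
    exact le_iSup₂ (f := fun (p : ℝ × ℕ) (_ : p ∈ jumpTimes E) => ‖u p.1 p.2‖ₑ) (t, j) ⟨h1, h2⟩

lemma norm_upper_le {ι κ : Type*} [Fintype ι] [Fintype κ] (x : EuclideanSpace ℝ (ι ⊕ κ)) :
    ‖upper x‖ ≤ ‖x‖ := by
  refine le_of_sq_le_sq ?_ (norm_nonneg _)
  rw [norm_sq_eq_upper_add_lower x]
  linarith [sq_nonneg ‖lower x‖]

lemma norm_lower_le {ι κ : Type*} [Fintype ι] [Fintype κ] (x : EuclideanSpace ℝ (ι ⊕ κ)) :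
    ‖lower x‖ ≤ ‖x‖ := by
  refine le_of_sq_le_sq ?_ (norm_nonneg _)
  rw [norm_sq_eq_upper_add_lower x]
  linarith [sq_nonneg ‖upper x‖]

/-- With zero inputs the error decays at rate `lamt` in ordinary time. -/
lemma IsDissipative.rate (h : IsDissipative P T₁ T₂ lamt γ L P₁ P₂ δ a b k)
    (hsol : (P.errorSystem T₁ T₂ L 0).IsSolutionPair E φ u) (hu : ∀ p ∈ E, u p.1 p.2 = 0)
    {s : ℝ} {j : ℕ} (hs : (s, j) ∈ E) :
    Metric.infDist (φ s j) (attractor nz ny T₂) ≤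
      √(2 * b / a) * Real.exp (-lamt * s) * Metric.infDist (φ 0 0) (attractor nz ny T₂) := by
  rw [infDist_attractor (timer_mem h.T₁_pos h.T₁_le hsol hs),
    infDist_attractor (timer_mem h.T₁_pos h.T₁_le hsol hsol.domain.zero_mem)]
  have := h.norm_le_of_input hsol le_rfl
    (fun j => ae_of_all _ fun t ht => by
      have hm : t ∈ slice E j := interior_subset ht
      have h0 := hu (t, j) hm
      dsimp only at h0
      rw [h0]; exact (norm_upper_le _).trans (by simp))
    (fun t j h1 _ => by
      have h0 := hu (t, j) h1
      dsimp only at h0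
      rw [h0]; exact (norm_lower_le _).trans (by simp)) hs
  rw [mul_zero, max_eq_left (by positivity)] at this
  exact this

lemma isClassK_linear {c : ℝ} (hc : 0 < c) : IsClassK fun x => c * x :=
  ⟨by fun_prop, fun _ _ _ _ h => by dsimp only; gcongr, mul_zero c⟩

/-- The estimate of exponential input-to-state stability. -/
lemma IsDissipative.iss_estimate (h : IsDissipative P T₁ T₂ lamt γ L P₁ P₂ δ a b k) :
    ∃ (κ lam : ℝ) (ρ : ℝ → ℝ), 0 < κ ∧ 0 < lam ∧ IsClassK ρ ∧
      ∀ (E : Set (ℝ × ℕ)) (φ : ℝ → ℕ → EuclideanSpace ℝ (StateIx nz ny))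
        (u : ℝ → ℕ → EuclideanSpace ℝ (Fin nw ⊕ Fin ny)),
        (P.errorSystem T₁ T₂ L 0).IsSolutionPair E φ u → hybridSupNorm E u ≠ ∞ →
        ∀ (t : ℝ) (j : ℕ), (t, j) ∈ E →
          Metric.infDist (φ t j) (attractor nz ny T₂) ≤
            max (κ * Real.exp (-lam * (t + j)) *
                Metric.infDist (φ 0 0) (attractor nz ny T₂))
              (ρ (hybridSupNorm E u).toReal) := by
  have ha := h.a_pos
  have hb := h.b_pos
  have hg := h.lyapGain_pos
  have hl := h.lamt_pos
  have hT₁ := h.T₁_pos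
  -- From j T₁ ≤ t + T₂ one gets min(1, T₁)(t + j) ≤ 2t + T₂. Multiplying by λ_t/2 bounds e^{-λ_t t}
  -- by an exponential in t + j, at the price of the factor e^{λ_t T₂/2}.
  refine ⟨√(2 * b / a) * Real.exp (lamt * T₂ / 2), lamt / 2 * min 1 T₁,
    fun x => √(2 * lyapGain T₁ T₂ lamt γ k / a) * x, by positivity, by positivity,
    isClassK_linear (by positivity), fun E φ u hsol hu t j hs => ?_⟩
  rw [infDist_attractor (timer_mem h.T₁_pos h.T₁_le hsol hs),
    infDist_attractor (timer_mem h.T₁_pos h.T₁_le hsol hsol.domain.zero_mem)]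
  obtain ⟨h1, h2⟩ := norm_le_hybridSupNorm hsol.domain hu
  refine (h.norm_le_of_input hsol ENNReal.toReal_nonneg
    (fun j => by filter_upwards [h1 j] with t ht hm using (norm_upper_le _).trans (ht hm))
    (fun t j i1 i2 => (norm_lower_le _).trans (h2 t j i1 i2)) hs).trans ?_
  refine max_le_max_right _ ?_
  gcongr ?_ * _
  rw [mul_assoc, ← Real.exp_add]
  gcongr
  have hj := jumps_le h.T₁_pos h.T₁_le hsol hs
  have ht := hsol.domain.nonneg hs
  have e1 : min 1 T₁ * t ≤ t := by
    calc _ ≤ 1 * t := by gcongr; exact min_le_left _ _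
      _ = t := one_mul t
  have e2 : min 1 T₁ * j ≤ T₁ * j := by gcongr; exact min_le_right _ _
  have e3 : lamt / 2 * (min 1 T₁ * t + min 1 T₁ * j) ≤ lamt / 2 * (t + (t + T₂)) := by
    gcongr; linarith
  linarith

end Stability

/-! ### The ℒ₂-gain along hybrid solutions -/

section Gain

variable {nz ny nw nq ns np : ℕ} {P : Plant nz ny nw nq ns np} {T₁ T₂ lamt γ δ a b k : ℝ}
  {L : Matrix (Fin nz) (Fin ny) ℝ} {P₁ : Matrix (Fin nz) (Fin nz) ℝ}
  {P₂ : Matrix (Fin ny) (Fin ny) ℝ}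
  {E : Set (ℝ × ℕ)} {φ : ℝ → ℕ → EuclideanSpace ℝ (StateIx nz ny)}
  {u : ℝ → ℕ → EuclideanSpace ℝ (Fin nw ⊕ Fin ny)}

/-- Slices with a smaller index end no later than s, so they miss r. Only the left endpoint of a
slice can belong to an earlier index, which is why half-open intervals are used in the integrals. -/
lemma IsHybridTimeDomain.firstIndex_eq (hE : IsHybridTimeDomain E) {s r : ℝ} {j : ℕ}
    (hs : (s, j) ∈ E) (hr : (r, j) ∈ E) (hsr : s < r) : firstIndex E r = j := by
  obtain ⟨t, -, hm, -, ht⟩ := hE.exists_times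
  refine le_antisymm (Nat.sInf_le hr) (le_csInf ⟨j, hr⟩ fun i hi => ?_)
  by_contra hlt
  push Not at hlt
  obtain ⟨h1, -, h3⟩ := ht s j hs
  have hri : r ∈ slice E i := hi
  rw [h3 i hlt] at hri
  have := hm (Nat.succ_le_of_lt hlt)
  exact absurd (hri.2.trans (this.trans h1)) (not_le.2 hsr)

lemma IsHybridTimeDomain.Icc_subset_timeProj (hE : IsHybridTimeDomain E) {s : ℝ}
    (hs : s ∈ timeProj E) : Icc 0 s ⊆ timeProj E := by
  obtain ⟨j, hj⟩ := hs
  refine hE.induction (Q := fun s _ => Icc 0 s ⊆ timeProj E) ?_ ?_ (fun _ _ _ _ h => h) hj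
  · rintro x ⟨h1, h2⟩
    obtain rfl := le_antisymm h1 h2
    exact ⟨0, hE.zero_mem⟩
  · intro j a b _ hI ha x hx
    rcases le_total x a with h | h
    · exact ha ⟨hx.1, h⟩
    · exact ⟨j, hI ⟨h, hx.2⟩⟩

/-- Exhaustion of an interval starting at `0` by its initial segments. -/
lemma setLIntegral_le_of_forall_Ioc {I : Set ℝ} (h0 : ∀ s ∈ I, 0 ≤ s)
    (hI : ∀ s ∈ I, Icc 0 s ⊆ I) {f : ℝ → ℝ≥0∞} {B : ℝ≥0∞}
    (hB : ∀ s ∈ I, ∫⁻ x in Ioc 0 s, f x ≤ B) : ∫⁻ x in I, f x ≤ B := by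
  -- Rational endpoints give a countable directed family, to which monotone convergence applies. It
  -- covers I except possibly 0 and a greatest element.
  set D : {q : ℚ // (q : ℝ) ∈ I} → Set ℝ := fun q => Ioc 0 (q : ℝ) with hD
  have hcov : (I : Set ℝ) ≤ᵐ[volume] ⋃ q, D q := by
    have hsub : (I \ ⋃ q, D q) ⊆ {0} ∪ {x | x ∈ I ∧ ∀ y ∈ I, y ≤ x} := by
      rintro x ⟨hx, hx'⟩
      rcases (h0 x hx).eq_or_lt with h | h
      · exact Or.inl h.symm
      · refine Or.inr ⟨hx, fun y hy => ?_⟩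
        by_contra hlt
        push Not at hlt
        obtain ⟨q, hq1, hq2⟩ := exists_rat_btwn hlt
        exact hx' (mem_iUnion.2 ⟨⟨q, hI y hy ⟨h.le.trans hq1.le, hq2.le⟩⟩, h, hq1.le⟩)
    have hsing : {x | x ∈ I ∧ ∀ y ∈ I, y ≤ x}.Subsingleton := fun x hx y hy =>
      le_antisymm (hy.2 x hx.1) (hx.2 y hy.1)
    have hnull : volume (I \ ⋃ q, D q) = 0 :=
      measure_mono_null hsub (measure_union_null (by simp) (hsing.measure_zero volume))
    exact ae_le_set.2 hnull
  refine (lintegral_mono' (Measure.restrict_mono_ae hcov) le_rfl).trans ?_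
  rw [setLIntegral_iUnion_of_directed]
  · exact iSup_le fun q => hB q q.2
  · intro q r
    rcases le_total (q : ℚ) r with h | h
    · exact ⟨r, Ioc_subset_Ioc_right (by exact_mod_cast h), subset_rfl⟩
    · exact ⟨q, subset_rfl, Ioc_subset_Ioc_right (by exact_mod_cast h)⟩

lemma ofReal_integral_norm_sq {F : Type*} [NormedAddCommGroup F] {f : ℝ → F} {s r : ℝ}
    (hsr : s ≤ r) (hf : IntervalIntegrable (fun x => ‖f x‖ ^ 2) volume s r) :
    ENNReal.ofReal (∫ x in s..r, ‖f x‖ ^ 2) = ∫⁻ x in Ioc s r, ‖f x‖ₑ ^ 2 := by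
  rw [intervalIntegral.integral_of_le hsr, ofReal_integral_eq_lintegral_ofReal
    ((intervalIntegrable_iff_integrableOn_Ioc_of_le hsr).1 hf)
    (ae_of_all _ fun x => sq_nonneg _)]
  refine lintegral_congr fun x => ?_
  rw [ENNReal.ofReal_pow (norm_nonneg _), ofReal_norm]

lemma IsHybridInput.intervalIntegrable_norm_sq {m : Type*} [Fintype m]
    {u : ℝ → ℕ → EuclideanSpace ℝ m} (hu : IsHybridInput E u) {F : Type*}
    [NormedAddCommGroup F] [NormedSpace ℝ F] [MeasurableSpace F] [BorelSpace F]
    [SecondCountableTopology F] (g : EuclideanSpace ℝ m →L[ℝ] F)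
    {j : ℕ} {s r : ℝ} (hsr : s ≤ r) (hI : Icc s r ⊆ slice E j) :
    IntervalIntegrable (fun x => ‖g (u x j)‖ ^ 2) volume s r := by
  rw [intervalIntegrable_iff_integrableOn_Ioc_of_le hsr]
  obtain ⟨hm, hb⟩ := hu j
  obtain ⟨M, hM⟩ := hb r
  have hm' : AEMeasurable (fun x => ‖g (u x j)‖ ^ 2) (volume.restrict (Ioc s r)) :=
    ((g.continuous.measurable.comp_aemeasurable
      (hm.mono_measure (Measure.restrict_mono_set volume
        (Ioc_subset_Icc_self.trans hI)))).norm).pow_const 2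
  refine Integrable.of_bound hm'.aestronglyMeasurable ((‖g‖ * M) ^ 2) ?_
  rw [ae_restrict_iff' measurableSet_Ioc]
  filter_upwards [hM] with x hx hmem
  rw [Real.norm_of_nonneg (sq_nonneg _)]
  have := hx (hI (Ioc_subset_Icc_self hmem)) hmem.2
  gcongr
  exact (g.le_opNorm _).trans (by gcongr)

/-- The dissipation inequality integrated along a flow. -/
lemma IsDissipative.gain_flow (h : IsDissipative P T₁ T₂ lamt γ L P₁ P₂ δ a b k)
    (hsol : (P.errorSystem T₁ T₂ L 0).IsSolutionPair E φ u) {j : ℕ} {s r : ℝ}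
    (hsr : s ≤ r) (hI : Icc s r ⊆ slice E j) :
    (∫⁻ x in Ioc s r, ‖mv P.Cp (upper (stE (φ x j)))‖ₑ ^ 2) +
        ENNReal.ofReal (lyap P₁ P₂ δ (stE (φ r j)) (stτ (φ r j))) ≤
      ENNReal.ofReal (lyap P₁ P₂ δ (stE (φ s j)) (stτ (φ s j))) +
        ENNReal.ofReal (γ ^ 2) * ∫⁻ x in Ioc s r, ‖upper (u x j)‖ₑ ^ 2 := by
  have hcφ : ContinuousOn (fun x => φ x j) (Icc s r) := by
    have := (hsol.ac hsr hI).continuousOn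
    rwa [uIcc_of_le hsr] at this
  have hy : IntervalIntegrable (fun x => ‖mv P.Cp (upper (stE (φ x j)))‖ ^ 2) volume s r := by
    refine ContinuousOn.intervalIntegrable ?_
    rw [uIcc_of_le hsr]
    exact ((((mvL P.Cp).comp (upperL.comp stEL)).continuous.comp_continuousOn hcφ).norm).pow 2
  have hw : IntervalIntegrable (fun x => ‖upper (u x j)‖ ^ 2) volume s r :=
    hsol.input.intervalIntegrable_norm_sq upperL hsr hI
  have key := sub_le_integral_of_ae_hasDerivAt
    (g := fun x => γ ^ 2 * ‖upper (u x j)‖ ^ 2 - ‖mv P.Cp (upper (stE (φ x j)))‖ ^ 2) hsr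
    (lyap_ac P₁ P₂ δ hsol hsr hI) (by
      filter_upwards [ae_hasDerivAt_lyap h.P₁_pos h.P₂_pos δ hsol hI] with t ht hmem
      refine ⟨ht hmem, ?_⟩
      have hτ := timer_mem h.T₁_pos h.T₁_le hsol (hI (Ioo_subset_Icc_self hmem))
      have hd := h.dissip (stZ (φ t j)) (stE (φ t j)) (upper (u t j)) _ hτ
      have hV : 0 ≤ lyap P₁ P₂ δ (stE (φ t j)) (stτ (φ t j)) :=
        (mul_nonneg h.a_pos.le (sq_nonneg _)).trans (h.le_lyap _ _ hτ)
      have := mul_nonneg (mul_nonneg zero_le_two h.lamt_pos.le) hV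
      linarith)
    ((hw.const_mul _).sub hy)
  rw [intervalIntegral.integral_sub (hw.const_mul _) hy, intervalIntegral.integral_const_mul] at key
  have hy0 : 0 ≤ ∫ x in s..r, ‖mv P.Cp (upper (stE (φ x j)))‖ ^ 2 :=
    intervalIntegral.integral_nonneg hsr fun x _ => sq_nonneg _
  have hw0 : 0 ≤ ∫ x in s..r, ‖upper (u x j)‖ ^ 2 :=
    intervalIntegral.integral_nonneg hsr fun x _ => sq_nonneg _
  have hVnn : ∀ x ∈ Icc s r, 0 ≤ lyap P₁ P₂ δ (stE (φ x j)) (stτ (φ x j)) := fun x hx =>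
    (mul_nonneg h.a_pos.le (sq_nonneg _)).trans
      (h.le_lyap _ _ (timer_mem h.T₁_pos h.T₁_le hsol (hI hx)))
  -- With the final value of V on the left, every term is nonnegative and the real inequality passes
  -- to extended nonnegative reals without subtraction.
  rw [← ofReal_integral_norm_sq hsr hy, ← ofReal_integral_norm_sq hsr hw,
    ← ENNReal.ofReal_mul (sq_nonneg γ), ← ENNReal.ofReal_add hy0 (hVnn r ⟨hsr, le_rfl⟩),
    ← ENNReal.ofReal_add (hVnn s ⟨le_rfl, hsr⟩) (by positivity)]
  exact ENNReal.ofReal_le_ofReal (by linarith)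

/-- The dissipation inequality integrated along a solution with `η ≡ 0`. -/
lemma IsDissipative.gain_Ioc (h : IsDissipative P T₁ T₂ lamt γ L P₁ P₂ δ a b k)
    (hsol : (P.errorSystem T₁ T₂ L 0).IsSolutionPair E φ u)
    (hη : ∀ p ∈ E, lower (u p.1 p.2) = 0) {s : ℝ} {j : ℕ} (hs : (s, j) ∈ E) :
    (∫⁻ x in Ioc 0 s, ‖mv P.Cp (upper (stE (φ x (firstIndex E x))))‖ₑ ^ 2) +
        ENNReal.ofReal (lyap P₁ P₂ δ (stE (φ s j)) (stτ (φ s j))) ≤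
      ENNReal.ofReal (lyap P₁ P₂ δ (stE (φ 0 0)) (stτ (φ 0 0))) +
        ENNReal.ofReal (γ ^ 2) * ∫⁻ x in Ioc 0 s, ‖upper (u x (firstIndex E x))‖ₑ ^ 2 := by
  refine hsol.domain.induction (Q := fun s j =>
    (∫⁻ x in Ioc 0 s, ‖mv P.Cp (upper (stE (φ x (firstIndex E x))))‖ₑ ^ 2) +
        ENNReal.ofReal (lyap P₁ P₂ δ (stE (φ s j)) (stτ (φ s j))) ≤
      ENNReal.ofReal (lyap P₁ P₂ δ (stE (φ 0 0)) (stτ (φ 0 0))) +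
        ENNReal.ofReal (γ ^ 2) * ∫⁻ x in Ioc 0 s, ‖upper (u x (firstIndex E x))‖ₑ ^ 2)
    (by simp) ?_ ?_ hs
  · intro j s r hsr hI ih
    have hs0 : 0 ≤ s := hsol.domain.nonneg (hI ⟨le_rfl, hsr⟩ : (s, j) ∈ E)
    have hidx : ∀ x ∈ Ioc s r, firstIndex E x = j := fun x hx =>
      hsol.domain.firstIndex_eq (hI ⟨le_rfl, hsr⟩ : (s, j) ∈ E)
        (hI (Ioc_subset_Icc_self hx) : (x, j) ∈ E) hx.1
    have hsplit : ∀ f : ℝ → ℝ≥0∞, ∫⁻ x in Ioc 0 r, f x =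
        (∫⁻ x in Ioc 0 s, f x) + ∫⁻ x in Ioc s r, f x := fun f => by
      rw [← Ioc_union_Ioc_eq_Ioc hs0 hsr, lintegral_union measurableSet_Ioc]
      exact Ioc_disjoint_Ioc_of_le le_rfl
    have e1 : ∫⁻ x in Ioc s r, ‖mv P.Cp (upper (stE (φ x (firstIndex E x))))‖ₑ ^ 2 =
        ∫⁻ x in Ioc s r, ‖mv P.Cp (upper (stE (φ x j)))‖ₑ ^ 2 :=
      setLIntegral_congr_fun measurableSet_Ioc fun x hx => by simp only [hidx x hx]
    have e2 : ∫⁻ x in Ioc s r, ‖upper (u x (firstIndex E x))‖ₑ ^ 2 =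
        ∫⁻ x in Ioc s r, ‖upper (u x j)‖ₑ ^ 2 :=
      setLIntegral_congr_fun measurableSet_Ioc fun x hx => by simp only [hidx x hx]
    rw [hsplit, hsplit, e1, e2, mul_add, add_assoc]
    calc _ ≤ _ := add_le_add_right (h.gain_flow hsol hsr hI) _
      _ = _ := (add_assoc _ _ _).symm
      _ ≤ _ := add_le_add_left ih _
      _ = _ := add_assoc _ _ _
  -- A jump takes no ordinary time, so the integrals are unchanged; with η = 0 the value of V does
  -- not increase.
  · intro t j h1 h2 ih
    refine le_trans (add_le_add_right (ENNReal.ofReal_le_ofReal ?_) _) ih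
    obtain ⟨hτ, hτ', hup, hlow⟩ := jump_state hsol h1 h2
    have hj := h.lyap_jump (stE (φ t j)) (stE (φ t (j + 1))) _
      ⟨h.T₁_pos.le.trans hτ'.1, hτ'.2⟩ hup
    have h0 := hη (t, j) h1
    dsimp only at h0
    rw [hlow, h0] at hj
    simpa [hτ] using hj

/-- The `ℒ₂`-gain estimate. -/
lemma IsDissipative.gain (h : IsDissipative P T₁ T₂ lamt γ L P₁ P₂ δ a b k)
    (hsol : (P.errorSystem T₁ T₂ L 0).IsSolutionPair E φ u)
    (hη : ∀ p ∈ E, lower (u p.1 p.2) = 0) :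
    (∫⁻ s in timeProj E, ‖mv P.Cp (upper (stE (φ s (firstIndex E s))))‖ₑ ^ 2) ^ (1 / 2 : ℝ) ≤
      ENNReal.ofReal (√b * Metric.infDist (φ 0 0) (attractor nz ny T₂)) +
        ENNReal.ofReal γ *
          (∫⁻ s in timeProj E, ‖upper (u s (firstIndex E s))‖ₑ ^ 2) ^ (1 / 2 : ℝ) := by
  have hτ0 := timer_mem h.T₁_pos h.T₁_le hsol hsol.domain.zero_mem
  rw [infDist_attractor hτ0]
  have hsqrt : ∀ x : ℝ, 0 ≤ x → ENNReal.ofReal (x ^ 2) ^ (1 / 2 : ℝ) = ENNReal.ofReal x := by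
    intro x hx
    rw [ENNReal.ofReal_rpow_of_nonneg (sq_nonneg _) (by norm_num), ← Real.sqrt_eq_rpow,
      Real.sqrt_sq hx]
  have key : ∫⁻ s in timeProj E, ‖mv P.Cp (upper (stE (φ s (firstIndex E s))))‖ₑ ^ 2 ≤
      ENNReal.ofReal ((√b * ‖stE (φ 0 0)‖) ^ 2) + ENNReal.ofReal (γ ^ 2) *
        ∫⁻ s in timeProj E, ‖upper (u s (firstIndex E s))‖ₑ ^ 2 := by
    refine setLIntegral_le_of_forall_Ioc (fun s hs => hs.elim fun j hj => hsol.domain.nonneg hj)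
      (fun s hs => hsol.domain.Icc_subset_timeProj hs) fun s hs => ?_
    obtain ⟨j, hj⟩ := hs
    refine (le_add_right le_rfl).trans ((h.gain_Ioc hsol hη hj).trans (add_le_add ?_ ?_))
    · refine ENNReal.ofReal_le_ofReal ?_
      rw [mul_pow, Real.sq_sqrt h.b_pos.le]
      exact h.lyap_le _ _ hτ0
    · gcongr
      exact Ioc_subset_Icc_self.trans (hsol.domain.Icc_subset_timeProj ⟨j, hj⟩)
  -- The square root is subadditive, so the initial value, at most (√b |e(0)|)², and the input
  -- energy separate.
  calc _ ≤ _ := ENNReal.rpow_le_rpow key (by norm_num)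
    _ ≤ _ := ENNReal.rpow_add_le_add_rpow _ _ (by norm_num) (by norm_num)
    _ = _ := by
      rw [ENNReal.mul_rpow_of_nonneg _ _ (by norm_num), hsqrt _ (by positivity),
        hsqrt _ h.γ_pos.le]

end Gain

/-! ### Lipschitz continuity of the flow map -/

section Lipschitz

/-- Lipschitz functions, with an unspecified constant. -/
def IsLip {X Y : Type*} [PseudoEMetricSpace X] [PseudoEMetricSpace Y] (f : X → Y) : Prop :=
  ∃ K, LipschitzWith K f

lemma IsLip.comp {X Y Z : Type*} [PseudoEMetricSpace X] [PseudoEMetricSpace Y]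
    [PseudoEMetricSpace Z] {g : Y → Z} {f : X → Y} (hg : IsLip g) (hf : IsLip f) :
    IsLip fun x => g (f x) :=
  let ⟨_, h₁⟩ := hg
  let ⟨_, h₂⟩ := hf
  ⟨_, h₁.comp h₂⟩

lemma IsLip.add {X F : Type*} [PseudoEMetricSpace X] [SeminormedAddCommGroup F] {f g : X → F}
    (hf : IsLip f) (hg : IsLip g) : IsLip fun x => f x + g x :=
  let ⟨_, h₁⟩ := hf
  let ⟨_, h₂⟩ := hg
  ⟨_, h₁.add h₂⟩

lemma IsLip.sub {X F : Type*} [PseudoEMetricSpace X] [SeminormedAddCommGroup F] {f g : X → F}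
    (hf : IsLip f) (hg : IsLip g) : IsLip fun x => f x - g x :=
  let ⟨_, h₁⟩ := hf
  let ⟨_, h₂⟩ := hg
  ⟨_, h₁.sub h₂⟩

lemma IsLip.left {X U Y : Type*} [PseudoEMetricSpace X] [PseudoEMetricSpace U]
    [PseudoEMetricSpace Y] {f : X → U → Y} (hf : IsLip fun p : X × U => f p.1 p.2) (v : U) :
    IsLip fun x => f x v :=
  let ⟨K, hK⟩ := hf
  ⟨K, fun x y => by simpa [Prod.edist_eq] using hK (x, v) (y, v)⟩

lemma isLip_const {X Y : Type*} [PseudoEMetricSpace X] [PseudoEMetricSpace Y] (c : Y) :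
    IsLip fun _ : X => c := ⟨0, LipschitzWith.const c⟩

lemma isLip_clm {F G : Type*} [NormedAddCommGroup F] [NormedSpace ℝ F] [NormedAddCommGroup G]
    [NormedSpace ℝ G] (g : F →L[ℝ] G) : IsLip fun x => g x := ⟨_, g.lipschitz⟩

lemma IsLip.stack {X : Type*} [PseudoEMetricSpace X] {ι κ : Type*} [Fintype ι] [Fintype κ]
    {g₁ : X → EuclideanSpace ℝ ι} {g₂ : X → EuclideanSpace ℝ κ} (h₁ : IsLip g₁)
    (h₂ : IsLip g₂) : IsLip fun p => stack (g₁ p) (g₂ p) := by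
  obtain ⟨K₁, k₁⟩ := h₁
  obtain ⟨K₂, k₂⟩ := h₂
  have h : LipschitzWith (‖stackL (ι := ι) (κ := κ)‖₊ * max K₁ K₂)
      (stackL (ι := ι) (κ := κ) ∘ fun x => (g₁ x, g₂ x)) :=
    (stackL (ι := ι) (κ := κ)).lipschitz.comp (k₁.prodMk k₂)
  exact ⟨_, h⟩

variable {nz ny nw nq ns np : ℕ}

/-- The flow map of the error system is Lipschitz in the state and the input. -/
lemma isLip_errorSystem_f (P : Plant nz ny nw nq ns np) (T₁ T₂ : ℝ)
    (L : Matrix (Fin nz) (Fin ny) ℝ) (H : Matrix (Fin ny) (Fin ny) ℝ) {ℓ : ℝ}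
    (hψ : ∀ v₁ v₂ : Vec nq, ‖P.ψ v₁ - P.ψ v₂‖ ≤ ℓ * ‖v₁ - v₂‖) :
    IsLip fun p : EuclideanSpace ℝ (StateIx nz ny) × EuclideanSpace ℝ (Fin nw ⊕ Fin ny) =>
      (P.errorSystem T₁ T₂ L H).f p.1 p.2 := by
  have hψ' : IsLip P.ψ := ⟨ℓ.toNNReal, LipschitzWith.of_dist_le_mul fun x y => by
    rw [dist_eq_norm, dist_eq_norm]
    exact (hψ x y).trans (mul_le_mul_of_nonneg_right (Real.le_coe_toNNReal ℓ) (norm_nonneg _))⟩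
  set S := EuclideanSpace ℝ (StateIx nz ny)
  set U := EuclideanSpace ℝ (Fin nw ⊕ Fin ny)
  have hz : IsLip fun p : S × U => stZ p.1 :=
    isLip_clm (upperL.comp (ContinuousLinearMap.fst ℝ S U))
  have he : IsLip fun p : S × U => stE p.1 :=
    isLip_clm (stEL.comp (ContinuousLinearMap.fst ℝ S U))
  have hw : IsLip fun p : S × U => upper p.2 :=
    isLip_clm (upperL.comp (ContinuousLinearMap.snd ℝ S U))
  have hup : IsLip fun p : S × U => upper (stE p.1) := (isLip_clm upperL).comp he
  have hmv : ∀ {ι κ : Type} [Fintype ι] [Fintype κ] (M : Matrix ι κ ℝ)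
      {g : S × U → EuclideanSpace ℝ κ}, IsLip g → IsLip fun p => mv M (g p) :=
    fun M _ hg => (isLip_clm (mvL M)).comp hg
  have hζ : IsLip fun p : S × U => P.zeta (stZ p.1) (upper (stE p.1)) :=
    (hψ'.comp (hmv P.S hz)).sub (hψ'.comp (hmv P.S (hz.sub hup)))
  have h1 := ((hmv P.A hz).add (hmv P.B (hψ'.comp (hmv P.S hz)))).add (hmv P.N hw)
  have h2 := ((hmv (P.matF L H) he).add (hmv P.matQ hζ)).add (hmv P.matT hw)
  have h3 := h1.stack (h2.stack (isLip_const (WithLp.toLp 2 fun _ : Unit => (-1 : ℝ))))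
  simpa only [Plant.errorSystem, mkState] using h3

end Lipschitz

/-! ### Extending solutions by flowing or jumping -/

section Extension

variable {n m : Type*} [Fintype n] [Fintype m] {𝓗 : HybridSystem n m}
  {φ : ℝ → ℕ → EuclideanSpace ℝ n} {u : ℝ → ℕ → EuclideanSpace ℝ m}

/-- The hybrid time domain with jump times `t 1, …, t J` and last interval `I`. -/
def lastDomain (t : ℕ → ℝ) (J : ℕ) (I : Set ℝ) : Set (ℝ × ℕ) :=
  {p | (p.2 < J ∧ p.1 ∈ Icc (t p.2) (t (p.2 + 1))) ∨ (p.2 = J ∧ p.1 ∈ I)}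

lemma slice_lastDomain_of_ne {t : ℕ → ℝ} {J j : ℕ} {I I' : Set ℝ} (hj : j ≠ J) :
    slice (lastDomain t J I') j = slice (lastDomain t J I) j := by
  ext s
  simp [slice, lastDomain, hj]

lemma slice_lastDomain_last {t : ℕ → ℝ} {J : ℕ} {I : Set ℝ} :
    slice (lastDomain t J I) J = I := by
  ext s
  simp [slice, lastDomain]

lemma isHybridTimeDomain_lastDomain {t : ℕ → ℝ} (h0 : t 0 = 0) (hm : Monotone t) {J : ℕ} {r : ℝ}
    (hr : t J ≤ r) : IsHybridTimeDomain (lastDomain t J (Icc (t J) r)) := by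
  refine ⟨fun i => if i ≤ J then t i else r, by simpa using h0, fun i j hij => ?_,
    Or.inr ⟨J, Icc (t J) r, Or.inl (by simp), ?_⟩⟩
  · dsimp only
    split_ifs with h1 h2
    · exact hm hij
    · exact (hm h1).trans hr
    · omega
    · exact le_rfl
  · ext p
    simp only [lastDomain, mem_ofPred_eq]
    refine or_congr (and_congr_right fun h => ?_) Iff.rfl
    rw [if_pos h.le, if_pos (Nat.succ_le_of_lt h)]

/-- A solution whose last interval can be prolonged is not maximal. -/
lemma not_isMaximal_of_extend_last {t : ℕ → ℝ} (h0 : t 0 = 0) (hm : Monotone t) {J : ℕ}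
    {I : Set ℝ} {r : ℝ} (hsol : 𝓗.IsSolutionPair (lastDomain t J I) φ u) (htI : t J ∈ I)
    (hI : I ⊂ Icc (t J) r) {x : ℝ → EuclideanSpace ℝ n} {v : ℝ → EuclideanSpace ℝ m}
    (hx : ∀ s ∈ I, x s = φ s J) (hv : ∀ s ∈ I, v s = u s J)
    (hac : AbsolutelyContinuousOnInterval x (t J) r) (hmem : ∀ s ∈ Ioo (t J) r, x s ∈ 𝓗.C)
    (hflow : ∀ᵐ s, s ∈ Ioo (t J) r → HasDerivAt x (𝓗.f (x s) (v s)) s)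
    (hmeas : AEMeasurable v (volume.restrict (Icc (t J) r)))
    (hbdd : ∃ M : ℝ, ∀ᵐ s, s ∈ Icc (t J) r → ‖v s‖ ≤ M) :
    ¬ 𝓗.IsMaximal (lastDomain t J I) φ u := by
  rintro ⟨-, hmax⟩
  have hr : t J ≤ r := (hI.1 htI).2
  set E := lastDomain t J I with hE
  set E' := lastDomain t J (Icc (t J) r) with hE'
  have hEE' : E ⊆ E' := fun p hp => hp.imp id fun h => ⟨h.1, hI.1 h.2⟩
  have hslice : ∀ j ≠ J, slice E' j = slice E j := fun j hj => slice_lastDomain_of_ne hj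
  have hsliceJ : slice E' J = Icc (t J) r := slice_lastDomain_last
  set φ' : ℝ → ℕ → EuclideanSpace ℝ n := fun s j => if j = J then x s else φ s j with hφ'
  set u' : ℝ → ℕ → EuclideanSpace ℝ m := fun s j => if j = J then v s else u s j with hu'
  have hφJ : ∀ s, φ' s J = x s := fun s => if_pos rfl
  have huJ : ∀ s, u' s J = v s := fun s => if_pos rfl
  have hφj : ∀ s, ∀ j ≠ J, φ' s j = φ s j := fun s j hj => if_neg hj
  have huj : ∀ s, ∀ j ≠ J, u' s j = u s j := fun s j hj => if_neg hj
  have hagree : ∀ s j, (s, j) ∈ E → φ' s j = φ s j ∧ u' s j = u s j := by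
    intro s j hs
    rcases eq_or_ne j J with rfl | hj
    · have : s ∈ I := by
        have h : s ∈ slice E j := hs
        rwa [hE, slice_lastDomain_last] at h
      rw [hφJ, huJ]
      exact ⟨hx s this, hv s this⟩
    · exact ⟨hφj s j hj, huj s j hj⟩
  refine hmax ⟨E', φ', u', ?_, ⟨hEE', fun hcon => hI.2 ?_⟩, fun p hp => hagree p.1 p.2 hp⟩
  · refine ⟨isHybridTimeDomain_lastDomain h0 hm hr, fun j => ?_, fun j => ?_, ?_, fun j => ?_,
      fun j => ?_, fun s j h1 h2 => ?_⟩
    · rcases eq_or_ne j J with rfl | hj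
      · rw [hsliceJ]
        simp only [huJ]
        exact ⟨hmeas, fun T => hbdd.imp fun M hM => hM.mono fun s hs h _ => hs h⟩
      · rw [hslice j hj]
        simp only [huj _ j hj]
        exact hsol.input j
    · rcases eq_or_ne j J with rfl | hj
      · rw [hsliceJ]
        simp only [hφJ]
        intro a b hab hsub
        refine hac.mono ?_
        rwa [uIcc_of_le hab, uIcc_of_le hr]
      · rw [hslice j hj]
        simp only [hφj _ j hj]
        exact hsol.arc j
    · rw [(hagree 0 0 hsol.domain.zero_mem).1]
      exact hsol.initial
    · rcases eq_or_ne j J with rfl | hj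
      · rw [hsliceJ, interior_Icc]
        simp only [hφJ]
        exact hmem
      · rw [hslice j hj]
        simp only [hφj _ j hj]
        exact hsol.flow_mem j
    · rcases eq_or_ne j J with rfl | hj
      · rw [hsliceJ, interior_Icc]
        simp only [hφJ, huJ]
        exact hflow
      · rw [hslice j hj]
        simp only [hφj _ j hj, huj _ j hj]
        exact hsol.flow j
    · have hjJ : j < J := by
        rcases h2 with h2 | h2
        · have := h2.1; dsimp only at this; omega
        · have := h2.1; dsimp only at this; omega
      have k1 : (s, j) ∈ E := by
        rcases h1 with h1 | h1
        · exact Or.inl h1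
        · exact absurd h1.1 hjJ.ne
      have k2 : (s, j + 1) ∈ E := by
        rcases h2 with h2 | ⟨h2, h2'⟩
        · exact Or.inl h2
        -- A jump into index J happens exactly at t J, which already belongs to I, so the extension
        -- creates no new jump.
        · refine Or.inr ⟨h2, ?_⟩
          dsimp only at h2 h2'
          have h3 : s ≤ t (j + 1) := by
            rcases k1 with k | k
            · exact k.2.2
            · exact absurd k.1 hjJ.ne
          rw [h2] at h3
          rwa [le_antisymm h3 h2'.1]
      rw [(hagree s j k1).1, (hagree s j k1).2, (hagree s _ k2).1]
      exact hsol.jump s j k1 k2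
  · intro s hs
    have : (s, J) ∈ E := hcon (Or.inr ⟨rfl, hs⟩)
    have h : s ∈ slice E J := this
    rwa [hE, slice_lastDomain_last] at h

/-- A solution that can jump at its final time is not maximal. -/
lemma not_isMaximal_of_jump {t : ℕ → ℝ} (h0 : t 0 = 0) (hm : Monotone t) {J : ℕ} {r : ℝ}
    (hr : t J ≤ r) (hsol : 𝓗.IsSolutionPair (lastDomain t J (Icc (t J) r)) φ u)
    (hD : φ r J ∈ 𝓗.D) {g : EuclideanSpace ℝ n} (hg : g ∈ 𝓗.G (φ r J) (u r J)) :
    ¬ 𝓗.IsMaximal (lastDomain t J (Icc (t J) r)) φ u := by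
  rintro ⟨-, hmax⟩
  set E := lastDomain t J (Icc (t J) r) with hE
  -- All times after index J are frozen at r, so the new last interval is the single point r. Its
  -- interior is empty and it is a null set, so flow and input conditions there are vacuous.
  set t' : ℕ → ℝ := fun i => if i ≤ J then t i else r with ht'
  have ht0 : t' 0 = 0 := by simpa [ht'] using h0
  have htm : Monotone t' := fun i j hij => by
    simp only [ht']
    split_ifs with h1 h2
    · exact hm hij
    · exact (hm h1).trans hr
    · omega
    · exact le_rfl
  have htJ : t' (J + 1) = r := by simp [ht']
  set E' := lastDomain t' (J + 1) (Icc (t' (J + 1)) r) with hE'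
  have hmemE' : ∀ s j, (s, j) ∈ E' ↔ (s, j) ∈ E ∨ (s = r ∧ j = J + 1) := by
    intro s j
    simp only [hE', hE, lastDomain, mem_ofPred_eq, htJ, Icc_self, mem_singleton_iff]
    rw [and_comm (a := s = r)]
    refine or_congr_left ?_
    rcases lt_trichotomy j J with h | rfl | h
    · have h1 : t' j = t j := if_pos h.le
      have h2 : t' (j + 1) = t (j + 1) := if_pos h
      simp [h1, h2, h, h.ne, h.trans (Nat.lt_succ_self J)]
    · have h1 : t' j = t j := if_pos le_rfl
      simp [h1, htJ]
    · have : ¬ j < J + 1 := by omega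
      simp [this, h.ne', h.not_gt]
  have hslice : ∀ j ≠ J + 1, slice E' j = slice E j := fun j hj => by
    ext s
    simp only [slice, mem_ofPred_eq, hmemE', hj, and_false, or_false]
  have hsliceJ : slice E' (J + 1) = {r} := by
    rw [hE', slice_lastDomain_last, htJ, Icc_self]
  set φ' : ℝ → ℕ → EuclideanSpace ℝ n := fun s j => if j = J + 1 then g else φ s j with hφ'
  have hφJ : ∀ s, φ' s (J + 1) = g := fun s => if_pos rfl
  have hφj : ∀ s, ∀ j ≠ J + 1, φ' s j = φ s j := fun s j hj => if_neg hj
  have hne : ∀ s j, (s, j) ∈ E → j ≠ J + 1 := by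
    rintro s j (h | h) rfl
    · have := h.1; dsimp only at this; omega
    · have := h.1; dsimp only at this; omega
  have hrE : (r, J) ∈ E := Or.inr ⟨rfl, hr, le_rfl⟩
  refine hmax ⟨E', φ', u, ?_, ⟨fun p hp => (hmemE' p.1 p.2).2 (Or.inl hp), fun hcon => ?_⟩,
    fun p hp => ⟨hφj _ _ (hne _ _ hp), rfl⟩⟩
  · have hnull : ∀ᵐ s : ℝ, s ≠ r := by simp [ae_iff]
    refine ⟨isHybridTimeDomain_lastDomain ht0 htm htJ.le, fun j => ?_, fun j => ?_, ?_,
      fun j => ?_, fun j => ?_, fun s j h1 h2 => ?_⟩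
    · rcases eq_or_ne j (J + 1) with rfl | hj
      · rw [hsliceJ]
        refine ⟨by rw [Measure.restrict_singleton]; simp, fun T => ⟨0, ?_⟩⟩
        filter_upwards [hnull] with s hs h
        exact absurd h hs
      · rw [hslice j hj]
        exact hsol.input j
    · rcases eq_or_ne j (J + 1) with rfl | hj
      · simp only [hφJ]
        exact fun a b _ _ => (LipschitzWith.const g).lipschitzOnWith.absolutelyContinuousOnInterval
      · rw [hslice j hj]
        simp only [hφj _ j hj]
        exact hsol.arc j
    · rw [hφj 0 0 (by omega)]
      exact hsol.initial
    · rcases eq_or_ne j (J + 1) with rfl | hj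
      · rw [hsliceJ, interior_singleton]
        simp
      · rw [hslice j hj]
        simp only [hφj _ j hj]
        exact hsol.flow_mem j
    · rcases eq_or_ne j (J + 1) with rfl | hj
      · rw [hsliceJ, interior_singleton]
        simp
      · rw [hslice j hj]
        simp only [hφj _ j hj]
        exact hsol.flow j
    · rw [hmemE'] at h1 h2
      have k1 : (s, j) ∈ E := by
        rcases h1 with h1 | ⟨-, rfl⟩
        · exact h1
        · rcases h2 with (h2 | h2) | h2
          · have := h2.1; dsimp only at this; omega
          · have := h2.1; dsimp only at this; omega
          · omega
      rw [hφj s j (hne _ _ k1)]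
      rcases h2 with h2 | ⟨rfl, h2⟩
      · rw [hφj s _ (hne _ _ h2)]
        exact hsol.jump s j k1 h2
      · obtain rfl : j = J := by omega
        rw [hφJ]
        exact ⟨hD, hg⟩
  · exact hne r (J + 1) (hcon ((hmemE' _ _).2 (Or.inr ⟨rfl, rfl⟩))) rfl

/-- Solutions of an autonomous Lipschitz differential equation exist locally. -/
lemma exists_local_solution {F : EuclideanSpace ℝ n → EuclideanSpace ℝ n} (hF : IsLip F)
    (x₀ : EuclideanSpace ℝ n) (r : ℝ) {h₀ : ℝ} (hh₀ : 0 < h₀) :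
    ∃ h : ℝ, 0 < h ∧ h ≤ h₀ ∧ ∃ α : ℝ → EuclideanSpace ℝ n, α r = x₀ ∧
      AbsolutelyContinuousOnInterval α r (r + h) ∧
      ∀ s ∈ Ioo r (r + h), HasDerivAt α (F (α s)) s := by
  obtain ⟨K, hK⟩ := hF
  set A : NNReal := ‖F x₀‖₊ + K with hA
  -- A bounds the speed on the unit ball around x₀, and A h ≤ 1 keeps the Picard–Lindelöf solution
  -- inside it.
  set h : ℝ := min h₀ (1 / (A + 1)) with hh
  have hpos : 0 < h := lt_min hh₀ (by positivity)
  have hb : ∀ x ∈ Metric.closedBall x₀ ((1 : NNReal) : ℝ), ‖F x‖ ≤ A := by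
    intro x hx
    have h1 := hK.dist_le_mul x x₀
    rw [dist_eq_norm] at h1
    have h2 : dist x x₀ ≤ 1 := hx
    calc ‖F x‖ ≤ ‖F x - F x₀‖ + ‖F x₀‖ := norm_le_norm_sub_add _ _
      _ ≤ K * 1 + ‖F x₀‖ := by gcongr; exact h1.trans (by gcongr)
      _ = A := by rw [hA]; push_cast; ring
  have hPL : IsPicardLindelof (fun _ => F) (tmin := r) (tmax := r + h)
      ⟨r, le_rfl, by linarith⟩ x₀ 1 0 A K := by
    refine IsPicardLindelof.of_time_independent hb hK.lipschitzOnWith ?_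
    simp only [add_sub_cancel_left, sub_self, NNReal.coe_one, NNReal.coe_zero, sub_zero]
    rw [max_eq_left hpos.le]
    calc (A : ℝ) * h ≤ A * (1 / (A + 1)) := by gcongr; exact min_le_right _ _
      _ ≤ 1 := by rw [mul_one_div, div_le_one (by positivity)]; linarith
  obtain ⟨α, hα0, hα⟩ := hPL.exists_eq_forall_mem_Icc_hasDerivWithinAt₀
  refine ⟨h, hpos, min_le_left _ _, α, hα0, ?_, fun s hs =>
    (hα s (Ioo_subset_Icc_self hs)).hasDerivAt (Icc_mem_nhds hs.1 hs.2)⟩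
  -- The velocity is bounded on the compact interval, so the curve is Lipschitz, hence absolutely
  -- continuous.
  have hc : ContinuousOn (fun s => F (α s)) (Icc r (r + h)) :=
    hK.continuous.comp_continuousOn fun s hs => (hα s hs).continuousWithinAt
  obtain ⟨M, hM⟩ := isCompact_Icc.exists_bound_of_continuousOn hc
  refine LipschitzOnWith.absolutelyContinuousOnInterval (K := M.toNNReal) ?_
  rw [uIcc_of_le (by linarith)]
  refine Convex.lipschitzOnWith_of_nnnorm_hasDerivWithin_le (convex_Icc _ _) hα fun s hs => ?_
  rw [← NNReal.coe_le_coe, coe_nnnorm]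
  exact (hM s hs).trans (Real.le_coe_toNNReal M)

end Extension

/-! ### Completeness of maximal solutions -/

section Completeness

variable {nz ny nw nq ns np : ℕ} {P : Plant nz ny nw nq ns np} {T₁ T₂ : ℝ}
  {L : Matrix (Fin nz) (Fin ny) ℝ} {H : Matrix (Fin ny) (Fin ny) ℝ}
  {φ : ℝ → ℕ → EuclideanSpace ℝ (StateIx nz ny)}
  {u : ℝ → ℕ → EuclideanSpace ℝ (Fin nw ⊕ Fin ny)}

/-- A solution defined on a compact last interval, with a positive timer at its final time, can be
continued by flowing with zero input. -/
lemma not_isMaximal_of_timer_pos {ℓ : ℝ}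
    (hψ : ∀ v₁ v₂ : Vec nq, ‖P.ψ v₁ - P.ψ v₂‖ ≤ ℓ * ‖v₁ - v₂‖) (hT₁ : 0 < T₁) (hT : T₁ ≤ T₂)
    {t : ℕ → ℝ} (h0 : t 0 = 0) (hm : Monotone t) {J : ℕ} {r : ℝ} (hr : t J ≤ r)
    (hsol : (P.errorSystem T₁ T₂ L H).IsSolutionPair (lastDomain t J (Icc (t J) r)) φ u)
    (hτ : 0 < stτ (φ r J)) :
    ¬ (P.errorSystem T₁ T₂ L H).IsMaximal (lastDomain t J (Icc (t J) r)) φ u := by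
  have hF : IsLip fun x => (P.errorSystem T₁ T₂ L H).f x 0 :=
    (isLip_errorSystem_f P T₁ T₂ L H hψ).left 0
  -- The length of the extension is limited by the present timer value, so the timer stays
  -- nonnegative. With zero input the equation to be solved is autonomous.
  obtain ⟨h, hpos, hle, α, hα0, hαac, hα⟩ := exists_local_solution hF (φ r J) r hτ
  have hslice : slice (lastDomain t J (Icc (t J) r)) J = Icc (t J) r := slice_lastDomain_last
  have hrE : (r, J) ∈ lastDomain t J (Icc (t J) r) := Or.inr ⟨rfl, hr, le_rfl⟩
  set x : ℝ → EuclideanSpace ℝ (StateIx nz ny) := fun s => if s ≤ r then φ s J else α s with hx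
  have hx₁ : ∀ s ≤ r, x s = φ s J := fun s hs => if_pos hs
  have hx₂ : ∀ s, r < s → x s = α s := fun s hs => if_neg (not_le.2 hs)
  have hx₂' : ∀ s, r ≤ s → x s = α s := fun s hs => by
    rcases hs.eq_or_lt with rfl | hs
    · rw [hx₁ _ le_rfl, hα0]
    · exact hx₂ s hs
  set v : ℝ → EuclideanSpace ℝ (Fin nw ⊕ Fin ny) := (Iic r).indicator fun s => u s J with hv
  have hv₁ : ∀ s ≤ r, v s = u s J := fun s hs => indicator_of_mem (by exact hs) _
  have hv₂ : ∀ s, r < s → v s = 0 := fun s hs => indicator_of_notMem (by simpa using hs) _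
  have hnull : ∀ᵐ s : ℝ, s ≠ r := by simp [ae_iff]
  refine not_isMaximal_of_extend_last h0 hm (r := r + h) hsol ⟨le_rfl, hr⟩
    ⟨Icc_subset_Icc_right (by linarith), fun hcon => ?_⟩ (fun s hs => hx₁ s hs.2)
    (fun s hs => hv₁ s hs.2) ?_ ?_ ?_ ?_ ?_
  · have := (hcon (show r + h ∈ Icc (t J) (r + h) from ⟨by linarith, le_rfl⟩)).2
    linarith
  · refine absolutelyContinuousOnInterval_trans hr (by linarith)
      (absolutelyContinuousOnInterval_congr (hsol.ac hr hslice.ge) fun s hs => ?_)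
      (absolutelyContinuousOnInterval_congr hαac fun s hs => ?_)
    · rw [uIcc_of_le hr] at hs
      exact (hx₁ s hs.2).symm
    · rw [uIcc_of_le (by linarith)] at hs
      exact (hx₂' s hs.1).symm
  · intro s hs
    rcases le_or_gt s r with hsr | hsr
    · rw [hx₁ s hsr]
      exact timer_mem hT₁ hT hsol (Or.inr ⟨rfl, hs.1.le, hsr⟩)
    · have hle' : s ≤ r + h := hs.2.le
      have hd : ∀ y ∈ Ioo r s, HasDerivAt (fun y => stτL (α y)) (-1) y := fun y hy => by
        have := stτL.hasFDerivAt.comp_hasDerivAt y (hα y ⟨hy.1, hy.2.trans_le hle'⟩)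
        rwa [stτL_apply, stτ_errorSystem_f] at this
      have key := sub_eq_mul_of_ae_hasDerivAt_const hsr.le
        (absolutelyContinuousOnInterval_comp_contDiff stτL.contDiff (hαac.mono (by
          rw [uIcc_of_le hsr.le, uIcc_of_le (by linarith)]; exact Icc_subset_Icc_right hle')))
        (ae_of_all _ hd)
      simp only [stτL_apply] at key
      rw [hα0] at key
      rw [hx₂ s hsr]
      have h1 := (timer_mem hT₁ hT hsol hrE).2
      exact ⟨by linarith, by linarith⟩
  · filter_upwards [hsol.ae_flow hslice.ge, hnull] with s hs hne hmem
    rcases lt_or_gt_of_ne hne with hsr | hsr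
    · rw [hx₁ s hsr.le, hv₁ s hsr.le]
      refine (hs ⟨hmem.1, hsr⟩).congr_of_eventuallyEq ?_
      filter_upwards [Iio_mem_nhds hsr] with y hy using hx₁ y (le_of_lt hy)
    · rw [hx₂ s hsr, hv₂ s hsr]
      refine (hα s ⟨hsr, hmem.2⟩).congr_of_eventuallyEq ?_
      filter_upwards [Ioi_mem_nhds hsr] with y hy using hx₂ y hy
  · rw [hv, aemeasurable_indicator_iff measurableSet_Iic, Measure.restrict_restrict
      measurableSet_Iic]
    have := (hsol.input J).1
    rw [hslice] at this
    exact this.mono_measure (Measure.restrict_mono_set volume fun s hs => ⟨hs.2.1, hs.1⟩)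
  · obtain ⟨M, hM⟩ := (hsol.input J).2 r
    refine ⟨max M 0, ?_⟩
    filter_upwards [hM] with s hs hmem
    rcases le_or_gt s r with hsr | hsr
    · rw [hv₁ s hsr]
      exact (hs (hslice.ge ⟨hmem.1, hsr⟩) hsr).trans (le_max_left _ _)
    · rw [hv₂ s hsr, norm_zero]
      exact le_max_right _ _

/-- A Lipschitz bound relative to the origin, with the bounded input absorbed in the constant.
Linear growth excludes finite escape times. -/
lemma exists_growth_bound {X U F : Type*} [NormedAddCommGroup X] [NormedAddCommGroup U]
    [NormedAddCommGroup F] {f : X → U → F} (hf : IsLip fun p : X × U => f p.1 p.2) (M : ℝ) :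
    ∃ c : ℝ, 0 ≤ c ∧ ∀ x v, ‖v‖ ≤ M → ‖f x v‖ ≤ c * (1 + ‖x‖) := by
  obtain ⟨K, hK⟩ := hf
  refine ⟨‖f 0 0‖ + K * (1 + |M|), by positivity, fun x v hv => ?_⟩
  have h1 := hK.dist_le_mul (x, v) 0
  rw [dist_eq_norm, dist_zero_right] at h1
  have h2 : ‖(x, v)‖ ≤ ‖x‖ + |M| :=
    (max_le (le_add_of_nonneg_right (norm_nonneg _)) (le_add_of_nonneg_left (norm_nonneg _))
      : ‖(x, v)‖ ≤ ‖x‖ + ‖v‖).trans (by gcongr; exact hv.trans (le_abs_self _))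
  calc ‖f x v‖ ≤ ‖f x v - f 0 0‖ + ‖f 0 0‖ := norm_le_norm_sub_add _ _
    _ ≤ K * (‖x‖ + |M|) + ‖f 0 0‖ := by gcongr; exact h1.trans (by gcongr)
    _ ≤ _ := by
      have h3 : 0 ≤ ‖f 0 0‖ * ‖x‖ := by positivity
      have h4 : 0 ≤ (K : ℝ) * |M| * ‖x‖ := by positivity
      have h5 : (0 : ℝ) ≤ K := K.2
      linarith

/-- Absolutely continuous curves whose velocity grows at most linearly are bounded on bounded
intervals. -/
lemma norm_sq_le_of_linear_growth {n : Type*} [Fintype n] {x x' : ℝ → EuclideanSpace ℝ n}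
    {s r c : ℝ} (hc : 0 ≤ c) (hsr : s ≤ r) (hx : AbsolutelyContinuousOnInterval x s r)
    (hx' : ∀ᵐ t, t ∈ Ioo s r → HasDerivAt x (x' t) t ∧ ‖x' t‖ ≤ c * (1 + ‖x t‖)) :
    1 + ‖x r‖ ^ 2 ≤ Real.exp (4 * c * (r - s)) * (1 + ‖x s‖ ^ 2) := by
  have hexp : AbsolutelyContinuousOnInterval (fun t => Real.exp (-(4 * c) * t)) s r :=
    ((Real.contDiff_exp.comp (contDiff_const.mul contDiff_id)).contDiffOn
      (n := 1)).absolutelyContinuousOnInterval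
  have hsq : AbsolutelyContinuousOnInterval (fun t => 1 + ‖x t‖ ^ 2) s r :=
    absolutelyContinuousOnInterval_comp_contDiff (g := fun y => 1 + ‖y‖ ^ 2)
      (contDiff_const.add (contDiff_norm_sq ℝ)) hx
  -- The derivative of 1 + |x|² is at most 2c|x|(1 + |x|) ≤ 4c(1 + |x|²), which the integrating
  -- factor e^{-4ct} compensates.
  have key := le_of_ae_hasDerivAt_nonpos (f' := fun t =>
      Real.exp (-(4 * c) * t) * (-(4 * c) * 1) * (1 + ‖x t‖ ^ 2) +
        Real.exp (-(4 * c) * t) * (2 * inner ℝ (x t) (x' t))) hsr (hexp.fun_mul hsq) (by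
    filter_upwards [hx'] with t ht hmem
    obtain ⟨h1, h2⟩ := ht hmem
    refine ⟨(((hasDerivAt_id t).const_mul (-(4 * c))).exp).mul (h1.norm_sq.const_add 1), ?_⟩
    rw [mul_assoc, ← mul_add]
    refine mul_nonpos_of_nonneg_of_nonpos (Real.exp_pos _).le ?_
    have h3 : inner ℝ (x t) (x' t) ≤ ‖x t‖ * (c * (1 + ‖x t‖)) :=
      (real_inner_le_norm _ _).trans (by gcongr)
    have h4 : ‖x t‖ * (1 + ‖x t‖) ≤ 2 * (1 + ‖x t‖ ^ 2) := by
      nlinarith [sq_nonneg (‖x t‖ - 1)]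
    have h5 := mul_le_mul_of_nonneg_left h4 hc
    linarith)
  have h6 := mul_le_mul_of_nonneg_left key (Real.exp_pos (4 * c * r)).le
  rw [← mul_assoc, ← mul_assoc, ← Real.exp_add, ← Real.exp_add] at h6
  rwa [show 4 * c * r + -(4 * c) * r = 0 by ring, Real.exp_zero, one_mul,
    show 4 * c * r + -(4 * c) * s = 4 * c * (r - s) by ring] at h6

/-- A solution whose last interval is bounded and does not contain its supremum can be
continued. -/
lemma not_isMaximal_of_Ico {n m : Type*} [Fintype n] [Fintype m] {𝓗 : HybridSystem n m}
    {φ : ℝ → ℕ → EuclideanSpace ℝ n} {u : ℝ → ℕ → EuclideanSpace ℝ m}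
    (hf : IsLip fun p : EuclideanSpace ℝ n × EuclideanSpace ℝ m => 𝓗.f p.1 p.2)
    {t : ℕ → ℝ} (h0 : t 0 = 0) (hm : Monotone t) {J : ℕ} {r : ℝ} (hr : t J < r)
    (hsol : 𝓗.IsSolutionPair (lastDomain t J (Ico (t J) r)) φ u) :
    ¬ 𝓗.IsMaximal (lastDomain t J (Ico (t J) r)) φ u := by
  have hslice : slice (lastDomain t J (Ico (t J) r)) J = Ico (t J) r := slice_lastDomain_last
  obtain ⟨M, hM⟩ := (hsol.input J).2 r
  rw [hslice] at hM
  obtain ⟨c, hc, hgrow⟩ := exists_growth_bound hf M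
  have hsub : ∀ {a b}, t J ≤ a → b < r → Icc a b ⊆ slice (lastDomain t J (Ico (t J) r)) J := by
    intro a b ha hb y hy
    rw [hslice]
    exact ⟨ha.trans hy.1, hy.2.trans_lt hb⟩
  have hflow : ∀ {a b}, t J ≤ a → b < r → ∀ᵐ s, s ∈ Ioo a b →
      HasDerivAt (fun s => φ s J) (𝓗.f (φ s J) (u s J)) s ∧
      ‖𝓗.f (φ s J) (u s J)‖ ≤ c * (1 + ‖φ s J‖) := by
    intro a b ha hb
    filter_upwards [hsol.ae_flow (hsub ha hb), hM] with s hs hMs hmem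
    exact ⟨hs hmem, hgrow _ _ (hMs ⟨ha.trans hmem.1.le, hmem.2.trans hb⟩ (hmem.2.trans hb).le)⟩
  -- Since |x| ≤ 1 + |x|², this bounds the state up to r. The velocity is then bounded, so the arc
  -- is Lipschitz on [t J, r).
  set R := Real.exp (4 * c * (r - t J)) * (1 + ‖φ (t J) J‖ ^ 2) with hR
  have hbound : ∀ s ∈ Ico (t J) r, ‖φ s J‖ ≤ R := by
    intro s hs
    have h1 := norm_sq_le_of_linear_growth hc hs.1 (hsol.ac hs.1 (hsub le_rfl hs.2))
      (hflow le_rfl hs.2)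
    have h2 : Real.exp (4 * c * (s - t J)) * (1 + ‖φ (t J) J‖ ^ 2) ≤ R := by
      rw [hR]; gcongr; exact hs.2.le
    nlinarith [sq_nonneg (‖φ s J‖ - 1)]
  have hlip : LipschitzOnWith (c * (1 + R)).toNNReal (fun s => φ s J) (Ico (t J) r) := by
    have hle : ∀ a ∈ Ico (t J) r, ∀ b ∈ Ico (t J) r, a ≤ b →
        ‖φ b J - φ a J‖ ≤ c * (1 + R) * (b - a) := by
      intro a ha b hb hab
      refine norm_sub_le_of_ae_hasDerivAt
        (f := fun s => φ s J) (f' := fun s => 𝓗.f (φ s J) (u s J)) hab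
        (hsol.ac hab (hsub ha.1 hb.2)) ?_
      filter_upwards [hflow ha.1 hb.2] with s hs hmem
      refine ⟨(hs hmem).1, (hs hmem).2.trans ?_⟩
      gcongr
      exact hbound s ⟨ha.1.trans hmem.1.le, hmem.2.trans hb.2⟩
    refine LipschitzOnWith.of_dist_le_mul fun a ha b hb => ?_
    refine le_trans ?_ (mul_le_mul_of_nonneg_right (Real.le_coe_toNNReal _) dist_nonneg)
    rcases le_total a b with hab | hab
    · rw [dist_comm, dist_comm a b, dist_eq_norm, Real.dist_eq, abs_of_nonneg (by linarith)]
      exact hle a ha b hb hab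
    · rw [dist_eq_norm, Real.dist_eq, abs_of_nonneg (by linarith)]
      exact hle b hb a ha hab
  -- Only the value of the Lipschitz extension at r is new; adding that one point already
  -- contradicts maximality.
  obtain ⟨x, hx, heq⟩ := hlip.extend_finite_dimension
  have hinput := (hsol.input J).1
  rw [hslice] at hinput
  refine not_isMaximal_of_extend_last h0 hm (r := r) hsol ⟨le_rfl, hr⟩
    ⟨Ico_subset_Icc_self, fun hcon => ?_⟩ (fun s hs => (heq hs).symm)
    (v := fun s => u s J) (fun s _ => rfl) hx.lipschitzOnWith.absolutelyContinuousOnInterval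
    ?_ ?_ ?_ ?_
  · exact lt_irrefl r (hcon ⟨hr.le, le_rfl⟩).2
  · intro s hs
    rw [← heq ⟨hs.1.le, hs.2⟩]
    refine hsol.flow_mem J s ?_
    rwa [hslice, interior_Ico]
  · filter_upwards [hsol.flow J] with s hs hmem
    rw [hslice, interior_Ico] at hs
    rw [← heq ⟨hmem.1.le, hmem.2⟩]
    refine (hs hmem).congr_of_eventuallyEq ?_
    filter_upwards [Ioo_mem_nhds hmem.1 hmem.2] with y hy using (heq ⟨hy.1.le, hy.2⟩).symm
  · rwa [Measure.restrict_congr_set Ico_ae_eq_Icc] at hinput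
  · refine ⟨M, ?_⟩
    have hnull : ∀ᵐ s : ℝ, s ≠ r := by simp [ae_iff]
    filter_upwards [hM, hnull] with s hs hne hmem
    exact hs ⟨hmem.1, lt_of_le_of_ne hmem.2 hne⟩ hmem.2

/-- Maximal solutions of the error system are complete. -/
lemma isCompleteDomain_of_isMaximal {ℓ : ℝ}
    (hψ : ∀ v₁ v₂ : Vec nq, ‖P.ψ v₁ - P.ψ v₂‖ ≤ ℓ * ‖v₁ - v₂‖) (hT₁ : 0 < T₁) (hT : T₁ ≤ T₂)
    {E : Set (ℝ × ℕ)} (hmax : (P.errorSystem T₁ T₂ L H).IsMaximal E φ u) :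
    HybridSystem.IsCompleteDomain E := by
  have hsol := hmax.1
  intro R
  by_contra! hR
  obtain ⟨t, h0, hm, rfl | ⟨J, I, hI, hE⟩⟩ := hsol.domain
  · obtain ⟨N, hN⟩ := exists_nat_ge R
    have h1 : 0 ≤ t N := h0.symm.le.trans (hm (Nat.zero_le N))
    have := hR (t N, N) ⟨le_rfl, hm (Nat.le_succ N)⟩
    dsimp only at this
    linarith
  change E = lastDomain t J I at hE
  subst hE
  rcases hI with rfl | ⟨hlt, rfl⟩ | rfl
  · have hr : t J ≤ t (J + 1) := hm (Nat.le_succ J)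
    have hrE : (t (J + 1), J) ∈ lastDomain t J (Icc (t J) (t (J + 1))) := Or.inr ⟨rfl, hr, le_rfl⟩
    -- The timer is nonnegative at the final time: a jump is possible if it vanishes, and a further
    -- flow if it is positive.
    rcases (timer_mem hT₁ hT hsol hrE).1.eq_or_lt with hτ | hτ
    · exact not_isMaximal_of_jump h0 hm hr hsol hτ.symm ⟨T₁, ⟨le_rfl, hT⟩, rfl⟩ hmax
    · exact not_isMaximal_of_timer_pos hψ hT₁ hT h0 hm hr hsol hτ hmax
  · exact not_isMaximal_of_Ico (isLip_errorSystem_f P T₁ T₂ L H hψ) h0 hm hlt hsol hmax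
  · have := hR (max (t J) R, J) (Or.inr ⟨rfl, mem_Ici.2 (le_max_left _ _)⟩)
    dsimp only at this
    have h1 := le_max_right (t J) R
    have h2 : (0 : ℝ) ≤ J := Nat.cast_nonneg J
    linarith

end Completeness

/-! ### The sampled-data loop as a hybrid solution -/

section Sampled

lemma _root_.HasDerivAt.stack {ι κ : Type*} [Fintype ι] [Fintype κ]
    {f : ℝ → EuclideanSpace ℝ ι} {g : ℝ → EuclideanSpace ℝ κ} {f' : EuclideanSpace ℝ ι}
    {g' : EuclideanSpace ℝ κ} {s : ℝ} (hf : HasDerivAt f f' s) (hg : HasDerivAt g g' s) :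
    HasDerivAt (fun s => SporadicObserver.stack (f s) (g s)) (SporadicObserver.stack f' g') s :=
  (stackL (ι := ι) (κ := κ)).hasFDerivAt.comp_hasDerivAt s (hf.prodMk hg)

lemma absolutelyContinuousOnInterval_stack {ι κ : Type*} [Fintype ι] [Fintype κ]
    {f : ℝ → EuclideanSpace ℝ ι} {g : ℝ → EuclideanSpace ℝ κ} {a b : ℝ}
    (hf : AbsolutelyContinuousOnInterval f a b) (hg : AbsolutelyContinuousOnInterval g a b) :
    AbsolutelyContinuousOnInterval (fun s => stack (f s) (g s)) a b := by
  have h1 := absolutelyContinuousOnInterval_comp_contDiff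
    ((stackL (ι := ι) (κ := κ)).comp (ContinuousLinearMap.inl ℝ _ _)).contDiff hf
  have h2 := absolutelyContinuousOnInterval_comp_contDiff
    ((stackL (ι := ι) (κ := κ)).comp (ContinuousLinearMap.inr ℝ _ _)).contDiff hg
  refine absolutelyContinuousOnInterval_congr (h1.fun_add h2) fun s _ => ?_
  change stackL (f s, 0) + stackL (0, g s) = stackL (f s, g s)
  rw [← map_add, Prod.mk_add_mk, add_zero, zero_add]

/-- A real number as a vector. -/
def scalarL : ℝ →L[ℝ] EuclideanSpace ℝ Unit :=
  LinearMap.toContinuousLinearMap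
    { toFun := fun τ => WithLp.toLp 2 fun _ => τ
      map_add' := fun _ _ => rfl
      map_smul' := fun _ _ => rfl }

lemma norm_stack_zero_right {ι κ : Type*} [Fintype ι] [Fintype κ] (x : EuclideanSpace ℝ ι) :
    ‖stack x (0 : EuclideanSpace ℝ κ)‖ = ‖x‖ := by
  rw [← sq_eq_sq₀ (norm_nonneg _) (norm_nonneg _), norm_sq_eq_upper_add_lower]
  simp

lemma eq_of_hasDerivAt_zero {n : ℕ} {f : ℝ → Vec n} {a b : ℝ} (hab : a ≤ b)
    (hc : ContinuousOn f (Icc a b)) (hd : ∀ s ∈ Ioo a b, HasDerivAt f 0 s) : f a = f b := by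
  rcases hab.eq_or_lt with rfl | hlt
  · rfl
  ext i
  obtain ⟨c, -, hc⟩ := exists_hasDerivAt_eq_slope (fun s => f s i) (fun _ => 0) hlt
    ((EuclideanSpace.proj (𝕜 := ℝ) i).continuous.comp_continuousOn hc)
    (fun s hs =>
      ((EuclideanSpace.proj (𝕜 := ℝ) i).hasFDerivAt.comp_hasDerivAt s (hd s hs)).congr_deriv
        (map_zero _))
  rw [eq_comm, div_eq_zero_iff] at hc
  rcases hc with hc | hc <;> linarith

variable {nz ny nw nq ns np : ℕ} {P : Plant nz ny nw nq ns np} {T₁ T₂ lamt γ δ a b k : ℝ}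
  {L : Matrix (Fin nz) (Fin ny) ℝ} {P₁ : Matrix (Fin nz) (Fin nz) ℝ}
  {P₂ : Matrix (Fin ny) (Fin ny) ℝ}
  {t : ℕ → ℝ} {w : ℝ → Vec nw} {η : ℝ → Vec ny} {z zhat : ℝ → Vec nz} {θ : ℝ → Vec ny}

lemma IsSamplingSequence.monotone (hT₁ : 0 < T₁) (ht : IsSamplingSequence T₁ T₂ t) :
    Monotone t := by
  refine monotone_nat_of_le_succ fun j => ?_
  rcases Nat.eq_zero_or_pos j with rfl | hj
  · rw [ht.1]; exact ht.2.1.1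
  · linarith [(ht.2.2 j hj).1]

lemma IsSamplingSequence.nonneg (hT₁ : 0 < T₁) (ht : IsSamplingSequence T₁ T₂ t) (j : ℕ) :
    0 ≤ t j :=
  ht.1.symm.le.trans (ht.monotone hT₁ (Nat.zero_le j))

lemma IsSamplingSequence.sub_le (ht : IsSamplingSequence T₁ T₂ t) (j : ℕ) :
    t (j + 1) - t j ≤ T₂ := by
  rcases Nat.eq_zero_or_pos j with rfl | hj
  · rw [ht.1, sub_zero]; exact ht.2.1.2
  · exact (ht.2.2 j hj).2

/-- Since t (j + 1) ≥ j T₁ the sampling times are unbounded, and the least j with s ≤ t (j + 1)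
works. The strict inequality for j ≥ 1 matters because θ is left-continuous: at t j it still has its
value before the sample. -/
lemma IsSamplingSequence.exists_index (hT₁ : 0 < T₁) (ht : IsSamplingSequence T₁ T₂ t) {s : ℝ}
    (hs : 0 ≤ s) : ∃ j, s ∈ Icc (t j) (t (j + 1)) ∧ (t j < s ∨ j = 0) := by
  have hgrow : ∀ j : ℕ, j * T₁ ≤ t (j + 1) := by
    intro j
    induction j with
    | zero => simpa using ht.2.1.1
    | succ j ih =>
      have := (ht.2.2 (j + 1) (by omega)).1
      push_cast
      linarith
  have hex : ∃ j, s ≤ t (j + 1) := by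
    obtain ⟨j, hj⟩ := exists_nat_ge (s / T₁)
    exact ⟨j, ((div_le_iff₀ hT₁).1 hj).trans (hgrow j)⟩
  classical
  refine ⟨Nat.find hex, ?_⟩
  rcases Nat.eq_zero_or_pos (Nat.find hex) with h0 | hpos
  · refine ⟨⟨?_, Nat.find_spec hex⟩, Or.inr h0⟩
    rw [h0, ht.1]; exact hs
  · have := Nat.find_min hex (Nat.sub_lt hpos one_pos)
    rw [Nat.sub_add_cancel (Nat.one_le_iff_ne_zero.2 hpos.ne'), not_le] at this
    exact ⟨⟨this.le, Nat.find_spec hex⟩, Or.inl this⟩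

/-- The hold state `θ` is constant between samples. -/
lemma IsTrajectory.hold_eq (h : IsTrajectory P L 0 t w η z zhat θ) (h0 : t 0 = 0)
    {j : ℕ} {s : ℝ} (hs : s ∈ Icc (t j) (t (j + 1))) (hs' : t j < s ∨ j = 0) :
    θ s = θ (t (j + 1)) := by
  refine eq_of_hasDerivAt_zero hs.2 ?_ fun x hx => ?_
  · rcases Nat.eq_zero_or_pos j with rfl | hj
    · refine h.θ_init.mono (Icc_subset_Icc_left ?_)
      rw [← h0]; exact hs.1
    · have hlt : t j < s := hs'.resolve_right hj.ne'
      exact (h.θ_cont j hj).mono fun x hx => ⟨hlt.trans_le hx.1, hx.2⟩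
  · have := h.θ_flow j x ⟨hs.1.trans_lt hx.1, hx.2⟩
    have h0 : mv (0 : Matrix (Fin ny) (Fin ny) ℝ) (θ x) = 0 := by
      ext i; simp [mv]
    rwa [h0] at this

/-- The hybrid time domain of a sampling sequence. -/
def samplingDomain (t : ℕ → ℝ) : Set (ℝ × ℕ) := {p | p.1 ∈ Icc (t p.2) (t (p.2 + 1))}

/-- The hybrid arc of a trajectory of the sampled-data system. -/
def sampledArc (P : Plant nz ny nw nq ns np) (t : ℕ → ℝ) (z zhat : ℝ → Vec nz) (θ : ℝ → Vec ny)
    (s : ℝ) (j : ℕ) : EuclideanSpace ℝ (StateIx nz ny) :=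
  mkState (z s) (stack (z s - zhat s) (mv P.C (z s - zhat s) - θ (t (j + 1)))) (t (j + 1) - s)

open Classical in
/-- The hybrid input of a trajectory of the sampled-data system: `w` off the sampling times, `η`
at the sampling times. -/
def sampledInput (t : ℕ → ℝ) (w : ℝ → Vec nw) (η : ℝ → Vec ny) (s : ℝ) (j : ℕ) :
    EuclideanSpace ℝ (Fin nw ⊕ Fin ny) :=
  if s = t (j + 1) then stack 0 (η s) else stack (w s) 0

lemma sampledInput_of_eq {s : ℝ} {j : ℕ} (h : s = t (j + 1)) :
    sampledInput t w η s j = stack 0 (η s) := if_pos h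

lemma sampledInput_of_ne {s : ℝ} {j : ℕ} (h : s ≠ t (j + 1)) :
    sampledInput t w η s j = stack (w s) 0 := if_neg h

lemma eq_of_mem_samplingDomain_succ {s : ℝ} {j : ℕ} (h₁ : (s, j) ∈ samplingDomain t)
    (h₂ : (s, j + 1) ∈ samplingDomain t) : s = t (j + 1) := le_antisymm h₁.2 h₂.1

/-- The error dynamics along the plant and the observer. -/
lemma errField_stack (z zhat : Vec nz) (θ : Vec ny) (w : Vec nw) :
    errField P L z (stack (z - zhat) (mv P.C (z - zhat) - θ)) w =
      stack ((mv P.A z + mv P.B (P.ψ (mv P.S z)) + mv P.N w) -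
          (mv P.A zhat + mv P.B (P.ψ (mv P.S zhat)) + mv L θ))
        (mv P.C ((mv P.A z + mv P.B (P.ψ (mv P.S z)) + mv P.N w) -
          (mv P.A zhat + mv P.B (P.ψ (mv P.S zhat)) + mv L θ))) := by
  set d := (mv P.A z + mv P.B (P.ψ (mv P.S z)) + mv P.N w) -
          (mv P.A zhat + mv P.B (P.ψ (mv P.S zhat)) + mv L θ) with hd
  set e := stack (z - zhat) (mv P.C (z - zhat) - θ)
  have hup : (upper (errField P L z e w)).ofLp = d.ofLp := by
    rw [upper_errField]
    simp only [e, hd, upper_stack, lower_stack, Plant.zeta, sub_sub_cancel, mv, WithLp.ofLp_sub,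
      WithLp.ofLp_add, Matrix.mulVec_sub]
    abel
  have hlow := lower_errField P L z e w
  rw [hup] at hlow
  rw [← stack_eta (errField P L z e w)]
  have h1 : upper (errField P L z e w) = d := by ext i; exact congrFun hup i
  have h2 : lower (errField P L z e w) = mv P.C d := by ext i; exact congrFun hlow i
  rw [h1, h2]

/-- A trajectory of the sampled-data system is a solution pair of the hybrid model. -/
lemma IsTrajectory.isSolutionPair (hT₁ : 0 < T₁) (ht : IsSamplingSequence T₁ T₂ t)
    (h : IsTrajectory P L 0 t w η z zhat θ) :
    (P.errorSystem T₁ T₂ L 0).IsSolutionPair (samplingDomain t) (sampledArc P t z zhat θ)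
      (sampledInput t w η) := by
  have hslice : ∀ j, slice (samplingDomain t) j = Icc (t j) (t (j + 1)) := fun j => rfl
  have hnull : ∀ j, ∀ᵐ s : ℝ, s ≠ t (j + 1) := fun j => by simp [ae_iff]
  refine ⟨⟨t, ht.1, ht.monotone hT₁, Or.inl rfl⟩, fun j => ?_, fun j => ?_, Or.inl ?_,
    fun j => ?_, fun j => ?_, fun s j h1 h2 => ?_⟩
  · rw [hslice]
    constructor
    · have hw : AEMeasurable (fun s => stack (w s) (0 : Vec ny))
          (volume.restrict (Icc (t j) (t (j + 1)))) := by
        have := (stackL.comp (ContinuousLinearMap.inl ℝ (Vec nw) (Vec ny))).continuous.measurable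
          |>.comp_aemeasurable (h.w_meas.mono_measure (Measure.restrict_mono_set volume
            fun s (hs : s ∈ Icc (t j) (t (j + 1))) => (ht.nonneg hT₁ j).trans hs.1))
        exact this
      -- On one slice the input differs from (w, 0) only at the next sampling time, where it carries
      -- η; this is a null set.
      refine hw.congr ?_
      filter_upwards [ae_restrict_of_ae (hnull j)] with s hs
      exact (sampledInput_of_ne hs).symm
    · intro T
      obtain ⟨M, hM⟩ := h.w_bdd (t (j + 1))
      refine ⟨M, ?_⟩
      filter_upwards [hM, hnull j] with s hs hne hmem _
      rw [sampledInput_of_ne hne, norm_stack_zero_right]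
      exact hs ⟨(ht.nonneg hT₁ j).trans hmem.1, hmem.2⟩
  · rw [hslice]
    intro r q hrq hsub
    have hr : t j ≤ r := (hsub ⟨le_rfl, hrq⟩).1
    have hpos : Icc r q ⊆ Ici 0 := fun s hs => (ht.nonneg hT₁ j).trans (hr.trans hs.1)
    have hz := h.z_ac r q hrq hpos
    have hzh := h.zhat_ac r q hrq hpos
    have hε := hz.fun_sub hzh
    -- The arc uses the constant θ (t (j + 1)), the held value on (t j, t (j + 1)], rather than θ s.
    -- This makes it continuous up to the left endpoint, where it represents the state after the
    -- sample.
    have hC := (absolutelyContinuousOnInterval_comp_contDiff (mvL P.C).contDiff hε).fun_sub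
      ((LipschitzWith.const (θ (t (j + 1)))).lipschitzOnWith.absolutelyContinuousOnInterval)
    have hτ : AbsolutelyContinuousOnInterval (fun s => scalarL (t (j + 1) - s)) r q :=
      ((scalarL.contDiff.comp (contDiff_const.sub contDiff_id)).contDiffOn
        (n := 1)).absolutelyContinuousOnInterval
    exact absolutelyContinuousOnInterval_stack hz (absolutelyContinuousOnInterval_stack
      (absolutelyContinuousOnInterval_stack hε hC) hτ)
  · change t (0 + 1) - 0 ∈ Icc 0 T₂
    simpa using ht.2.1
  · rw [hslice, interior_Icc]
    intro s hs
    change t (j + 1) - s ∈ Icc 0 T₂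
    have := ht.sub_le j
    exact ⟨by linarith [hs.2], by linarith [hs.1]⟩
  · rw [hslice, interior_Icc]
    filter_upwards [h.z_flow, h.zhat_flow] with s hz hzh hmem
    have hs0 : 0 < s := (ht.nonneg hT₁ j).trans_lt hmem.1
    have hz := hz hs0
    have hzh := hzh hs0
    have hε := hz.sub hzh
    have hC := ((mvL P.C).hasFDerivAt.comp_hasDerivAt s hε).sub_const (θ (t (j + 1)))
    have hτ := scalarL.hasFDerivAt.comp_hasDerivAt s ((hasDerivAt_id s).const_sub (t (j + 1)))
    have hder := hz.stack ((hε.stack hC).stack hτ)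
    refine hder.congr_deriv ?_
    have hθ : θ s = θ (t (j + 1)) :=
      h.hold_eq ht.1 (Ioo_subset_Icc_self hmem) (Or.inl hmem.1)
    have hf := errField_stack (P := P) (L := L) (z s) (zhat s) (θ s) (w s)
    rw [hθ] at hf
    rw [sampledInput_of_ne hmem.2.ne, ← mkState_eta ((P.errorSystem T₁ T₂ L 0).f _ _),
      stE_errorSystem_f, stτ_errorSystem_f, hθ]
    simp only [sampledArc, stE_mkState, stZ_mkState, upper_stack]
    rw [hf]
    rfl
  · have hs := eq_of_mem_samplingDomain_succ h1 h2
    subst hs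
    have hlt : t (j + 1) < t (j + 1 + 1) := by linarith [(ht.2.2 (j + 1) (by omega)).1]
    -- The right limit of θ at the sampling time is computed twice: as the sampled value, and as the
    -- constant held until the next sample. Substituting it gives θ̃⁺ = -η.
    have hhold : θ (t (j + 1 + 1)) = mv P.C (z (t (j + 1))) + η (t (j + 1)) -
        mv P.C (zhat (t (j + 1))) := by
      refine tendsto_nhds_unique ?_ (h.θ_jump (j + 1) (by omega))
      refine tendsto_const_nhds.congr' ?_
      filter_upwards [Ioo_mem_nhdsGT hlt] with s hs
      exact (h.hold_eq ht.1 (Ioo_subset_Icc_self hs) (Or.inl hs.1)).symm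
    refine ⟨sub_self _, t (j + 1 + 1) - t (j + 1), ht.2.2 (j + 1) (by omega), ?_⟩
    rw [sampledInput_of_eq rfl]
    simp only [sampledArc, stE_mkState, stZ_mkState, lower_stack, hhold]
    congr 1
    ext (i | i)
    · simp [mv, stack, Matrix.fromBlocks_mulVec, Matrix.fromRows_mulVec]
    · simp [mv, stack, Matrix.fromBlocks_mulVec, Matrix.fromRows_mulVec, Matrix.neg_mulVec,
        Matrix.mulVec_sub]

/-- The arc and the trajectory agree where θ equals its held value. At t j with j ≥ 1 the arc of
index j is already past the jump, so this point is left to index j - 1. -/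
lemma IsTrajectory.errNorm_eq (h : IsTrajectory P L 0 t w η z zhat θ) (h0 : t 0 = 0)
    {j : ℕ} {s : ℝ} (hs : s ∈ Icc (t j) (t (j + 1))) (hs' : t j < s ∨ j = 0) :
    errNorm P (z s) (zhat s) (θ s) = ‖stE (sampledArc P t z zhat θ s j)‖ := by
  rw [errNorm, h.hold_eq h0 hs hs', sampledArc, stE_mkState]

lemma IsTrajectory.errNorm_zero_eq (hT₁ : 0 < T₁) (ht : IsSamplingSequence T₁ T₂ t)
    (h : IsTrajectory P L 0 t w η z zhat θ) :
    errNorm P (z 0) (zhat 0) (θ 0) = ‖stE (sampledArc P t z zhat θ 0 0)‖ :=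
  h.errNorm_eq ht.1 ⟨ht.1.le, ht.nonneg hT₁ 1⟩ (Or.inr rfl)

/-- Input-to-state estimate for the sampled-data system. -/
lemma IsDissipative.sampled_le (h : IsDissipative P T₁ T₂ lamt γ L P₁ P₂ δ a b k)
    (ht : IsSamplingSequence T₁ T₂ t) (htr : IsTrajectory P L 0 t w η z zhat θ) {W : ℝ}
    (hW : 0 ≤ W) (hw : ∀ᵐ s ∂(volume : Measure ℝ), 0 ≤ s → ‖w s‖ ≤ W)
    (hη : ∀ k : ℕ, 1 ≤ k → ‖η (t k)‖ ≤ W) {s : ℝ} (hs : 0 ≤ s) :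
    errNorm P (z s) (zhat s) (θ s) ≤
      max (√(2 * b / a) * Real.exp (-lamt * s) * errNorm P (z 0) (zhat 0) (θ 0))
        (√(2 * lyapGain T₁ T₂ lamt γ k / a) * W) := by
  obtain ⟨j, hj, hj'⟩ := ht.exists_index h.T₁_pos hs
  rw [htr.errNorm_eq ht.1 hj hj', htr.errNorm_zero_eq h.T₁_pos ht]
  refine h.norm_le_of_input (htr.isSolutionPair h.T₁_pos ht) hW (fun i => ?_)
    (fun r i h1 h2 => ?_) hj
  · have hnull : ∀ᵐ r : ℝ, r ≠ t (i + 1) := by simp [ae_iff]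
    filter_upwards [hw, hnull] with r hr hne hmem
    rw [sampledInput_of_ne hne, upper_stack]
    have hm : r ∈ slice (samplingDomain t) i := interior_subset hmem
    exact hr ((ht.nonneg h.T₁_pos i).trans hm.1)
  · have hr := eq_of_mem_samplingDomain_succ h1 h2
    rw [sampledInput_of_eq hr, lower_stack, hr]
    exact hη (i + 1) (by omega)

lemma timeProj_samplingDomain (hT₁ : 0 < T₁) (ht : IsSamplingSequence T₁ T₂ t) :
    timeProj (samplingDomain t) = Ici 0 := by
  ext s
  constructor
  · rintro ⟨j, hj⟩
    exact (ht.nonneg hT₁ j).trans hj.1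
  · intro hs
    obtain ⟨j, hj, -⟩ := ht.exists_index hT₁ hs
    exact ⟨j, hj⟩

/-- The `ℒ₂`-gain estimate for the sampled-data system. -/
lemma IsDissipative.sampled_gain (h : IsDissipative P T₁ T₂ lamt γ L P₁ P₂ δ a b k)
    (ht : IsSamplingSequence T₁ T₂ t) (htr : IsTrajectory P L 0 t w η z zhat θ)
    (hη : ∀ s : ℝ, 0 ≤ s → η s = 0) :
    (∫⁻ s in Ici (0 : ℝ), ‖mv P.Cp (z s - zhat s)‖ₑ ^ 2) ^ (1 / 2 : ℝ) ≤
      ENNReal.ofReal (√b * errNorm P (z 0) (zhat 0) (θ 0)) +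
        ENNReal.ofReal γ * (∫⁻ s in Ici (0 : ℝ), ‖w s‖ₑ ^ 2) ^ (1 / 2 : ℝ) := by
  have hsol := htr.isSolutionPair h.T₁_pos ht
  have key := h.gain hsol (by
    rintro ⟨s, j⟩ hs
    dsimp only
    by_cases hsj : s = t (j + 1)
    · rw [sampledInput_of_eq hsj, lower_stack, hη s ((ht.nonneg h.T₁_pos j).trans hs.1)]
    · rw [sampledInput_of_ne hsj, lower_stack])
  rw [infDist_attractor (timer_mem h.T₁_pos h.T₁_le hsol hsol.domain.zero_mem),
    ← htr.errNorm_zero_eq h.T₁_pos ht, timeProj_samplingDomain h.T₁_pos ht] at key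
  refine key.trans ?_
  -- Replacing the hybrid input by w is only an inequality pointwise, since the w-part of the hybrid
  -- input is 0 at sampling times.
  gcongr with s
  by_cases hsj : s = t (firstIndex (samplingDomain t) s + 1)
  · rw [sampledInput_of_eq hsj, upper_stack]; simp
  · rw [sampledInput_of_ne hsj, upper_stack]

end Sampled

/-! ### Assembly of the design properties -/

lemma IsDissipative.solvesProblem {nz ny nw nq ns np : ℕ} {P : Plant nz ny nw nq ns np}
    {ℓ T₁ T₂ lamt γ δ a b k : ℝ} {L : Matrix (Fin nz) (Fin ny) ℝ}
    {P₁ : Matrix (Fin nz) (Fin nz) ℝ} {P₂ : Matrix (Fin ny) (Fin ny) ℝ}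
    (hψ : ∀ v₁ v₂ : Vec nq, ‖P.ψ v₁ - P.ψ v₂‖ ≤ ℓ * ‖v₁ - v₂‖)
    (h : IsDissipative P T₁ T₂ lamt γ L P₁ P₂ δ a b k) :
    SolvesProblem P T₁ T₂ lamt γ L 0 := by
  have ha := h.a_pos
  have hb := h.b_pos
  have hg := h.lyapGain_pos
  refine ⟨⟨h.iss_estimate, fun E φ u hmax =>
      isCompleteDomain_of_isMaximal hψ h.T₁_pos h.T₁_le hmax⟩,
    ⟨√(2 * b / a), by positivity, fun E φ u hsol hu t j hs => h.rate hsol hu hs⟩,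
    ⟨√b, by positivity, fun E φ u hsol hη => h.gain hsol hη⟩,
    ⟨√(2 * b / a), by positivity, fun t w η z zhat θ ht htr hw hη s hs => ?_⟩,
    ⟨√(2 * b / a), fun W => √(2 * lyapGain T₁ T₂ lamt γ k / a) * W, by positivity,
      isClassK_linear (by positivity), fun t w η z zhat θ ht htr W hW hw hη s hs => ?_⟩,
    ⟨√b, by positivity, fun t w η z zhat θ ht htr hη => h.sampled_gain ht htr hη⟩⟩
  · have := h.sampled_le ht htr le_rfl
      (ae_of_all _ fun s hs => by rw [hw s hs, norm_zero])
      (fun k _ => by rw [hη _ (ht.nonneg h.T₁_pos k), norm_zero]) hs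
    rwa [mul_zero, max_eq_left (by unfold errNorm; positivity)] at this
  · refine (h.sampled_le ht htr hW hw hη hs).trans (max_le_max_right _ ?_)
    have hle : Real.exp (-lamt * s) ≤ 1 := by
      rw [Real.exp_le_one_iff]
      nlinarith [h.lamt_pos]
    have h0 : 0 ≤ errNorm P (z 0) (zhat 0) (θ 0) := norm_nonneg _
    calc _ ≤ √(2 * b / a) * 1 * errNorm P (z 0) (zhat 0) (θ 0) := by gcongr
      _ = _ := by rw [mul_one]

end SporadicObserver

end

theorem proposition5 {nz ny nw nq ns np : ℕ} (P : SporadicObserver.Plant nz ny nw nq ns np)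
    (ℓ T₁ T₂ lamt γ : ℝ) (hℓ : 0 < ℓ)
    (hψ : ∀ v₁ v₂ : SporadicObserver.Vec nq, ‖P.ψ v₁ - P.ψ v₂‖ ≤ ℓ * ‖v₁ - v₂‖)
    (hT₁ : 0 < T₁) (hT : T₁ ≤ T₂) (hlamt : 0 < lamt) (hγ : 0 < γ)
    (P₁ : Matrix (Fin nz) (Fin nz) ℝ) (P₂ : Matrix (Fin ny) (Fin ny) ℝ)
    (hP₁ : P₁.PosDef) (hP₂ : P₂.PosDef) (δ χ : ℝ) (hδ : 0 < δ) (hχ : 0 < χ)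
    (X : Matrix (Fin nz) (Fin nz) ℝ) (hX : IsUnit X)
    (X₅ Y₅ X₇ Y₇ : Matrix (Fin ny) (Fin nz) ℝ) (X₆ Y₆ X₈ Y₈ : Matrix (Fin ny) (Fin ny) ℝ)
    (J : Matrix (Fin nz) (Fin ny) ℝ)
    (hLMI₀ : SporadicObserver.NegDef
      (SporadicObserver.lmiZOH P ℓ lamt γ P₁ P₂ δ χ X J X₅ X₆ X₇ X₈ 0))
    (hLMI₂ : SporadicObserver.NegDef
      (SporadicObserver.lmiZOH P ℓ lamt γ P₁ P₂ δ χ X J Y₅ Y₆ Y₇ Y₈ T₂)) :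
    SporadicObserver.SolvesProblem P T₁ T₂ lamt γ ((Xᵀ)⁻¹ * J) 0 := by
  obtain ⟨a, b, ha, hb, hab⟩ := SporadicObserver.exists_bounds_lyap hP₁ hP₂ hδ T₂
  obtain ⟨k, hk, hjump⟩ := SporadicObserver.exists_lyap_jump_bound P₁ hP₂ hδ T₂
  exact SporadicObserver.IsDissipative.solvesProblem hψ
    { T₁_pos := hT₁, T₁_le := hT, lamt_pos := hlamt, γ_pos := hγ, P₁_pos := hP₁, P₂_pos := hP₂,
      a_pos := ha, b_pos := hb, k_pos := hk
      le_lyap := fun e τ hτ => (hab e τ hτ).1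
      lyap_le := fun e τ hτ => (hab e τ hτ).2
      lyap_jump := hjump
      dissip := fun z e w τ hτ =>
        SporadicObserver.dissipation P hψ hδ hχ hX hLMI₀ hLMI₂ z e w hτ }
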